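/- Let $n\ge 1$, $m \ge 0$ be integers and $0\le\alpha<n$. Cubes are closed, with sides parallel to the coordinate axes; $|Q|$ is Lebesgue measure and $|Q|_\mu=\mu(Q)$. **Operators.** A function $K:\mathbb R^n\times\mathbb R^n\to\mathbb R$ is a standard $\alpha$-fractional Calderón–Zygmund (CZ) kernel with constants $\theta>0$, $C_{CZ}>0$ if for $x\ne y$ $$|K(x,y)|\le C_{CZ}|x-y|^{\alpha-n},\qquad |K(x,y)-K(x',y)|\le C_{CZ}\Big(\frac{|x-x'|}{|x-y|}\Big)^{\theta}|x-y|^{\alpha-n}\ \text{ if } \frac{|x-x'|}{|x-y|}\le\tfrac12,$$ and the same holds for $(x,y)\mapsto K(y,x)$. A standard $\alpha$-fractional CZ operator $T^\alpha$ consists of a vector $K=(K_j)_{1\le j\le m}$ of such kernels and of truncation functions $\eta_{\delta,R}$, $0<\delta<R<\infty$, such that each $\eta_{\delta,R}$ vanishes near $0$ and near $\infty$, the kernels $\eta_{\delta,R}(|x-y|)K_j(x,y)$ are standard kernels with the same constants $\theta,C_{CZ}$ for all $\delta,R$, and $\eta_{\delta,R}(t)\to1$ for each $t>0$ as $\delta\to0$,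 $R\to\infty$. Put $T_{\delta,R}(f\mu)(x)=\int \eta_{\delta,R}(|x-y|)K(x,y)f(y)\,d\mu(y)$. $T^\alpha$ is bounded on unweighted $L^2(\mathbb R^n)$ with norm at most $B$ if $\|T_{\delta,R}f\|_{L^2(dx)}\le B\|f\|_{L^2(dx)}$ for all $f \in L^2$ and all $0<\delta<R<\infty$. $T^\alpha$ is elliptic with constant $c>0$ if for each unit vector $u\in\mathbb R^n$ there is $j$ with $|K_j(x,x+tu)|\ge c\,t^{\alpha-n}$ for all $x\in\mathbb R^n$, $t>0$. **Measures.** A measure $d\omega=w\,dx$ is an $A_\infty$ weight with parameters $0<\varepsilon,\eta<1$ if $|E|_\omega/|Q|_\omega<\eta$ whenever $E$ is a compact subset of a cube $Q$ with $|E|/|Q|<\varepsilon$. Put $$A_2^\alpha(\sigma,\omega)=\sup_Q\frac{|Q|_\sigma}{|Q|^{1-\alpha/n}}\frac{|Q|_\omega}{|Q|^{1-\alpha/n}},\qquad \mathfrak N_{T^\alpha}(\sigma,\omega)=\sup\frac{\left|\int_F T_{\delta,R}(\mathbf 1_E\sigma)\,d\omega\right|}{\sqrt{|E|_\sigma|F|_\omega}},$$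 where the second supremum is over all $0<\delta<R<\infty$, all cubes $Q$ and all compact $E,F\subset Q$ (with $0/0=0$). **Theorem.** Let $\sigma,\omega$ be locally finite positive Borel measures on $\mathbb R^n$, at least one of which is an $A_\infty$ weight, and let $T^\alpha$ be a standard $\alpha$-fractional CZ operator, bounded on unweighted $L^2(\mathbb R^n)$ if $\alpha=0$. If $A_2^\alpha(\sigma,\omega)<\infty$, then the restricted weak type inequality $\mathfrak N_{T^\alpha}(\sigma,\omega)<\infty$ holds. If $T^\alpha$ is elliptic, then conversely $\mathfrak N_{T^\alpha}(\sigma,\omega)<\infty$ implies $A_2^\alpha(\sigma,\omega)<\infty$, and $$\mathfrak N_{T^\alpha}(\sigma,\omega)\le C_1\sqrt{A_2^\alpha(\sigma,\omega)},\qquad \sqrt{A_2^\alpha(\sigma,\omega)}\le C_2\,\mathfrak N_{T^\alpha}(\sigma,\omega),$$ where $0<C_1,C_2<\infty$ depend only on $n,m,\alpha,\theta,C_{CZ}$, the $A_\infty$ parameters $\varepsilon,\eta$ of one of the weights and, for $C_1$ when $\alpha=0$, on the $L^2$ bound $B$ and, for $C_2$, on the ellipticity constant $c$. -/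

import Mathlib

open MeasureTheory Filter Topology
open scoped ENNReal NNReal

noncomputable section

namespace RestrictedWeak

/-- Euclidean space of dimension `n`, with the Euclidean norm and Lebesgue measure. -/
abbrev E (n : ℕ) : Type := EuclideanSpace ℝ (Fin n)

/-- The closed cube with sides parallel to the coordinate axes, lower corner `a` and
side length `l`. -/
def cube {n : ℕ} (a : E n) (l : ℝ) : Set (E n) :=
  {x | ∀ i, a i ≤ x i ∧ x i ≤ a i + l}

/-- The classical `α`-fractional Muckenhoupt constant: the supremum over all cubes `Q` of
`(|Q|_σ / |Q|^(1 - α/n)) * (|Q|_ω / |Q|^(1 - α/n))`. -/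
def muckenhoupt {n : ℕ} (α : ℝ) (σ ω : Measure (E n)) : ℝ≥0∞ :=
  ⨆ (a : E n) (l : ℝ) (_ : 0 < l),
    σ (cube a l) / volume (cube a l) ^ (1 - α / n) *
      (ω (cube a l) / volume (cube a l) ^ (1 - α / n))

/-- `ω` is an `A_∞` weight with parameters `ε, η`: it is absolutely continuous with a density
`w`, and for every cube `Q` and every compact `A ⊆ Q`, `|A| / |Q| < ε` implies
`|A|_ω / |Q|_ω < η`. -/
def IsAInftyWith {n : ℕ} (ε η : ℝ) (ω : Measure (E n)) : Prop :=
  (∃ w : E n → ℝ≥0∞, Measurable w ∧ ω = volume.withDensity w) ∧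
    ∀ (a : E n) (l : ℝ), 0 < l → ∀ A : Set (E n), IsCompact A → A ⊆ cube a l →
      volume A < ENNReal.ofReal ε * volume (cube a l) →
      ω A < ENNReal.ofReal η * ω (cube a l)

/-- `ω` is an `A_∞` weight. -/
def IsAInfty {n : ℕ} (ω : Measure (E n)) : Prop :=
  ∃ ε η : ℝ, 0 < ε ∧ ε < 1 ∧ 0 < η ∧ η < 1 ∧ IsAInftyWith ε η ω

/-- The size estimate, and the smoothness estimate in the first variable. -/
def KernelEstimates {n : ℕ} (α θ C : ℝ) (K : E n → E n → ℝ) : Prop :=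
  (∀ x y, x ≠ y → |K x y| ≤ C * ‖x - y‖ ^ (α - n)) ∧
  ∀ x x' y, x ≠ y → ‖x - x'‖ / ‖x - y‖ ≤ 1 / 2 →
    |K x y - K x' y| ≤ C * (‖x - x'‖ / ‖x - y‖) ^ θ * ‖x - y‖ ^ (α - n)

/-- `K` is a standard `α`-fractional Calderón-Zygmund kernel with smoothness exponent `θ`
and constant `C`: the estimates hold for `K` and for its adjoint kernel. -/
def IsStandardKernel {n : ℕ} (α θ C : ℝ) (K : E n → E n → ℝ) : Prop :=
  KernelEstimates α θ C K ∧ KernelEstimates α θ C (fun x y => K y x)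

/-- An `α`-fractional singular integral operator in `ℝⁿ`, with values in `ℝᵐ`: a vector
`K = (K_j)` of standard kernels together with a family of truncation functions
`η_{δ,R}`, `0 < δ < R < ∞`. Each `η_{δ,R}` vanishes near `0` and near `∞`, the truncated
kernels `η_{δ,R}(|x - y|) K_j(x, y)` satisfy the standard estimates uniformly in `δ, R`, and
`η_{δ,R} → 1` pointwise on `(0, ∞)` when `δ → 0` and `R → ∞`. -/
structure SingularIntegral (n m : ℕ) (α θ C : ℝ) where
  kernel : E n → E n → E m
  cutoff : ℝ → ℝ → ℝ → ℝ
  standard : ∀ j, IsStandardKernel α θ C (fun x y => kernel x y j)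
  cutoff_support : ∀ δ R, 0 < δ → δ < R →
    ∃ r s : ℝ, 0 < r ∧ ∀ t, t < r ∨ s < t → cutoff δ R t = 0
  truncated_standard : ∀ δ R, 0 < δ → δ < R → ∀ j,
    IsStandardKernel α θ C (fun x y => cutoff δ R ‖x - y‖ * kernel x y j)
  cutoff_tendsto : ∀ t, 0 < t →
    Tendsto (fun p : ℝ × ℝ => cutoff p.1 p.2 t) (𝓝[>] 0 ×ˢ atTop) (𝓝 1)

namespace SingularIntegral

variable {n m : ℕ} {α θ C : ℝ}

/-- The truncated operator `T_{δ,R}(f μ)(x) = ∫ K_{δ,R}(x, y) f(y) dμ(y)`. -/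
def trunc (T : SingularIntegral n m α θ C) (δ R : ℝ) (μ : Measure (E n)) (f : E n → ℝ)
    (x : E n) : E m :=
  ∫ y, f y • (T.cutoff δ R ‖x - y‖ • T.kernel x y) ∂μ

/-- `T` is bounded on unweighted `L²(ℝⁿ)` with norm at most `B`: the truncated operators
satisfy `‖T_{δ,R} f‖₂ ≤ B ‖f‖₂` for all `f ∈ L²`, uniformly in `0 < δ < R < ∞`. -/
def IsL2BoundedBy (T : SingularIntegral n m α θ C) (B : ℝ≥0) : Prop :=
  ∀ δ R, 0 < δ → δ < R → ∀ f : E n → ℝ, MemLp f 2 volume →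
    eLpNorm (T.trunc δ R volume f) 2 volume ≤ B * eLpNorm f 2 volume

/-- Ellipticity with constant `c`. -/
def IsEllipticWith (T : SingularIntegral n m α θ C) (c : ℝ) : Prop :=
  ∀ u : E n, ‖u‖ = 1 → ∃ j, ∀ (x : E n) (t : ℝ), 0 < t →
    c * t ^ (α - n) ≤ |T.kernel x (x + t • u) j|

/-- Ellipticity. -/
def IsElliptic (T : SingularIntegral n m α θ C) : Prop :=
  ∃ c : ℝ, 0 < c ∧ T.IsEllipticWith c

/-- The restricted weak type norm: the supremum over truncations `0 < δ < R < ∞`, cubes `Q`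
and compact subsets `A, F` of `Q` of
`|∫_F T_{δ,R}(1_A σ) dω| / √(|A|_σ |F|_ω)`. (The numerator vanishes when the denominator
does, and then the quotient is `0`.) -/
def restrictedWeakNorm (T : SingularIntegral n m α θ C) (σ ω : Measure (E n)) : ℝ≥0∞ :=
  ⨆ (δ : ℝ) (R : ℝ) (_ : 0 < δ) (_ : δ < R) (a : E n) (l : ℝ) (_ : 0 < l)
    (A : Set (E n)) (F : Set (E n)) (_ : IsCompact A) (_ : IsCompact F)
    (_ : A ⊆ cube a l) (_ : F ⊆ cube a l),
    ‖∫ x in F, T.trunc δ R σ (A.indicator 1) x ∂ω‖ₑ / (σ A * ω F) ^ (1 / 2 : ℝ)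

end SingularIntegral

end RestrictedWeak

end

/-! Sufficiency. The Muckenhoupt condition is symmetric, and the adjoint of a truncated kernel
satisfies the same estimates with the same L² bound, so Fubini reduces matters to `ω` being the A_∞
weight. Components and truncations are treated one at a time, with constants that do not see the
truncation.

Unweighted theory first gives t |B ∩ {|Tμ| > t}| ≲ ρ^α μ(ℝⁿ) for every finite measure μ and ball B
of radius ρ (`exists_weakType`). For α > 0 the fractional integral kernel is locally integrable; for
α = 0 this is the weak (1,1) bound, proved by a Calderón–Zygmund decomposition of μ.

This is carried to `ω` by a good-λ inequality (`measure_levelSet_le`). Let ν = 1_A σ. On a maximal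
dyadic cube almost filled by {|Tν| > t}, the points with |Tν| > 2t and fractional maximal function
at most γt form a small Lebesgue proportion, hence a small `ω`-proportion by the iterated A_∞
condition (`exists_forall_measure_le`). The maximal function satisfies t² ω{M ν > t} ≲ A₂ σ(A) for
arbitrary pairs of measures, by Vitali covering (`measure_maximalLevelSet_le`). Absorption yields
the same inequality for T; the truncation makes the absorbed quantity finite. No regularity of σ
enters. The layer cake formula then turns weak type (2,2) on indicators into the restricted
inequality.

Necessity. Move a cube Q by M times its side, M large. Ellipticity at the two corners and smoothness
give a truncated component of the kernel one sign and size at least a multiple of |Q|^(α/n - 1) on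
the product of Q and its translate Q'. Testing T on the indicators bounds |Q|_σ |Q'|_ω or |Q'|_σ
|Q|_ω. The A_∞ weight is doubling (`exists_forall_measure_cube_le`), so Q' can be replaced by Q in
its factor. -/

namespace RestrictedWeak

variable {n : ℕ}

/-! ### Cubes, balls and the Muckenhoupt product in coordinates -/

section Coordinates

/-- The sharp factor is √n; the cruder `n` only affects dimensional constants and keeps later
arithmetic free of roots. -/
lemma norm_le_of_abs_apply_le {x : E n} {s : ℝ} (hs : 0 ≤ s) (h : ∀ i, |x i| ≤ s) :
    ‖x‖ ≤ n * s := by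
  have hn : (0 : ℝ) ≤ n := Nat.cast_nonneg n
  refine abs_le_of_sq_le_sq' ?_ (by positivity) |>.2
  rw [EuclideanSpace.norm_sq_eq]
  calc ∑ i, ‖x i‖ ^ 2 ≤ ∑ _i : Fin n, s ^ 2 :=
        Finset.sum_le_sum fun i _ => pow_le_pow_left₀ (norm_nonneg _) (h i) 2
    _ = n * s ^ 2 := by simp
    _ ≤ (n * s) ^ 2 := by
        rcases Nat.eq_zero_or_pos n with h0 | h0
        · simp [h0]
        · have : (1 : ℝ) ≤ n := by exact_mod_cast h0
          nlinarith [sq_nonneg s, mul_nonneg hn (sq_nonneg s)]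

lemma abs_apply_le_norm (x : E n) (i : Fin n) : |x i| ≤ ‖x‖ := PiLp.norm_apply_le x i

lemma norm_sub_le_of_mem_cube {a x : E n} {l : ℝ} (hl : 0 ≤ l) (hx : x ∈ cube a l) :
    ‖x - a‖ ≤ n * l := by
  refine norm_le_of_abs_apply_le hl fun i => ?_
  have := hx i
  rw [PiLp.sub_apply, abs_le]
  constructor <;> linarith

lemma cube_eq_preimage (a : E n) (l : ℝ) :
    cube a l = (WithLp.ofLp : E n → Fin n → ℝ) ⁻¹' Set.Icc (a : Fin n → ℝ) (fun i => a i + l) := by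
  ext x
  simp [cube, Set.mem_Icc, Pi.le_def, forall_and]

lemma isClosed_cube (a : E n) (l : ℝ) : IsClosed (cube a l) := by
  rw [cube_eq_preimage]
  exact isClosed_Icc.preimage (PiLp.continuous_ofLp 2 _)

lemma measurableSet_cube (a : E n) (l : ℝ) : MeasurableSet (cube a l) :=
  (isClosed_cube a l).measurableSet

lemma cube_subset_closedBall (a : E n) {l : ℝ} (hl : 0 ≤ l) :
    cube a l ⊆ Metric.closedBall a (n * l) := fun x hx => by
  rw [Metric.mem_closedBall, dist_eq_norm]
  exact norm_sub_le_of_mem_cube hl hx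

lemma isCompact_cube (a : E n) {l : ℝ} (hl : 0 ≤ l) : IsCompact (cube a l) :=
  (isCompact_closedBall a (n * l)).of_isClosed_subset (isClosed_cube a l)
    (cube_subset_closedBall a hl)

lemma volume_cube (a : E n) (l : ℝ) : volume (cube a l) = ENNReal.ofReal l ^ n := by
  rw [cube_eq_preimage, (PiLp.volume_preserving_ofLp (Fin n)).measure_preimage
    measurableSet_Icc.nullMeasurableSet, Real.volume_Icc_pi]
  simp

/-- Expresses the Muckenhoupt normalisation as the reciprocal of the kernel size at distance `l`. -/
lemma volume_cube_rpow (hn : 0 < n) (a : E n) {l : ℝ} (hl : 0 < l) (α : ℝ) :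
    volume (cube a l) ^ (1 - α / n) = ENNReal.ofReal (l ^ (n - α)) := by
  have hn' : (n : ℝ) ≠ 0 := by positivity
  rw [volume_cube, ← ENNReal.ofReal_pow hl.le, ENNReal.ofReal_rpow_of_pos (by positivity),
    ← Real.rpow_natCast, ← Real.rpow_mul hl.le]
  congr 2
  field_simp

/-- The cube with lower corner `z - r (1, …, 1)` and side length `2 r` contains the ball of
radius `r` about `z`. -/
lemma closedBall_subset_cube (z : E n) (r : ℝ) :
    Metric.closedBall z r ⊆ cube (WithLp.toLp 2 fun i => z i - r) (2 * r) := fun x hx i => by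
  rw [Metric.mem_closedBall, dist_eq_norm] at hx
  have h := (abs_apply_le_norm (x - z) i).trans hx
  rw [PiLp.sub_apply, abs_le] at h
  simp only
  constructor <;> linarith

lemma le_muckenhoupt (hn : 0 < n) (α : ℝ) (σ ω : Measure (E n)) (a : E n) {l : ℝ} (hl : 0 < l) :
    σ (cube a l) * ω (cube a l) ≤
      ENNReal.ofReal (l ^ (n - α)) ^ 2 * muckenhoupt α σ ω := by
  have h : σ (cube a l) / volume (cube a l) ^ (1 - α / n) *
      (ω (cube a l) / volume (cube a l) ^ (1 - α / n)) ≤ muckenhoupt α σ ω :=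
    le_iSup_of_le a (le_iSup_of_le l (le_iSup_of_le hl le_rfl))
  rw [volume_cube_rpow hn a hl] at h
  set v := ENNReal.ofReal (l ^ (n - α))
  have hv : v ≠ 0 := by
    simp only [v, ne_eq, ENNReal.ofReal_eq_zero, not_le]
    positivity
  have hv' : v ≠ ∞ := ENNReal.ofReal_ne_top
  calc σ (cube a l) * ω (cube a l)
      = (v * (σ (cube a l) / v)) * (v * (ω (cube a l) / v)) := by
        rw [ENNReal.mul_div_cancel hv hv', ENNReal.mul_div_cancel hv hv']
    _ = v ^ 2 * (σ (cube a l) / v * (ω (cube a l) / v)) := by ring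
    _ ≤ _ := by gcongr

lemma muckenhoupt_swap (α : ℝ) (σ ω : Measure (E n)) :
    muckenhoupt α σ ω = muckenhoupt α ω σ := by
  simp only [muckenhoupt, mul_comm]

end Coordinates

/-! ### Dyadic cubes and stopping families -/

section Dyadic

/-- The index of the dyadic cube of side `2⁻ᵏ` containing `x`. -/
noncomputable def dyadicIndex (k : ℤ) (x : E n) : Fin n → ℤ := fun i => ⌊(2 : ℝ) ^ k * x i⌋

/-- The half-open dyadic cube of side `2⁻ᵏ` and lower corner `2⁻ᵏ z`. -/
def dyadicCube (p : ℤ × (Fin n → ℤ)) : Set (E n) := {x | dyadicIndex p.1 x = p.2}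

/-- The lower corner of a dyadic cube. -/
noncomputable def dyadicCorner (p : ℤ × (Fin n → ℤ)) : E n :=
  WithLp.toLp 2 fun i => (2 : ℝ) ^ (-p.1) * p.2 i

lemma mem_dyadicCube {p : ℤ × (Fin n → ℤ)} {x : E n} :
    x ∈ dyadicCube p ↔ dyadicIndex p.1 x = p.2 := Iff.rfl

lemma mem_dyadicCube_self (k : ℤ) (x : E n) : x ∈ dyadicCube (k, dyadicIndex k x) := rfl

lemma dyadicCube_eq_preimage (p : ℤ × (Fin n → ℤ)) :
    dyadicCube p = (WithLp.ofLp : E n → Fin n → ℝ) ⁻¹' Set.univ.pi fun i =>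
      Set.Ico ((2 : ℝ) ^ (-p.1) * p.2 i) ((2 : ℝ) ^ (-p.1) * (p.2 i + 1)) := by
  ext x
  simp only [dyadicCube, Set.mem_ofPred_eq, funext_iff, dyadicIndex, Set.mem_preimage,
    Set.mem_pi, Set.mem_univ, true_imp_iff, Set.mem_Ico, Int.floor_eq_iff, zpow_neg]
  have h2 : (0 : ℝ) < 2 ^ p.1 := by positivity
  refine forall_congr' fun i => and_congr ?_ ?_
  · rw [inv_mul_le_iff₀ h2]
  · rw [lt_inv_mul_iff₀ h2]

lemma measurableSet_dyadicCube (p : ℤ × (Fin n → ℤ)) : MeasurableSet (dyadicCube p) := by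
  rw [dyadicCube_eq_preimage]
  exact (WithLp.measurable_ofLp 2 _) (MeasurableSet.univ_pi fun i => measurableSet_Ico)

lemma volume_dyadicCube (p : ℤ × (Fin n → ℤ)) :
    volume (dyadicCube p) = ENNReal.ofReal ((2 : ℝ) ^ (-p.1)) ^ n := by
  rw [dyadicCube_eq_preimage, (PiLp.volume_preserving_ofLp (Fin n)).measure_preimage
    (MeasurableSet.univ_pi fun i => measurableSet_Ico).nullMeasurableSet, Real.volume_pi_Ico]
  simp [mul_add]

lemma volume_dyadicCube_ne_zero (p : ℤ × (Fin n → ℤ)) : volume (dyadicCube p) ≠ 0 := by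
  rw [volume_dyadicCube]
  refine pow_ne_zero _ ?_
  simp only [ne_eq, ENNReal.ofReal_eq_zero, not_le]
  positivity

lemma volume_dyadicCube_ne_top (p : ℤ × (Fin n → ℤ)) : volume (dyadicCube p) ≠ ∞ := by
  rw [volume_dyadicCube]
  exact ENNReal.pow_ne_top ENNReal.ofReal_ne_top

lemma dyadicCube_subset_cube (p : ℤ × (Fin n → ℤ)) :
    dyadicCube p ⊆ cube (dyadicCorner p) ((2 : ℝ) ^ (-p.1)) := by
  rw [dyadicCube_eq_preimage]
  intro x hx i
  have := hx i (Set.mem_univ i)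
  simp only [dyadicCorner]
  exact ⟨this.1, by linarith [this.2]⟩

lemma volume_cube_dyadicCorner (p : ℤ × (Fin n → ℤ)) :
    volume (cube (dyadicCorner p) ((2 : ℝ) ^ (-p.1))) = volume (dyadicCube p) := by
  rw [volume_cube, volume_dyadicCube]

lemma norm_sub_le_of_mem_dyadicCube {p : ℤ × (Fin n → ℤ)} {x y : E n} (hx : x ∈ dyadicCube p)
    (hy : y ∈ dyadicCube p) : ‖x - y‖ ≤ n * (2 : ℝ) ^ (-p.1) := by
  rw [dyadicCube_eq_preimage] at hx hy
  refine norm_le_of_abs_apply_le (by positivity) fun i => ?_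
  have h1 := hx i (Set.mem_univ i)
  have h2 := hy i (Set.mem_univ i)
  rw [PiLp.sub_apply, abs_le]
  constructor <;> linarith [h1.1, h1.2, h2.1, h2.2]

lemma norm_sub_dyadicCorner_le {p : ℤ × (Fin n → ℤ)} {x : E n} (hx : x ∈ dyadicCube p) :
    ‖x - dyadicCorner p‖ ≤ n * (2 : ℝ) ^ (-p.1) :=
  norm_sub_le_of_mem_cube (by positivity) (dyadicCube_subset_cube p hx)

/-- Nestedness of the dyadic grids: the coarse index is the integer quotient of the fine one by a
power of 2, so it is a function of it. -/
lemma dyadicIndex_eq_of_le {j k : ℤ} (hjk : j ≤ k) {x y : E n}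
    (h : dyadicIndex k x = dyadicIndex k y) : dyadicIndex j x = dyadicIndex j y := by
  obtain ⟨d, rfl⟩ : ∃ d : ℕ, k = j + d := ⟨(k - j).toNat, by omega⟩
  have key : ∀ x : E n, ∀ i, dyadicIndex j x i = dyadicIndex (j + d) x i / (2 ^ d : ℕ) := by
    intro x i
    have hx : (2 : ℝ) ^ j * x i = (2 : ℝ) ^ (j + d) * x i / (2 ^ d : ℕ) := by
      rw [zpow_add₀ two_ne_zero, zpow_natCast]
      push_cast
      field_simp
    simp only [dyadicIndex]
    rw [hx, Int.floor_div_natCast]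
  ext i
  rw [key x, key y, h]

lemma dyadicCube_subset_of_le {j k : ℤ} (hjk : j ≤ k) (x : E n) :
    dyadicCube (k, dyadicIndex k x) ⊆ dyadicCube (j, dyadicIndex j x) :=
  fun _ hy => dyadicIndex_eq_of_le hjk hy

lemma volume_dyadicCube_pred (k : ℤ) (z w : Fin n → ℤ) :
    volume (dyadicCube (k - 1, z)) = 2 ^ n * volume (dyadicCube (k, w)) := by
  rw [volume_dyadicCube, volume_dyadicCube, ← mul_pow]
  congr 1
  rw [show -(k - 1, z).1 = 1 + -(k, w).1 by simp; ring, zpow_add₀ two_ne_zero,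
    ENNReal.ofReal_mul (by positivity)]
  simp

/-- Open sets contain all sufficiently small dyadic cubes about each of their points. -/
lemma exists_dyadicCube_subset {U : Set (E n)} (hU : IsOpen U) {x : E n} (hx : x ∈ U) (k₀ : ℤ) :
    ∃ k, k₀ ≤ k ∧ dyadicCube (k, dyadicIndex k x) ⊆ U := by
  obtain ⟨ε, hε, hball⟩ := Metric.isOpen_iff.1 hU x hx
  obtain ⟨d, hd⟩ := exists_pow_lt_of_lt_one (show 0 < ε / (n + 1) by positivity)
    (show (1 / 2 : ℝ) < 1 by norm_num)
  refine ⟨max k₀ d, le_max_left _ _, fun y hy => hball ?_⟩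
  rw [Metric.mem_ball, dist_eq_norm]
  refine (norm_sub_le_of_mem_dyadicCube hy (mem_dyadicCube_self _ x)).trans_lt ?_
  have h1 : (2 : ℝ) ^ (-(max k₀ (d : ℤ))) ≤ (1 / 2) ^ d := by
    rw [one_div, inv_pow, ← zpow_natCast, ← zpow_neg]
    exact zpow_le_zpow_right₀ one_le_two (by simp)
  have h2 := h1.trans_lt hd
  rw [lt_div_iff₀ (by positivity)] at h2
  have : (0 : ℝ) < 2 ^ (-(max k₀ (d : ℤ))) := by positivity
  simp only
  nlinarith

/-- Large dyadic cubes have large volume. -/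
lemma exists_forall_lt_volume_dyadicCube (hn : 0 < n) {V : ℝ≥0∞} (hV : V ≠ ∞) :
    ∃ k₀ : ℤ, ∀ k < k₀, ∀ z : Fin n → ℤ, V < volume (dyadicCube (k, z)) := by
  obtain ⟨d, hd⟩ := pow_unbounded_of_one_lt V.toReal (show (1 : ℝ) < 2 by norm_num)
  refine ⟨-d, fun k hk z => ?_⟩
  rw [volume_dyadicCube, ← ENNReal.ofReal_pow (by positivity), ENNReal.lt_ofReal_iff_toReal_lt hV]
  refine hd.trans_le ?_
  have h1 : (2 : ℝ) ^ d ≤ 2 ^ (-k) := by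
    rw [← zpow_natCast]
    exact zpow_le_zpow_right₀ one_le_two (by omega)
  exact h1.trans (le_self_pow₀ ((one_le_pow₀ one_le_two).trans h1) (Nat.pos_iff_ne_zero.1 hn))

/-- The indices of the maximal dyadic cubes with the property `P`. -/
def maximalCubes (P : ℤ × (Fin n → ℤ) → Prop) : Set (ℤ × (Fin n → ℤ)) :=
  {p | P p ∧ ∀ j < p.1, ∀ x ∈ dyadicCube p, ¬ P (j, dyadicIndex j x)}

variable {P : ℤ × (Fin n → ℤ) → Prop}

/-- If two maximal cubes share a point, neither can be coarser, since it would be an ancestor of the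
other with the property `P`. Cubes of one generation sharing a point coincide. -/
lemma pairwiseDisjoint_maximalCubes : (maximalCubes P).PairwiseDisjoint dyadicCube := by
  have key : ∀ p ∈ maximalCubes P, ∀ q ∈ maximalCubes P, ∀ x ∈ dyadicCube p,
      x ∈ dyadicCube q → ¬ p.1 < q.1 := by
    intro p hp q hq x hxp hxq hlt
    refine hq.2 _ hlt x hxq ?_
    rw [mem_dyadicCube.1 hxp]
    exact hp.1
  intro p hp q hq hpq
  refine Set.disjoint_left.2 fun x hxp hxq => hpq ?_
  have h1 : p.1 = q.1 :=
    le_antisymm (not_lt.1 (key q hq p hp x hxq hxp)) (not_lt.1 (key p hp q hq x hxp hxq))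
  refine Prod.ext h1 ?_
  rw [← mem_dyadicCube.1 hxp, ← mem_dyadicCube.1 hxq, h1]

/-- As `P` fails for all sufficiently large cubes, the generations of the cubes around `x` with
property `P` are bounded below and have a least element. -/
lemma exists_mem_maximalCubes (hP : ∃ k₀ : ℤ, ∀ k < k₀, ∀ z, ¬ P (k, z)) {x : E n} {k : ℤ}
    (hx : P (k, dyadicIndex k x)) : ∃ p ∈ maximalCubes P, x ∈ dyadicCube p := by
  obtain ⟨k₀, hk₀⟩ := hP
  obtain ⟨j, hj, hmin⟩ := Int.exists_least_of_bdd (P := fun k => P (k, dyadicIndex k x))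
    ⟨k₀, fun k hk => not_lt.1 fun hlt => hk₀ k hlt _ hk⟩ ⟨k, hx⟩
  refine ⟨(j, dyadicIndex j x), ⟨hj, fun i hi y hy hPy => ?_⟩, mem_dyadicCube_self j x⟩
  have : dyadicIndex i y = dyadicIndex i x := dyadicIndex_eq_of_le hi.le hy
  rw [this] at hPy
  exact absurd (hmin i hPy) (not_le.2 hi)

lemma not_parent_of_mem_maximalCubes {p : ℤ × (Fin n → ℤ)} (hp : p ∈ maximalCubes P) {x : E n}
    (hx : x ∈ dyadicCube p) : ¬ P (p.1 - 1, dyadicIndex (p.1 - 1) x) :=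
  hp.2 _ (by omega) x hx

lemma dyadicCube_subset_parent {p : ℤ × (Fin n → ℤ)} {x : E n} (hx : x ∈ dyadicCube p) :
    dyadicCube p ⊆ dyadicCube (p.1 - 1, dyadicIndex (p.1 - 1) x) := by
  have h := dyadicCube_subset_of_le (show p.1 - 1 ≤ p.1 by omega) x
  rw [mem_dyadicCube.1 hx] at h
  exact h

lemma dyadicCube_nonempty (p : ℤ × (Fin n → ℤ)) : (dyadicCube p).Nonempty :=
  nonempty_of_measure_ne_zero (volume_dyadicCube_ne_zero p)

/-- Sum over maximal cubes of the measures of pieces of a set. -/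
lemma tsum_measure_maximalCubes_inter (μ : Measure (E n)) {A : Set (E n)} (hA : MeasurableSet A) :
    ∑' p : maximalCubes P, μ (dyadicCube p ∩ A) = μ ((⋃ p ∈ maximalCubes P, dyadicCube p) ∩ A) := by
  rw [Set.iUnion₂_inter, measure_biUnion (Set.to_countable _)]
  · exact pairwiseDisjoint_maximalCubes.mono fun p => Set.inter_subset_left
  · exact fun p _ => (measurableSet_dyadicCube p).inter hA

end Dyadic

end RestrictedWeak

/-! ### A_∞ weights: small sets and doubling -/

namespace RestrictedWeak

variable {n : ℕ} {ε η : ℝ} {ω : Measure (E n)}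

namespace IsAInftyWith

lemma absolutelyContinuous (h : IsAInftyWith ε η ω) : ω ≪ volume := by
  obtain ⟨⟨w, -, rfl⟩, -⟩ := h
  exact withDensity_absolutelyContinuous _ _

/-- The A_∞ condition tests compact sets only. Inner regularity extends it to measurable sets, at
the price of a non-strict inequality. -/
lemma measure_le [IsLocallyFiniteMeasure ω] (h : IsAInftyWith ε η ω) {a : E n} {l : ℝ}
    (hl : 0 < l) {A : Set (E n)} (hA : MeasurableSet A) (hAQ : A ⊆ cube a l)
    (hvol : volume A < ENNReal.ofReal ε * volume (cube a l)) :
    ω A ≤ ENNReal.ofReal η * ω (cube a l) := by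
  have hfin : ω A ≠ ∞ :=
    ((measure_mono hAQ).trans_lt (isCompact_cube a hl.le).measure_lt_top).ne
  rw [hA.measure_eq_iSup_isCompact_of_ne_top hfin]
  refine iSup₂_le fun K hKA => iSup_le fun hK => ?_
  exact (h.2 a l hl K hK (hKA.trans hAQ) ((measure_mono hKA).trans_lt hvol)).le

/-- Absolute continuity makes the missing faces of a half-open cube negligible, so the condition on
closed cubes applies to dyadic ones. -/
lemma measure_dyadicCube (h : IsAInftyWith ε η ω) (p : ℤ × (Fin n → ℤ)) :
    ω (cube (dyadicCorner p) ((2 : ℝ) ^ (-p.1))) = ω (dyadicCube p) := by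
  have h0 : volume (cube (dyadicCorner p) ((2 : ℝ) ^ (-p.1)) \ dyadicCube p) = 0 := by
    rw [measure_sdiff (dyadicCube_subset_cube p) (measurableSet_dyadicCube p).nullMeasurableSet
      (volume_dyadicCube_ne_top p), volume_cube_dyadicCorner, tsub_self]
  have h1 := h.absolutelyContinuous h0
  refine le_antisymm ?_ (measure_mono (dyadicCube_subset_cube p))
  calc ω (cube (dyadicCorner p) ((2 : ℝ) ^ (-p.1)))
      ≤ ω (dyadicCube p ∪ cube (dyadicCorner p) ((2 : ℝ) ^ (-p.1)) \ dyadicCube p) :=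
        measure_mono (by rw [Set.union_sdiff_self]; exact Set.subset_union_right)
    _ ≤ _ := (measure_union_le _ _).trans (by rw [h1, add_zero])

lemma measure_le_of_subset_dyadicCube [IsLocallyFiniteMeasure ω] (h : IsAInftyWith ε η ω)
    {p : ℤ × (Fin n → ℤ)} {A : Set (E n)} (hA : MeasurableSet A) (hAQ : A ⊆ dyadicCube p)
    (hvol : volume A < ENNReal.ofReal ε * volume (dyadicCube p)) :
    ω A ≤ ENNReal.ofReal η * ω (dyadicCube p) := by
  rw [← h.measure_dyadicCube]
  exact h.measure_le (by positivity) hA (hAQ.trans (dyadicCube_subset_cube p))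
    (by rwa [volume_cube_dyadicCorner])

/-- Iterating the `A_∞` condition: sets of very small relative volume have very small
relative weight. -/
lemma measure_le_pow [IsLocallyFiniteMeasure ω] (h : IsAInftyWith ε η ω)
    (hε : 0 < ε) (hε1 : ε < 1) (j : ℕ) {p : ℤ × (Fin n → ℤ)} {A : Set (E n)}
    (hA : MeasurableSet A) (hAQ : A ⊆ dyadicCube p)
    (hvol : volume A < (ENNReal.ofReal ε / 2 ^ (n + 1)) ^ j * ENNReal.ofReal ε *
      volume (dyadicCube p)) :
    ω A ≤ ENNReal.ofReal η ^ (j + 1) * ω (dyadicCube p) := by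
  induction j generalizing A with
  | zero => simpa using h.measure_le_of_subset_dyadicCube hA hAQ (by simpa using hvol)
  | succ j ih =>
    set e := ENNReal.ofReal ε with he
    -- Passing from a parent to a child multiplies densities by at most 2^n; the extra factor 1/2
    -- leaves room for the strict inequality `hae`.
    set a := e / 2 ^ (n + 1) with ha
    have he0 : e ≠ 0 := by simp [he, hε]
    have het : e ≠ ∞ := ENNReal.ofReal_ne_top
    have he1 : e ≤ 1 := by
      rw [he, ENNReal.ofReal_le_one]
      exact hε1.le
    have h2 : (2 : ℝ≥0∞) ^ (n + 1) ≠ 0 := by positivity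
    have h2t : (2 : ℝ≥0∞) ^ (n + 1) ≠ ∞ := ENNReal.pow_ne_top (by simp)
    have ha0 : a ≠ 0 := by
      rw [ha]
      exact (ENNReal.div_pos he0 h2t).ne'
    have hat : a ≠ ∞ := by
      rw [ha]
      exact ENNReal.div_ne_top het h2
    have hae : a * 2 ^ n < e := by
      have h3 : a * 2 ^ n * 2 = e := by
        rw [mul_assoc, ← pow_succ, ha, ENNReal.div_mul_cancel h2 h2t]
      have h4 : a * 2 ^ n ≠ 0 := mul_ne_zero ha0 (by positivity)
      have h5 : a * 2 ^ n ≠ ∞ := ENNReal.mul_ne_top hat (ENNReal.pow_ne_top (by simp))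
      calc a * 2 ^ n < a * 2 ^ n + a * 2 ^ n := ENNReal.lt_add_right h5 h4
        _ = e := by rw [← h3, mul_two]
    have ha1 : a < 1 := by
      refine lt_of_le_of_lt ?_ (hae.trans_le he1)
      exact le_mul_of_one_le_right' (one_le_pow₀ (by norm_num))
    -- An open neighbourhood replaces Lebesgue differentiation: small cubes about a point of `A` lie
    -- in `U`, where the density is 1 > `a`. The maximal subcubes of `p` with density of `U` above
    -- `a` therefore cover `A`. Their union `X` has volume below |U|/a, so the induction hypothesis
    -- applies to it; within each of them `A` has density below ε, which gains one more factor η.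
    obtain ⟨U, hAU, hUo, hU⟩ := A.exists_isOpen_lt_of_lt _ hvol
    set P : ℤ × (Fin n → ℤ) → Prop := fun q => p.1 ≤ q.1 ∧ dyadicCube q ⊆ dyadicCube p ∧
      a * volume (dyadicCube q) < volume (U ∩ dyadicCube q)
    have hbdd : ∃ k₀ : ℤ, ∀ k < k₀, ∀ z, ¬ P (k, z) :=
      ⟨p.1, fun k hk z hPz => absurd hPz.1 (not_le.2 hk)⟩
    set X : Set (E n) := ⋃ q ∈ maximalCubes P, dyadicCube q with hX
    have hXm : MeasurableSet X :=
      MeasurableSet.biUnion (Set.to_countable _) fun q _ => measurableSet_dyadicCube q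
    have hXp : X ⊆ dyadicCube p := Set.iUnion₂_subset fun q hq => hq.1.2.1
    have hAX : A ⊆ X := by
      intro x hx
      obtain ⟨k, hk, hkU⟩ := exists_dyadicCube_subset hUo (hAU hx) p.1
      have hxp := hAQ hx
      have hsub := dyadicCube_subset_of_le hk x
      rw [mem_dyadicCube.1 hxp] at hsub
      obtain ⟨q, hq, hxq⟩ := exists_mem_maximalCubes (P := P) hbdd (x := x) (k := k)
        ⟨hk, hsub, by
          rw [Set.inter_eq_self_of_subset_right hkU]
          have h0 := volume_dyadicCube_ne_zero (k, dyadicIndex k x)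
          have ht := volume_dyadicCube_ne_top (k, dyadicIndex k x)
          simpa using ENNReal.mul_lt_mul_left h0 ht ha1⟩
      exact Set.mem_iUnion₂.2 ⟨q, hq, hxq⟩
    have hUp : volume U < a * volume (dyadicCube p) := by
      refine hU.trans_le ?_
      gcongr
      calc a ^ (j + 1) * e ≤ a ^ (j + 1) * 1 := by gcongr
        _ = a ^ j * a := by rw [mul_one, pow_succ]
        _ ≤ 1 * a := by gcongr; exact pow_le_one₀ zero_le ha1.le
        _ = a := one_mul a
    have hXvol : volume X < a ^ j * e * volume (dyadicCube p) := by
      have h1 : a * volume X ≤ volume U := by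
        have hsum := tsum_measure_maximalCubes_inter (P := P) volume MeasurableSet.univ
        have hsumU := tsum_measure_maximalCubes_inter (P := P) volume hUo.measurableSet
        simp only [Set.inter_univ] at hsum
        rw [← hX] at hsum hsumU
        rw [← hsum, ← ENNReal.tsum_mul_left]
        calc ∑' q : maximalCubes P, a * volume (dyadicCube (q : ℤ × (Fin n → ℤ)))
            ≤ ∑' q : maximalCubes P, volume (dyadicCube (q : ℤ × (Fin n → ℤ)) ∩ U) :=
              ENNReal.tsum_le_tsum fun q => by
                rw [Set.inter_comm]
                exact q.2.1.2.2.le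
          _ = volume (X ∩ U) := hsumU
          _ ≤ volume U := measure_mono Set.inter_subset_right
      have h2 := h1.trans_lt hU
      rw [pow_succ', mul_assoc, mul_assoc] at h2
      rw [mul_assoc]
      exact (ENNReal.mul_lt_mul_iff_right ha0 hat).1 h2
    have hXω := ih hXm hXp hXvol
    have hcube : ∀ q ∈ maximalCubes P, ω (dyadicCube q ∩ A) ≤
        ENNReal.ofReal η * ω (dyadicCube q) := by
      intro q hq
      obtain ⟨x, hx⟩ := dyadicCube_nonempty q
      have hxp := hq.1.2.1 hx
      -- The cube `p` itself is not selected, as `U` is too small in it; hence the parent of a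
      -- selected cube still lies in `p` and must fail the density test.
      have hlt : p.1 < q.1 := by
        refine lt_of_le_of_ne hq.1.1 fun heq => ?_
        have hpq : q = p := by
          refine Prod.ext heq.symm ?_
          rw [← mem_dyadicCube.1 hx, ← mem_dyadicCube.1 hxp, heq]
        have h3 := hq.1.2.2
        rw [hpq] at h3
        exact absurd (h3.trans_le (measure_mono Set.inter_subset_left)) (not_lt.2 hUp.le)
      have hpar := not_parent_of_mem_maximalCubes hq hx
      have hsub := dyadicCube_subset_of_le (show p.1 ≤ q.1 - 1 by omega) x
      rw [mem_dyadicCube.1 hxp] at hsub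
      have h4 : volume (U ∩ dyadicCube (q.1 - 1, dyadicIndex (q.1 - 1) x)) ≤
          a * volume (dyadicCube (q.1 - 1, dyadicIndex (q.1 - 1) x)) := by
        by_contra hcon
        exact hpar ⟨by simp only; omega, hsub, not_le.1 hcon⟩
      refine h.measure_le_of_subset_dyadicCube ((measurableSet_dyadicCube q).inter hA)
        Set.inter_subset_left ?_
      calc volume (dyadicCube q ∩ A)
          ≤ volume (U ∩ dyadicCube (q.1 - 1, dyadicIndex (q.1 - 1) x)) :=
            measure_mono fun y hy => ⟨hAU hy.2, dyadicCube_subset_parent hx hy.1⟩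
        _ ≤ a * (2 ^ n * volume (dyadicCube (q.1, q.2))) := by
            rw [← volume_dyadicCube_pred q.1 (dyadicIndex (q.1 - 1) x) q.2]
            exact h4
        _ = a * 2 ^ n * volume (dyadicCube q) := by rw [mul_assoc]
        _ < e * volume (dyadicCube q) := by
            simpa using ENNReal.mul_lt_mul_left (volume_dyadicCube_ne_zero q)
              (volume_dyadicCube_ne_top q) hae
    have hsum := tsum_measure_maximalCubes_inter (P := P) ω MeasurableSet.univ
    have hsumA := tsum_measure_maximalCubes_inter (P := P) ω hA
    simp only [Set.inter_univ] at hsum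
    rw [← hX] at hsum hsumA
    calc ω A = ω (X ∩ A) := by rw [Set.inter_eq_self_of_subset_right hAX]
      _ = ∑' q : maximalCubes P, ω (dyadicCube (q : ℤ × (Fin n → ℤ)) ∩ A) := hsumA.symm
      _ ≤ ∑' q : maximalCubes P, ENNReal.ofReal η * ω (dyadicCube (q : ℤ × (Fin n → ℤ))) :=
          ENNReal.tsum_le_tsum fun q => hcube q q.2
      _ = ENNReal.ofReal η * ω X := by rw [ENNReal.tsum_mul_left, hsum]
      _ ≤ ENNReal.ofReal η * (ENNReal.ofReal η ^ (j + 1) * ω (dyadicCube p)) := by gcongr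
      _ = _ := by ring

end IsAInftyWith

/-- The quantitative absolute continuity of `A_∞` weights on dyadic cubes, with an arbitrarily
small constant. -/
lemma exists_forall_measure_le (hε : 0 < ε) (hε1 : ε < 1) (hη : η < 1)
    {η' : ℝ} (hη' : 0 < η') :
    ∃ δ : ℝ, 0 < δ ∧ δ < 1 ∧ ∀ (ω : Measure (E n)) [IsLocallyFiniteMeasure ω],
      IsAInftyWith ε η ω → ∀ (p : ℤ × (Fin n → ℤ)) (A : Set (E n)), A ⊆ dyadicCube p →
        volume A < ENNReal.ofReal δ * volume (dyadicCube p) →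
        ω A ≤ ENNReal.ofReal η' * ω (dyadicCube p) := by
  -- The sign of `η` is not assumed, so powers are taken of `max η 0`.
  obtain ⟨j, hj⟩ := exists_pow_lt_of_lt_one hη' (show max η 0 < 1 by simp [hη])
  have hε2 : ε / 2 ^ (n + 1) < 1 := by
    rw [div_lt_one (by positivity)]
    exact hε1.trans_le (one_le_pow₀ one_le_two)
  refine ⟨(ε / 2 ^ (n + 1)) ^ j * ε, by positivity, ?_, ?_⟩
  · calc (ε / 2 ^ (n + 1)) ^ j * ε ≤ 1 * ε := by
          gcongr
          exact pow_le_one₀ (by positivity) hε2.le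
      _ < 1 := by linarith
  intro ω _ h p A hA hvol
  -- pass to a measurable superset inside the cube
  set A' := toMeasurable volume A ∩ dyadicCube p
  have hm : MeasurableSet A' := (measurableSet_toMeasurable _ _).inter (measurableSet_dyadicCube p)
  have hAA' : A ⊆ A' := Set.subset_inter (subset_toMeasurable _ _) hA
  have hvol' : volume A' < ENNReal.ofReal ((ε / 2 ^ (n + 1)) ^ j * ε) * volume (dyadicCube p) :=
    (measure_mono Set.inter_subset_left).trans_lt (by rwa [measure_toMeasurable])
  have hδ : ENNReal.ofReal ((ε / 2 ^ (n + 1)) ^ j * ε) =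
      (ENNReal.ofReal ε / 2 ^ (n + 1)) ^ j * ENNReal.ofReal ε := by
    rw [ENNReal.ofReal_mul (by positivity), ENNReal.ofReal_pow (by positivity),
      ENNReal.ofReal_div_of_pos (by positivity), ENNReal.ofReal_pow zero_le_two]
    simp
  rw [hδ] at hvol'
  refine (measure_mono hAA').trans
    ((h.measure_le_pow hε hε1 j hm Set.inter_subset_right hvol').trans ?_)
  gcongr
  calc ENNReal.ofReal η ^ (j + 1) ≤ ENNReal.ofReal (max η 0) ^ (j + 1) := by
        gcongr
        exact le_max_left _ _
    _ = ENNReal.ofReal ((max η 0) ^ (j + 1)) := by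
        rw [ENNReal.ofReal_pow (le_max_right _ _)]
    _ ≤ ENNReal.ofReal η' := by
        refine ENNReal.ofReal_le_ofReal ?_
        rw [pow_succ]
        have h0 : 0 ≤ max η 0 := le_max_right _ _
        have h1 : max η 0 ≤ 1 := by simp [hη.le]
        nlinarith [pow_nonneg h0 j]

/-- `A_∞` weights are doubling: translates of a cube have comparable weight. -/
lemma exists_forall_measure_cube_le (hε : 0 < ε) (hη : η < 1)
    (M : ℝ) : ∃ D : ℝ≥0, 0 < D ∧ ∀ (ω : Measure (E n)) [IsLocallyFiniteMeasure ω],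
      IsAInftyWith ε η ω → ∀ (a b : E n) (l : ℝ), 0 < l → (∀ i, |b i - a i| ≤ M * l) →
        ω (cube b l) ≤ D * ω (cube a l) := by
  -- With this β, widening a cube by β times its side in every direction adds less than the fraction
  -- ε of the new volume, so the added shell has at most η of the new weight. One widening thus
  -- costs (1 - η)⁻¹, and about M/β of them absorb the translate.
  obtain ⟨β, hβ, hβε⟩ : ∃ β : ℝ, 0 < β ∧ (1 + 2 * β) ^ n * (1 - ε) < 1 := by
    have hc : Tendsto (fun β : ℝ => (1 + 2 * β) ^ n * (1 - ε)) (𝓝[>] 0) (𝓝 (1 - ε)) := by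
      have : Continuous fun β : ℝ => (1 + 2 * β) ^ n * (1 - ε) := by fun_prop
      simpa using (this.tendsto 0).mono_left nhdsWithin_le_nhds
    obtain ⟨β, h1, h2⟩ :=
      ((hc.eventually_lt_const (show 1 - ε < 1 by linarith)).and self_mem_nhdsWithin).exists
    exact ⟨β, h2, h1⟩
  obtain ⟨k, hk⟩ := exists_nat_ge (M / β)
  set q : ℝ≥0 := (Real.toNNReal (1 - η))⁻¹ with hq
  have hq0 : 0 < Real.toNNReal (1 - η) := by simp [hη]
  have hqpos : 0 < q := by rw [hq]; positivity
  refine ⟨q ^ k, by positivity, fun ω _ h a b l hl hab => ?_⟩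
  have step : ∀ (a : E n) (l : ℝ), 0 < l →
      ω (cube (WithLp.toLp 2 fun i => a i - β * l) ((1 + 2 * β) * l)) ≤ q * ω (cube a l) := by
    intro a l hl
    set Q' := cube (WithLp.toLp 2 fun i => a i - β * l) ((1 + 2 * β) * l) with hQ'
    have hβl : 0 < β * l := by positivity
    have hl' : 0 < (1 + 2 * β) * l := by positivity
    have hsub : cube a l ⊆ Q' := by
      intro x hx i
      have := hx i
      simp only
      constructor <;> linarith
    have hfin : ω Q' ≠ ∞ := (isCompact_cube _ hl'.le).measure_lt_top.ne
    have hdiff : ω (Q' \ cube a l) ≤ ENNReal.ofReal η * ω Q' := by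
      refine h.measure_le hl' ((measurableSet_cube _ _).diff (measurableSet_cube _ _))
        Set.sdiff_subset ?_
      rw [measure_sdiff hsub (measurableSet_cube _ _).nullMeasurableSet
        (isCompact_cube a hl.le).measure_lt_top.ne, hQ', volume_cube, volume_cube,
        ← ENNReal.ofReal_pow hl.le, ← ENNReal.ofReal_pow hl'.le, ← ENNReal.ofReal_mul hε.le,
        ← ENNReal.ofReal_sub _ (by positivity)]
      refine (ENNReal.ofReal_lt_ofReal_iff (by positivity)).2 ?_
      rw [mul_pow]
      have : 0 < l ^ n := by positivity
      nlinarith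
    have htot : ω Q' ≤ ω (cube a l) + ENNReal.ofReal η * ω Q' := by
      calc ω Q' ≤ ω (cube a l ∪ Q' \ cube a l) :=
            measure_mono (by rw [Set.union_sdiff_self]; exact Set.subset_union_right)
        _ ≤ _ := (measure_union_le _ _).trans (by gcongr)
    have hη2 : ENNReal.ofReal (1 - η) * ω Q' ≤ ω (cube a l) := by
      lift ω Q' to ℝ≥0 using hfin with W
      lift ω (cube a l) to ℝ≥0 using (isCompact_cube a hl.le).measure_lt_top.ne with V
      simp only [ENNReal.ofReal] at htot ⊢
      norm_cast at htot ⊢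
      rw [← NNReal.coe_le_coe] at htot ⊢
      push_cast at htot ⊢
      rw [Real.coe_toNNReal _ (by linarith)]
      rcases le_total 0 η with h0 | h0
      · rw [Real.coe_toNNReal _ h0] at htot
        linarith
      -- A nonpositive η is impossible: the strict inequality for the empty set would read 0 < 0.
      · exfalso
        have hp := h.2 a l hl ∅ isCompact_empty (Set.empty_subset _) (by
          rw [volume_cube, ← ENNReal.ofReal_pow hl.le, ← ENNReal.ofReal_mul hε.le]
          simp only [measure_empty, ENNReal.ofReal_pos]
          positivity)
        simp [ENNReal.ofReal_of_nonpos h0] at hp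
    calc ω Q' = (q : ℝ≥0∞) * (ENNReal.ofReal (1 - η) * ω Q') := by
          rw [← mul_assoc, ENNReal.ofReal, ← ENNReal.coe_mul, hq, inv_mul_cancel₀ hq0.ne']
          simp
      _ ≤ _ := by gcongr
  -- The margin `t` grows at least linearly, because each widening is proportional to the current
  -- side, which is at least `l`.
  have iter : ∀ k : ℕ, ∃ t : ℝ, k * (β * l) ≤ t ∧
      ω (cube (WithLp.toLp 2 fun i => a i - t) (l + 2 * t)) ≤ (q : ℝ≥0∞) ^ k * ω (cube a l) := by
    intro k
    induction k with
    | zero => exact ⟨0, by simp, by simp⟩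
    | succ k ih =>
      obtain ⟨t, ht, hω⟩ := ih
      have ht0 : 0 ≤ t := le_trans (by positivity) ht
      refine ⟨t + β * (l + 2 * t), ?_, ?_⟩
      · push_cast
        nlinarith [mul_nonneg hβ.le ht0]
      · have h1 := step (WithLp.toLp 2 fun i => a i - t) (l + 2 * t) (by positivity)
        simp only at h1
        have h2 : (fun i => a i - (t + β * (l + 2 * t))) = fun i => a i - t - β * (l + 2 * t) := by
          ext i; ring
        rw [h2, show l + 2 * (t + β * (l + 2 * t)) = (1 + 2 * β) * (l + 2 * t) by ring]
        calc _ ≤ _ := h1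
          _ ≤ (q : ℝ≥0∞) * ((q : ℝ≥0∞) ^ k * ω (cube a l)) := by gcongr
          _ = _ := by ring
  obtain ⟨t, ht, hω⟩ := iter k
  push_cast
  refine (measure_mono fun x hx i => ?_).trans hω
  have hMt : M * l ≤ t := by
    rw [div_le_iff₀ hβ] at hk
    nlinarith
  have h1 := abs_le.1 (hab i)
  have h2 := hx i
  simp only
  constructor <;> linarith

end RestrictedWeak

namespace RestrictedWeak

variable {n : ℕ}

/-! ### Integrals of powers over dyadic annuli -/

section Annuli

/-- The constant `2 ^ s / (1 - 2 ^ (-θ))` in the estimates obtained by summing over dyadic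
annuli. -/
noncomputable def annuliConst (s θ : ℝ) : ℝ≥0∞ :=
  ENNReal.ofReal (2 ^ s) * (1 - ENNReal.ofReal (2 ^ (-θ)))⁻¹

lemma annuliConst_ne_top (s : ℝ) {θ : ℝ} (hθ : 0 < θ) : annuliConst s θ ≠ ∞ := by
  refine ENNReal.mul_ne_top ENNReal.ofReal_ne_top (ENNReal.inv_ne_top.2 ?_)
  refine (tsub_pos_of_lt ?_).ne'
  rw [ENNReal.ofReal_lt_one]
  exact Real.rpow_lt_one_of_one_lt_of_neg one_lt_two (by linarith)

/-- A measure of growth `s` has tails of the expected size. -/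
lemma lintegral_compl_closedBall_le {ν : Measure (E n)} {z : E n} {s θ ρ : ℝ} {A : ℝ≥0∞}
    (hs : 0 ≤ s) (hθ : 0 < θ) (hρ : 0 < ρ)
    (hν : ∀ t, 0 < t → ν (Metric.closedBall z t) ≤ A * ENNReal.ofReal (t ^ s)) :
    ∫⁻ y in (Metric.closedBall z ρ)ᶜ, ENNReal.ofReal (‖z - y‖ ^ (-s - θ)) ∂ν ≤
      annuliConst s θ * A * ENNReal.ofReal (ρ ^ (-θ)) := by
  set S : ℕ → Set (E n) := fun j =>
    Metric.closedBall z (2 ^ (j + 1) * ρ) \ Metric.closedBall z (2 ^ j * ρ)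
  have hcov : (Metric.closedBall z ρ)ᶜ ⊆ ⋃ j, S j := by
    intro y hy
    rw [Set.mem_compl_iff, Metric.mem_closedBall, not_le] at hy
    obtain ⟨j, hj1, hj2⟩ := exists_nat_pow_near_of_lt_one
      (y := (1 / 2 : ℝ)) (x := ρ / dist y z) (div_pos hρ (hρ.trans hy))
      (by rw [div_le_one (by linarith)]; exact hy.le) (by norm_num) (by norm_num)
    have hd : 0 < dist y z := by linarith
    refine Set.mem_iUnion.2 ?_
    rcases lt_or_eq_of_le hj2 with hlt | heq
    · refine ⟨j, ?_, ?_⟩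
      · rw [Metric.mem_closedBall]
        rw [one_div, inv_pow, inv_eq_one_div, div_lt_div_iff₀ (by positivity) hd] at hj1
        linarith
      · rw [Metric.mem_closedBall, not_le]
        rw [one_div, inv_pow, inv_eq_one_div, div_lt_div_iff₀ hd (by positivity)] at hlt
        linarith
    -- The annuli contain their outer but not their inner sphere, so a point at distance exactly 2^j
    -- ρ belongs to the preceding one; j = 0 cannot occur outside the closed ball.
    · have hdeq : dist y z = 2 ^ j * ρ := by
        rw [one_div, inv_pow, inv_eq_one_div, div_eq_div_iff hd.ne' (by positivity)] at heq
        linarith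
      cases j with
      | zero => simp at hdeq; linarith
      | succ i =>
        refine ⟨i, ?_, ?_⟩
        · rw [Metric.mem_closedBall, hdeq]
        · rw [Metric.mem_closedBall, hdeq, not_le, pow_succ]
          have : 0 < 2 ^ i * ρ := by positivity
          linarith
  -- The integrand is at most (2^j ρ)^(-s-θ) and the mass at most A (2^(j+1) ρ)^s; the product
  -- decays like 2^(-θj).
  have hterm : ∀ j, ∫⁻ y in S j, ENNReal.ofReal (‖z - y‖ ^ (-s - θ)) ∂ν ≤
      ENNReal.ofReal (2 ^ s) * A * ENNReal.ofReal (ρ ^ (-θ)) * ENNReal.ofReal (2 ^ (-θ)) ^ j := by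
    intro j
    calc ∫⁻ y in S j, ENNReal.ofReal (‖z - y‖ ^ (-s - θ)) ∂ν
        ≤ ∫⁻ _y in S j, ENNReal.ofReal ((2 ^ j * ρ) ^ (-s - θ)) ∂ν := by
          refine setLIntegral_mono' (Metric.isClosed_closedBall.measurableSet.diff
            Metric.isClosed_closedBall.measurableSet) fun y hy => ?_
          have h1 := hy.2
          rw [Metric.mem_closedBall, not_le, dist_comm, dist_eq_norm] at h1
          exact ENNReal.ofReal_le_ofReal
            (Real.rpow_le_rpow_of_nonpos (by positivity) h1.le (by linarith))
      _ = ENNReal.ofReal ((2 ^ j * ρ) ^ (-s - θ)) * ν (S j) := by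
          rw [setLIntegral_const]
      _ ≤ ENNReal.ofReal ((2 ^ j * ρ) ^ (-s - θ)) *
            (A * ENNReal.ofReal ((2 ^ (j + 1) * ρ) ^ s)) := by
          gcongr
          exact (measure_mono Set.sdiff_subset).trans (hν _ (by positivity))
      _ = A * (ENNReal.ofReal ((2 ^ j * ρ) ^ (-s - θ) * (2 ^ (j + 1) * ρ) ^ s)) := by
          rw [ENNReal.ofReal_mul (by positivity)]
          ring
      _ = A * ENNReal.ofReal (2 ^ s * ρ ^ (-θ) * (2 ^ (-θ)) ^ j) := by
          congr 2
          rw [pow_succ', mul_assoc 2, Real.mul_rpow zero_le_two (by positivity : 0 ≤ 2 ^ j * ρ)]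
          have h3 : ((2 : ℝ) ^ (-θ)) ^ j = (2 ^ j : ℝ) ^ (-θ) := by
            rw [Real.rpow_pow_comm zero_le_two]
          rw [h3, mul_assoc _ (ρ ^ (-θ)), mul_comm (ρ ^ (-θ)),
            ← Real.mul_rpow (by positivity) hρ.le, mul_left_comm,
            ← Real.rpow_add (by positivity)]
          congr 2
          ring
      _ = _ := by
          rw [ENNReal.ofReal_mul (by positivity), ENNReal.ofReal_mul (by positivity),
            ENNReal.ofReal_pow (by positivity)]
          ring
  calc ∫⁻ y in (Metric.closedBall z ρ)ᶜ, ENNReal.ofReal (‖z - y‖ ^ (-s - θ)) ∂ν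
      ≤ ∫⁻ y in ⋃ j, S j, ENNReal.ofReal (‖z - y‖ ^ (-s - θ)) ∂ν :=
        lintegral_mono_set hcov
    _ ≤ ∑' j, ∫⁻ y in S j, ENNReal.ofReal (‖z - y‖ ^ (-s - θ)) ∂ν := lintegral_iUnion_le _ _
    _ ≤ ∑' j, ENNReal.ofReal (2 ^ s) * A * ENNReal.ofReal (ρ ^ (-θ)) *
          ENNReal.ofReal (2 ^ (-θ)) ^ j := ENNReal.tsum_le_tsum hterm
    _ = _ := by
        rw [ENNReal.tsum_mul_left, ENNReal.tsum_geometric, annuliConst]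
        ring

/-- The exponent is written `n - 0` to match the growth hypothesis with exponent `n - α` at α = 0.
-/
lemma volume_closedBall_le (z : E n) {t : ℝ} (ht : 0 < t) :
    volume (Metric.closedBall z t) ≤
      volume (Metric.ball (0 : E n) 1) * ENNReal.ofReal (t ^ ((n : ℝ) - 0)) := by
  rw [Measure.addHaar_closedBall _ _ ht.le, mul_comm]
  simp

/-- The fractional integral kernel is locally integrable, with the scaling invariant bound. -/
lemma lintegral_closedBall_rpow_le {α : ℝ} (hα : 0 < α) (hαn : α < n) (z : E n)
    {ρ : ℝ} (hρ : 0 < ρ) :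
    ∫⁻ x in Metric.closedBall z ρ, ENNReal.ofReal (‖x - z‖ ^ (α - n)) ≤
      annuliConst (n - α) α * volume (Metric.ball (0 : E n) 1) * ENNReal.ofReal (ρ ^ α) := by
  have hn : 0 < n := by
    rcases Nat.eq_zero_or_pos n with h | h
    · simp [h] at hαn; linarith
    · exact h
  set S : ℕ → Set (E n) := fun j =>
    Metric.closedBall z ((1 / 2) ^ j * ρ) \ Metric.closedBall z ((1 / 2) ^ (j + 1) * ρ)
  have hcov : Metric.closedBall z ρ ⊆ {z} ∪ ⋃ j, S j := by
    intro y hy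
    rw [Metric.mem_closedBall] at hy
    rcases eq_or_ne y z with h | h
    · exact Or.inl h
    have hd : 0 < dist y z := dist_pos.2 h
    obtain ⟨j, hj1, hj2⟩ := exists_nat_pow_near_of_lt_one
      (y := (1 / 2 : ℝ)) (x := dist y z / ρ) (by positivity)
      (by rwa [div_le_one hρ]) (by norm_num) (by norm_num)
    refine Or.inr (Set.mem_iUnion.2 ⟨j, ?_, ?_⟩)
    · rw [Metric.mem_closedBall]
      rwa [div_le_iff₀ hρ] at hj2
    · rw [Metric.mem_closedBall, not_le]
      rwa [lt_div_iff₀ hρ] at hj1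
  have hterm : ∀ j, ∫⁻ y in S j, ENNReal.ofReal (‖y - z‖ ^ (α - n)) ≤
      ENNReal.ofReal (2 ^ (n - α)) * volume (Metric.ball (0 : E n) 1) * ENNReal.ofReal (ρ ^ α) *
        ENNReal.ofReal (2 ^ (-α)) ^ j := by
    intro j
    calc ∫⁻ y in S j, ENNReal.ofReal (‖y - z‖ ^ (α - n))
        ≤ ∫⁻ _y in S j, ENNReal.ofReal (((1 / 2) ^ (j + 1) * ρ) ^ (α - n)) := by
          refine setLIntegral_mono' (Metric.isClosed_closedBall.measurableSet.diff
            Metric.isClosed_closedBall.measurableSet) fun y hy => ?_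
          have h1 := hy.2
          rw [Metric.mem_closedBall, not_le, dist_eq_norm] at h1
          exact ENNReal.ofReal_le_ofReal
            (Real.rpow_le_rpow_of_nonpos (by positivity) h1.le (by linarith))
      _ = ENNReal.ofReal (((1 / 2) ^ (j + 1) * ρ) ^ (α - n)) * volume (S j) := by
          rw [setLIntegral_const]
      _ ≤ ENNReal.ofReal (((1 / 2) ^ (j + 1) * ρ) ^ (α - n)) *
            (volume (Metric.ball (0 : E n) 1) *
              ENNReal.ofReal (((1 / 2) ^ j * ρ) ^ ((n : ℝ) - 0))) := by
          gcongr
          exact (measure_mono Set.sdiff_subset).trans (volume_closedBall_le z (by positivity))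
      _ = volume (Metric.ball (0 : E n) 1) * (ENNReal.ofReal
            (((1 / 2) ^ (j + 1) * ρ) ^ (α - n) * ((1 / 2) ^ j * ρ) ^ ((n : ℝ) - 0))) := by
          rw [ENNReal.ofReal_mul (by positivity)]
          ring
      _ = volume (Metric.ball (0 : E n) 1) *
            ENNReal.ofReal (2 ^ (n - α) * ρ ^ α * (2 ^ (-α)) ^ j) := by
          congr 2
          rw [pow_succ', mul_assoc (1 / 2 : ℝ),
            Real.mul_rpow (by norm_num) (by positivity : 0 ≤ (1 / 2 : ℝ) ^ j * ρ)]
          have h3 : ((2 : ℝ) ^ (-α)) ^ j = ((1 / 2 : ℝ) ^ j) ^ α := by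
            rw [← Real.rpow_pow_comm (by norm_num), one_div, Real.inv_rpow zero_le_two,
              Real.rpow_neg zero_le_two]
          have h4 : (1 / 2 : ℝ) ^ (α - n) = 2 ^ (n - α) := by
            rw [one_div, Real.inv_rpow zero_le_two, ← Real.rpow_neg zero_le_two, neg_sub]
          rw [h3, h4, mul_assoc _ (ρ ^ α), mul_comm (ρ ^ α),
            ← Real.mul_rpow (by positivity) hρ.le, mul_assoc,
            ← Real.rpow_add (by positivity)]
          congr 2
          ring
      _ = _ := by
          rw [ENNReal.ofReal_mul (by positivity), ENNReal.ofReal_mul (by positivity),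
            ENNReal.ofReal_pow (by positivity)]
          ring
  -- In positive dimension Lebesgue measure has no atoms, so the centre, which no annulus contains,
  -- contributes nothing.
  have : Nonempty (Fin n) := ⟨⟨0, hn⟩⟩
  have hz : ∫⁻ x in ({z} : Set (E n)), ENNReal.ofReal (‖x - z‖ ^ (α - n)) = 0 := by
    rw [Measure.restrict_singleton]
    simp
  calc ∫⁻ x in Metric.closedBall z ρ, ENNReal.ofReal (‖x - z‖ ^ (α - n))
      ≤ ∫⁻ x in {z} ∪ ⋃ j, S j, ENNReal.ofReal (‖x - z‖ ^ (α - n)) := lintegral_mono_set hcov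
    _ ≤ 0 + ∑' j, ∫⁻ y in S j, ENNReal.ofReal (‖y - z‖ ^ (α - n)) := by
        refine (lintegral_union_le _ _ _).trans ?_
        rw [hz]
        gcongr
        exact lintegral_iUnion_le _ _
    _ ≤ ∑' j, ENNReal.ofReal (2 ^ (n - α)) * volume (Metric.ball (0 : E n) 1) *
          ENNReal.ofReal (ρ ^ α) * ENNReal.ofReal (2 ^ (-α)) ^ j := by
        rw [zero_add]
        exact ENNReal.tsum_le_tsum hterm
    _ = _ := by
        rw [ENNReal.tsum_mul_left, ENNReal.tsum_geometric, annuliConst]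
        ring

end Annuli

/-! ### Truncated kernels and their potentials -/

section Kernel

/-- A standard kernel which vanishes near the diagonal and near infinity. -/
structure IsTruncatedKernel (α θ C : ℝ) (k : E n → E n → ℝ) : Prop where
  standard : IsStandardKernel α θ C k
  vanish : ∃ r s : ℝ, 0 < r ∧ ∀ x y, ‖x - y‖ < r ∨ s < ‖x - y‖ → k x y = 0

/-- The potential `x ↦ ∫ k(x, y) dμ(y)`. -/
noncomputable def potential (k : E n → E n → ℝ) (μ : Measure (E n)) (x : E n) : ℝ :=
  ∫ y, k x y ∂μ

variable {α θ C : ℝ} {k : E n → E n → ℝ}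

namespace IsTruncatedKernel

lemma swap (hk : IsTruncatedKernel α θ C k) : IsTruncatedKernel α θ C fun x y => k y x := by
  obtain ⟨r, s, hr, h⟩ := hk.vanish
  exact ⟨⟨hk.standard.2, hk.standard.1⟩, r, s, hr, fun x y hxy => h y x (by rwa [norm_sub_rev])⟩

/-- This bound depends on the truncation. It serves for integrability, continuity and a priori
finiteness, and never enters a final constant. -/
lemma exists_bound (hk : IsTruncatedKernel α θ C k) (hC : 0 < C) (hαn : α < n) :
    ∃ M : ℝ, 0 ≤ M ∧ ∀ x y, |k x y| ≤ M := by
  obtain ⟨r, s, hr, h⟩ := hk.vanish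
  refine ⟨C * r ^ (α - n), by positivity, fun x y => ?_⟩
  rcases lt_or_ge ‖x - y‖ r with h1 | h1
  · rw [h x y (Or.inl h1), abs_zero]
    positivity
  · refine (hk.standard.1.1 x y ?_).trans ?_
    · rintro rfl
      simp at h1
      linarith
    · gcongr ?_ * ?_
      exact Real.rpow_le_rpow_of_nonpos hr h1 (by linarith)

/-- Near the diagonal the kernel vanishes. Elsewhere one moves first in `x`, then in `y`, each time
by one of the two smoothness estimates. -/
lemma continuous (hk : IsTruncatedKernel α θ C k) (hθ : 0 < θ) :
    Continuous fun p : E n × E n => k p.1 p.2 := by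
  rw [continuous_iff_continuousAt]
  rintro ⟨x₀, y₀⟩
  rcases eq_or_ne x₀ y₀ with rfl | hne
  · obtain ⟨r, s, hr, h⟩ := hk.vanish
    have hev : (fun _ : E n × E n => (0 : ℝ)) =ᶠ[𝓝 (x₀, x₀)] fun p => k p.1 p.2 := by
      have hc : ContinuousAt (fun p : E n × E n => ‖p.1 - p.2‖) (x₀, x₀) := by fun_prop
      have := hc.eventually_lt_const (show ‖x₀ - x₀‖ < r by simpa using hr)
      filter_upwards [this] with p hp
      exact (h _ _ (Or.inl hp)).symm
    exact continuousAt_const.congr hev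
  · have hpos : 0 < ‖x₀ - y₀‖ := norm_pos_iff.2 (sub_ne_zero.2 hne)
    have hc1 : ContinuousAt (fun p : E n × E n => ‖x₀ - p.1‖ / ‖x₀ - p.2‖) (x₀, y₀) :=
      ContinuousAt.div (by fun_prop) (by fun_prop) hpos.ne'
    have hc2 : ContinuousAt (fun p : E n × E n => ‖y₀ - p.2‖ / ‖y₀ - x₀‖) (x₀, y₀) := by fun_prop
    have hc3 : ContinuousAt (fun p : E n × E n => ‖x₀ - p.2‖ ^ (α - n)) (x₀, y₀) :=
      ContinuousAt.rpow_const (by fun_prop) (Or.inl hpos.ne')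
    have hb : ContinuousAt (fun p : E n × E n =>
        C * (‖x₀ - p.1‖ / ‖x₀ - p.2‖) ^ θ * ‖x₀ - p.2‖ ^ (α - n) +
          C * (‖y₀ - p.2‖ / ‖y₀ - x₀‖) ^ θ * ‖y₀ - x₀‖ ^ (α - n)) (x₀, y₀) :=
      ((continuousAt_const.mul (hc1.rpow_const (Or.inr hθ.le))).mul hc3).add
        ((continuousAt_const.mul (hc2.rpow_const (Or.inr hθ.le))).mul continuousAt_const)
    have hb0 := hb.tendsto
    simp only [sub_self, norm_zero, zero_div, Real.zero_rpow hθ.ne', mul_zero, zero_mul,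
      add_zero] at hb0
    have e1 := hc1.eventually_lt_const (show ‖x₀ - x₀‖ / ‖x₀ - y₀‖ < 1 / 2 by simp)
    have e2 := hc2.eventually_lt_const (show ‖y₀ - y₀‖ / ‖y₀ - x₀‖ < 1 / 2 by simp)
    have e3 : ∀ᶠ p : E n × E n in 𝓝 (x₀, y₀), 0 < ‖x₀ - p.2‖ := by
      have : ContinuousAt (fun p : E n × E n => ‖x₀ - p.2‖) (x₀, y₀) := by fun_prop
      exact this.eventually_const_lt hpos
    rw [ContinuousAt, tendsto_iff_dist_tendsto_zero]
    refine squeeze_zero' (Eventually.of_forall fun _ => dist_nonneg) ?_ hb0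
    filter_upwards [e1, e2, e3] with p h1 h2 h3
    have i1 := hk.standard.1.2 x₀ p.1 p.2 (by
      rintro h
      rw [h] at h3
      simp at h3) h1.le
    have i2 := hk.standard.2.2 y₀ p.2 x₀ hne.symm h2.le
    rw [Real.dist_eq]
    calc |k p.1 p.2 - k x₀ y₀| ≤ |k p.1 p.2 - k x₀ p.2| + |k x₀ p.2 - k x₀ y₀| :=
          abs_sub_le _ _ _
      _ ≤ _ := by
          exact add_le_add (by rw [abs_sub_comm]; exact i1) (by rw [abs_sub_comm]; exact i2)

lemma continuous_right (hk : IsTruncatedKernel α θ C k) (hθ : 0 < θ) (x : E n) :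
    Continuous (k x) :=
  (hk.continuous hθ).comp (by fun_prop : Continuous fun y : E n => (x, y))

lemma continuous_left (hk : IsTruncatedKernel α θ C k) (hθ : 0 < θ) (y : E n) :
    Continuous fun x => k x y :=
  (hk.continuous hθ).comp (by fun_prop : Continuous fun x : E n => (x, y))

lemma integrable (hk : IsTruncatedKernel α θ C k) (hθ : 0 < θ) (hC : 0 < C) (hαn : α < n)
    (μ : Measure (E n)) [IsFiniteMeasure μ] (x : E n) : Integrable (k x) μ := by
  obtain ⟨M, -, hM⟩ := hk.exists_bound hC hαn
  exact Integrable.of_bound (hk.continuous_right hθ x).aestronglyMeasurable M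
    (Eventually.of_forall fun y => hM x y)

lemma continuous_potential (hk : IsTruncatedKernel α θ C k) (hθ : 0 < θ) (hC : 0 < C)
    (hαn : α < n) (μ : Measure (E n)) [IsFiniteMeasure μ] : Continuous (potential k μ) := by
  obtain ⟨M, -, hM⟩ := hk.exists_bound hC hαn
  exact continuous_of_dominated (fun x => (hk.continuous_right hθ x).aestronglyMeasurable)
    (fun x => Eventually.of_forall fun y => hM x y) (integrable_const M)
    (Eventually.of_forall fun y => hk.continuous_left hθ y)

lemma potential_add (hk : IsTruncatedKernel α θ C k) (hθ : 0 < θ) (hC : 0 < C)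
    (hαn : α < n) (μ : Measure (E n)) [IsFiniteMeasure μ] {S : Set (E n)} (hS : MeasurableSet S)
    (x : E n) : potential k μ x = potential k (μ.restrict S) x + potential k (μ.restrict Sᶜ) x :=
  (integral_add_compl hS (hk.integrable hθ hC hαn μ x)).symm

/-- The smoothness of the kernel, integrated against a measure of growth `n - α`. -/
lemma lintegral_enorm_sub_le (hk : IsTruncatedKernel α θ C k) (hθ : 0 < θ) (hC : 0 < C)
    (hαn : α < n) {ν : Measure (E n)} {x z : E n} {ρ : ℝ} {A : ℝ≥0∞} (hρ : 0 < ρ)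
    (hν : ∀ t, 0 < t → ν (Metric.closedBall z t) ≤ A * ENNReal.ofReal (t ^ (n - α)))
    (hx : ‖z - x‖ ≤ ρ / 2) :
    ∫⁻ y in (Metric.closedBall z ρ)ᶜ, ‖k z y - k x y‖ₑ ∂ν ≤
      ENNReal.ofReal C * annuliConst (n - α) θ * A := by
  -- Smoothness gains (ρ/|z - y|)^θ over the size bound. The tail integral produces ρ^(-θ), which
  -- cancels ρ^θ and leaves a scale-free bound.
  have hpt : ∀ y ∈ (Metric.closedBall z ρ)ᶜ, ‖k z y - k x y‖ₑ ≤
      ENNReal.ofReal (C * ρ ^ θ) * ENNReal.ofReal (‖z - y‖ ^ (-(n - α) - θ)) := by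
    intro y hy
    rw [Set.mem_compl_iff, Metric.mem_closedBall, not_le, dist_comm, dist_eq_norm] at hy
    have hzy : 0 < ‖z - y‖ := hρ.trans hy
    rw [← ENNReal.ofReal_mul (by positivity), Real.enorm_eq_ofReal_abs]
    refine ENNReal.ofReal_le_ofReal ?_
    refine (hk.standard.1.2 z x y (sub_ne_zero.1 (norm_pos_iff.1 hzy)) ?_).trans ?_
    · rw [div_le_iff₀ hzy]
      linarith
    · rw [Real.div_rpow (norm_nonneg _) hzy.le, neg_sub, Real.rpow_sub hzy (α - n)]
      calc C * (‖z - x‖ ^ θ / ‖z - y‖ ^ θ) * ‖z - y‖ ^ (α - n)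
          = C * ‖z - x‖ ^ θ * (‖z - y‖ ^ (α - n) / ‖z - y‖ ^ θ) := by ring
        _ ≤ C * ρ ^ θ * (‖z - y‖ ^ (α - n) / ‖z - y‖ ^ θ) := by
            gcongr
            linarith
  calc ∫⁻ y in (Metric.closedBall z ρ)ᶜ, ‖k z y - k x y‖ₑ ∂ν
      ≤ ∫⁻ y in (Metric.closedBall z ρ)ᶜ,
          ENNReal.ofReal (C * ρ ^ θ) * ENNReal.ofReal (‖z - y‖ ^ (-(n - α) - θ)) ∂ν :=
        setLIntegral_mono' Metric.isClosed_closedBall.measurableSet.compl hpt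
    _ = ENNReal.ofReal (C * ρ ^ θ) * ∫⁻ y in (Metric.closedBall z ρ)ᶜ,
          ENNReal.ofReal (‖z - y‖ ^ (-(n - α) - θ)) ∂ν :=
        lintegral_const_mul' _ _ ENNReal.ofReal_ne_top
    _ ≤ ENNReal.ofReal (C * ρ ^ θ) *
          (annuliConst (n - α) θ * A * ENNReal.ofReal (ρ ^ (-θ))) := by
        gcongr
        exact lintegral_compl_closedBall_le (by linarith) hθ hρ hν
    _ = ENNReal.ofReal C * annuliConst (n - α) θ * A *
          ENNReal.ofReal (ρ ^ θ * ρ ^ (-θ)) := by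
        rw [ENNReal.ofReal_mul hC.le, ENNReal.ofReal_mul (by positivity)]
        ring
    _ = _ := by
        rw [← Real.rpow_add hρ, add_neg_cancel, Real.rpow_zero, ENNReal.ofReal_one, mul_one]

/-- The far part of a potential varies little. -/
lemma enorm_potential_sub_le (hk : IsTruncatedKernel α θ C k) (hθ : 0 < θ) (hC : 0 < C)
    (hαn : α < n) {ν : Measure (E n)} [IsFiniteMeasure ν] {x z : E n} {ρ : ℝ} {A : ℝ≥0∞}
    (hρ : 0 < ρ)
    (hν : ∀ t, 0 < t → ν (Metric.closedBall z t) ≤ A * ENNReal.ofReal (t ^ (n - α)))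
    (hx : ‖z - x‖ ≤ ρ / 2) :
    ‖potential k (ν.restrict (Metric.closedBall z ρ)ᶜ) z -
      potential k (ν.restrict (Metric.closedBall z ρ)ᶜ) x‖ₑ ≤
      ENNReal.ofReal C * annuliConst (n - α) θ * A := by
  rw [potential, potential, ← integral_sub (hk.integrable hθ hC hαn _ _)
    (hk.integrable hθ hC hαn _ _)]
  exact (enorm_integral_le_lintegral_enorm _).trans
    (hk.lintegral_enorm_sub_le hθ hC hαn hρ hν hx)

end IsTruncatedKernel

end Kernel

end RestrictedWeak

/-! ### Local weak type bounds with respect to Lebesgue measure -/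

namespace RestrictedWeak

variable {n : ℕ} {α θ C : ℝ} {k : E n → E n → ℝ}

/-- Boundedness on `L²`, as a bilinear form on bounded integrable functions. -/
def IsL2Form (k : E n → E n → ℝ) (B : ℝ≥0) : Prop :=
  ∀ f g : E n → ℝ, Integrable f → Integrable g → (∃ M, ∀ x, |f x| ≤ M) → (∃ M, ∀ x, |g x| ≤ M) →
    |∫ x, g x * ∫ y, k x y * f y| ≤ B * √(∫ x, f x ^ 2) * √(∫ x, g x ^ 2)

/-- The `L²` bound controls level sets. -/
lemma IsL2Form.sq_mul_volume_le {B : ℝ≥0} (h : IsL2Form k B) {f : E n → ℝ} (hf : Integrable f)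
    (hfM : ∃ M, ∀ x, |f x| ≤ M) {S : Set (E n)} (hS : MeasurableSet S) (hSfin : volume S ≠ ∞)
    {t s : ℝ} (ht : 0 < t) (hs : s ^ 2 = 1) (hpot : ∀ x ∈ S, t ≤ s * ∫ y, k x y * f y)
    (hint : IntegrableOn (fun x => ∫ y, k x y * f y) S) :
    t ^ 2 * volume.real S ≤ B ^ 2 * ∫ x, f x ^ 2 := by
  have habs : |s| = 1 := by
    rw [← abs_one, ← sq_eq_sq_iff_abs_eq_abs, hs, one_pow]
  -- Testing the form against g = s 1_S gives t|S| ≤ B ‖f‖₂ |S|^(1/2); dividing by |S|^(1/2) and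
  -- squaring ends the proof.
  have hg : Integrable (S.indicator fun _ : E n => s) :=
    (integrable_indicator_iff hS).2 (integrableOn_const hSfin)
  have h1 := h f (S.indicator fun _ => s) hf hg hfM ⟨1, fun x => by
    by_cases hx : x ∈ S <;> simp [hx, habs]⟩
  have h2 : ∫ x, (S.indicator (fun _ : E n => s) x) ^ 2 = volume.real S := by
    have : (fun x => (S.indicator (fun _ : E n => s) x) ^ 2) = S.indicator fun _ => (1 : ℝ) := by
      ext x
      by_cases hx : x ∈ S <;> simp [hx, hs]
    rw [this, integral_indicator hS]
    simp
  have h3 : ∫ x, S.indicator (fun _ : E n => s) x * ∫ y, k x y * f y =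
      ∫ x in S, s * ∫ y, k x y * f y := by
    rw [← integral_indicator hS]
    congr 1 with x
    by_cases hx : x ∈ S <;> simp [hx]
  have h4 : t * volume.real S ≤ ∫ x in S, s * ∫ y, k x y * f y := by
    have := setIntegral_mono_on (μ := volume) (f := fun _ => t) (integrableOn_const hSfin)
      (hint.const_mul s) hS hpot
    simpa [mul_comm] using this
  rw [h2, h3] at h1
  have h5 := h4.trans ((le_abs_self _).trans h1)
  have hI : 0 ≤ ∫ x, f x ^ 2 := integral_nonneg fun x => sq_nonneg _
  have hV : 0 ≤ volume.real S := measureReal_nonneg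
  set V := volume.real S
  set I := ∫ x, f x ^ 2
  rcases hV.eq_or_lt with h0 | hpos
  · rw [← h0, mul_zero]
    positivity
  have h6 : t * √V ≤ B * √I := by
    have h7 : t * √V * √V ≤ B * √I * √V := by
      rw [mul_assoc, Real.mul_self_sqrt hV]
      exact h5
    exact le_of_mul_le_mul_right h7 (Real.sqrt_pos.2 hpos)
  calc t ^ 2 * V = (t * √V) ^ 2 := by rw [mul_pow, Real.sq_sqrt hV]
    _ ≤ (B * √I) ^ 2 := by gcongr
    _ = B ^ 2 * I := by rw [mul_pow, Real.sq_sqrt hI]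

/-- The local weak type estimate when `α > 0`: the potential is dominated by a fractional
integral. -/
lemma IsTruncatedKernel.weakType_of_pos (hk : IsTruncatedKernel α θ C k) (hα : 0 < α)
    (hαn : α < n) (hθ : 0 < θ) (μ : Measure (E n)) [IsFiniteMeasure μ] (z : E n)
    {ρ : ℝ} (hρ : 0 < ρ) {t : ℝ} :
    ENNReal.ofReal t * volume (Metric.closedBall z ρ ∩ {x | t < |potential k μ x|}) ≤
      ENNReal.ofReal C * ((annuliConst (n - α) α + 1) * volume (Metric.ball (0 : E n) 1)) *
        ENNReal.ofReal (ρ ^ α) * μ Set.univ := by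
  set b := volume (Metric.ball (0 : E n) 1)
  have hsize : ∀ x y, ‖k x y‖ₑ ≤ ENNReal.ofReal C * ENNReal.ofReal (‖x - y‖ ^ (α - n)) := by
    intro x y
    rcases eq_or_ne x y with rfl | hxy
    · obtain ⟨r, s, hr, h⟩ := hk.vanish
      rw [h x x (Or.inl (by simpa using hr))]
      simp
    · rw [← ENNReal.ofReal_mul' (by positivity), Real.enorm_eq_ofReal_abs]
      exact ENNReal.ofReal_le_ofReal (hk.standard.1.1 x y hxy)
  -- The bound is uniform in `y`, wherever it lies: within ρ of `y` the singularity is integrable,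
  -- and further away the kernel is at most C ρ^(α-n). Chebyshev and Tonelli then suffice.
  have hinner : ∀ y, ∫⁻ x in Metric.closedBall z ρ, ‖k x y‖ₑ ≤
      ENNReal.ofReal C * ((annuliConst (n - α) α + 1) * b) * ENNReal.ofReal (ρ ^ α) := by
    intro y
    have hfar : ∫⁻ x in Metric.closedBall z ρ \ Metric.closedBall y ρ,
        ENNReal.ofReal (‖x - y‖ ^ (α - n)) ≤ b * ENNReal.ofReal (ρ ^ α) := by
      calc ∫⁻ x in Metric.closedBall z ρ \ Metric.closedBall y ρ,
            ENNReal.ofReal (‖x - y‖ ^ (α - n))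
          ≤ ∫⁻ _x in Metric.closedBall z ρ \ Metric.closedBall y ρ,
            ENNReal.ofReal (ρ ^ (α - n)) := by
            refine setLIntegral_mono' (Metric.isClosed_closedBall.measurableSet.diff
              Metric.isClosed_closedBall.measurableSet) fun x hx => ?_
            have h1 := hx.2
            rw [Metric.mem_closedBall, not_le, dist_eq_norm] at h1
            exact ENNReal.ofReal_le_ofReal
              (Real.rpow_le_rpow_of_nonpos hρ h1.le (by linarith))
        _ ≤ ENNReal.ofReal (ρ ^ (α - n)) * (b * ENNReal.ofReal (ρ ^ ((n : ℝ) - 0))) := by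
            rw [setLIntegral_const]
            gcongr
            exact (measure_mono Set.sdiff_subset).trans (volume_closedBall_le z hρ)
        _ = b * ENNReal.ofReal (ρ ^ (α - n) * ρ ^ ((n : ℝ) - 0)) := by
            rw [ENNReal.ofReal_mul (by positivity)]
            ring
        _ = _ := by
            rw [← Real.rpow_add hρ]
            congr 3
            ring
    calc ∫⁻ x in Metric.closedBall z ρ, ‖k x y‖ₑ
        ≤ ∫⁻ x in Metric.closedBall z ρ,
            ENNReal.ofReal C * ENNReal.ofReal (‖x - y‖ ^ (α - n)) :=
          lintegral_mono fun x => hsize x y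
      _ = ENNReal.ofReal C * ∫⁻ x in Metric.closedBall z ρ,
            ENNReal.ofReal (‖x - y‖ ^ (α - n)) :=
          lintegral_const_mul' _ _ ENNReal.ofReal_ne_top
      _ ≤ ENNReal.ofReal C * ∫⁻ x in Metric.closedBall y ρ ∪
            Metric.closedBall z ρ \ Metric.closedBall y ρ,
            ENNReal.ofReal (‖x - y‖ ^ (α - n)) := by
          gcongr
          rw [Set.union_sdiff_self]
          exact Set.subset_union_right
      _ ≤ ENNReal.ofReal C * (annuliConst (n - α) α * b * ENNReal.ofReal (ρ ^ α) +
            b * ENNReal.ofReal (ρ ^ α)) := by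
          gcongr
          exact (lintegral_union_le _ _ _).trans
            (add_le_add (lintegral_closedBall_rpow_le hα hαn y hρ) hfar)
      _ = _ := by ring
  have hmeas : Measurable fun p : E n × E n => ‖k p.1 p.2‖ₑ :=
    (hk.continuous hθ).measurable.enorm
  calc ENNReal.ofReal t * volume (Metric.closedBall z ρ ∩ {x | t < |potential k μ x|})
      ≤ ENNReal.ofReal t * (volume.restrict (Metric.closedBall z ρ))
          {x | ENNReal.ofReal t ≤ ∫⁻ y, ‖k x y‖ₑ ∂μ} := by
        rw [Measure.restrict_apply' Metric.isClosed_closedBall.measurableSet, Set.inter_comm]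
        gcongr with x
        intro hx
        refine le_trans ?_ (enorm_integral_le_lintegral_enorm _)
        rw [Real.enorm_eq_ofReal_abs]
        exact ENNReal.ofReal_le_ofReal (le_of_lt hx)
    _ ≤ ∫⁻ x in Metric.closedBall z ρ, ∫⁻ y, ‖k x y‖ₑ ∂μ :=
        mul_meas_ge_le_lintegral hmeas.lintegral_prod_right' _
    _ = ∫⁻ y, (∫⁻ x in Metric.closedBall z ρ, ‖k x y‖ₑ) ∂μ :=
        lintegral_lintegral_swap hmeas.aemeasurable
    _ ≤ ∫⁻ _y, ENNReal.ofReal C * ((annuliConst (n - α) α + 1) * b) *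
          ENNReal.ofReal (ρ ^ α) ∂μ := lintegral_mono hinner
    _ = _ := by rw [lintegral_const]

/-- The neighbourhoods of disjoint cubes on which `μ` has large density have small volume. -/
lemma volume_biUnion_closedBall_le (μ : Measure (E n)) {t : ℝ≥0∞} {I : Set (ℤ × (Fin n → ℤ))}
    (hdisj : I.PairwiseDisjoint dyadicCube)
    (hI : ∀ p ∈ I, t * volume (dyadicCube p) ≤ μ (dyadicCube p)) :
    t * volume (⋃ p ∈ I, Metric.closedBall (dyadicCorner p) (2 * (n * (2 : ℝ) ^ (-p.1)))) ≤
      ENNReal.ofReal ((2 * n) ^ n) * volume (Metric.ball (0 : E n) 1) * μ Set.univ := by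
  have hball : ∀ p : ℤ × (Fin n → ℤ),
      volume (Metric.closedBall (dyadicCorner p) (2 * (n * (2 : ℝ) ^ (-p.1)))) =
      ENNReal.ofReal ((2 * n) ^ n) * volume (Metric.ball (0 : E n) 1) *
        volume (dyadicCube p) := by
    intro p
    rw [Measure.addHaar_closedBall _ _ (by positivity), volume_dyadicCube,
      ← ENNReal.ofReal_pow (by positivity), mul_right_comm, ← ENNReal.ofReal_mul (by positivity)]
    simp only [finrank_euclideanSpace, Fintype.card_fin]
    congr 2
    ring
  have hunion := measure_biUnion_le (volume : Measure (E n)) I.to_countable fun p =>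
    Metric.closedBall (dyadicCorner p) (2 * (n * (2 : ℝ) ^ (-p.1)))
  generalize ENNReal.ofReal ((2 * n) ^ n) * volume (Metric.ball (0 : E n) 1) = κ at hball ⊢
  refine (mul_le_mul_right hunion t).trans ?_
  rw [← ENNReal.tsum_mul_left]
  have hterm : ∀ p : I, t * volume (Metric.closedBall (dyadicCorner (p : ℤ × (Fin n → ℤ)))
      (2 * (n * (2 : ℝ) ^ (-(p : ℤ × (Fin n → ℤ)).1)))) ≤
      κ * μ (dyadicCube (p : ℤ × (Fin n → ℤ))) := by
    intro p
    rw [hball, mul_left_comm]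
    exact mul_le_mul_right (hI p p.2) κ
  refine (ENNReal.tsum_le_tsum hterm).trans ?_
  rw [ENNReal.tsum_mul_left, ← measure_biUnion I.to_countable hdisj
    fun p _ => measurableSet_dyadicCube p]
  exact mul_le_mul_right (measure_mono (Set.subset_univ _)) κ

/-- The Calderón-Zygmund decomposition of a finite measure at height `t`. The measure is replaced
by the bounded density `g`, which has the same integrals over the cubes of the decomposition. The
points of each cube are moved to its corner by `c`, and `rad` is comparable to its side length:
the cube is either a small one, or its neighbourhood belongs to the exceptional set `Ex`. -/
lemma exists_calderonZygmund_decomposition (hn : 0 < n) (μ : Measure (E n)) [IsFiniteMeasure μ]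
    {t r : ℝ} (ht : 0 < t) (hr : 0 < r) :
    ∃ (c : E n → E n) (rad g : E n → ℝ) (Ex : Set (E n)), Measurable c ∧ Measurable g ∧
      (∀ y, 0 ≤ g y) ∧ (∀ y, g y ≤ 2 ^ n * t) ∧
      μ.map c = (volume.withDensity fun y => ENNReal.ofReal (g y)).map c ∧
      (∀ y, 0 < rad y) ∧ (∀ y, ‖c y - y‖ ≤ rad y / 2) ∧ MeasurableSet Ex ∧
      ENNReal.ofReal t * volume Ex ≤
        ENNReal.ofReal ((2 * n) ^ n) * volume (Metric.ball (0 : E n) 1) * μ Set.univ ∧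
      ∀ y, Metric.closedBall (c y) (rad y) ⊆ Ex ∨ rad y < r := by
  have hn0 : (0 : ℝ) < n := by exact_mod_cast hn
  have ht' : ENNReal.ofReal t ≠ 0 := by simpa using ht
  obtain ⟨N, hN⟩ : ∃ N : ℤ, 2 * (n * (2 : ℝ) ^ (-N)) < r := by
    obtain ⟨d, hd⟩ := exists_pow_lt_of_lt_one (show 0 < r / (2 * n) by positivity)
      (show (1 / 2 : ℝ) < 1 by norm_num)
    refine ⟨d, ?_⟩
    rw [lt_div_iff₀ (by positivity), one_div, inv_pow, ← zpow_natCast, ← zpow_neg] at hd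
    linarith
  -- Heavy cubes are sought only down to generation `N`, and every cube of generation `N` stops as
  -- well. The maximal cubes therefore tile the space, and `μ` may be singular. The leftover cubes
  -- are so small that the truncated kernel will not see them.
  set Sel : ℤ × (Fin n → ℤ) → Prop := fun p =>
    p.1 ≤ N ∧ ENNReal.ofReal t * volume (dyadicCube p) < μ (dyadicCube p)
  set P : ℤ × (Fin n → ℤ) → Prop := fun p => Sel p ∨ p.1 = N
  have hbdd : ∃ k₀ : ℤ, ∀ k < k₀, ∀ z, ¬ P (k, z) := by
    obtain ⟨k₀, hk₀⟩ := exists_forall_lt_volume_dyadicCube hn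
      (ENNReal.div_ne_top (measure_ne_top μ Set.univ) ht')
    refine ⟨min k₀ N, fun j hj w => ?_⟩
    rintro (⟨-, h⟩ | h)
    · have h1 := hk₀ j (hj.trans_le (min_le_left _ _)) w
      rw [ENNReal.div_lt_iff (Or.inl ht') (Or.inl ENNReal.ofReal_ne_top), mul_comm] at h1
      exact absurd ((h1.trans h).trans_le (measure_mono (Set.subset_univ _))) (lt_irrefl _)
    · exact absurd (hj.trans_le (min_le_right _ _)) (by simp only at h; omega)
  have hex : ∀ x : E n, ∃ p ∈ maximalCubes P, x ∈ dyadicCube p := fun x =>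
    exists_mem_maximalCubes hbdd (x := x) (k := N) (Or.inr rfl)
  choose Φ hΦmax hΦmem using hex
  have hfib : ∀ p ∈ maximalCubes P, Φ ⁻¹' {p} = dyadicCube p := by
    intro p hp
    ext x
    simp only [Set.mem_preimage, Set.mem_singleton_iff]
    refine ⟨fun h => h ▸ hΦmem x, fun h => ?_⟩
    by_contra hne
    exact Set.disjoint_left.1 (pairwiseDisjoint_maximalCubes (hΦmax x) hp hne) (hΦmem x) h
  have hfib' : ∀ p ∉ maximalCubes P, Φ ⁻¹' {p} = ∅ := by
    intro p hp
    ext x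
    simp only [Set.mem_preimage, Set.mem_singleton_iff, Set.mem_empty_iff_false, iff_false]
    rintro rfl
    exact hp (hΦmax x)
  have hΦ : Measurable Φ := by
    refine measurable_to_countable' fun p => ?_
    by_cases hp : p ∈ maximalCubes P
    · rw [hfib p hp]
      exact measurableSet_dyadicCube p
    · rw [hfib' p hp]
      exact MeasurableSet.empty
  -- Whether heavy or of generation `N`, a maximal cube has a parent that is not heavy.
  have hmax_le : ∀ p ∈ maximalCubes P, μ (dyadicCube p) ≤
      ENNReal.ofReal (2 ^ n * t) * volume (dyadicCube p) := by
    intro p hp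
    obtain ⟨x, hx⟩ := dyadicCube_nonempty p
    have hle : p.1 ≤ N := by
      rcases hp.1 with h | h
      · exact h.1
      · exact h.le
    have hpar := not_parent_of_mem_maximalCubes hp hx
    have h1 : μ (dyadicCube (p.1 - 1, dyadicIndex (p.1 - 1) x)) ≤
        ENNReal.ofReal t * volume (dyadicCube (p.1 - 1, dyadicIndex (p.1 - 1) x)) := by
      by_contra hcon
      exact hpar (Or.inl ⟨by simp only; omega, not_le.1 hcon⟩)
    calc μ (dyadicCube p) ≤ _ := measure_mono (dyadicCube_subset_parent hx)
      _ ≤ _ := h1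
      _ = _ := by
          rw [volume_dyadicCube_pred p.1 _ p.2, ENNReal.ofReal_mul (by positivity),
            ENNReal.ofReal_pow zero_le_two]
          simp only [Prod.mk.eta, ENNReal.ofReal_ofNat]
          ring
  set γ : E n → ℝ≥0∞ := fun y => μ (dyadicCube (Φ y)) / volume (dyadicCube (Φ y)) with hγ
  have hγm : Measurable γ :=
    (Measurable.of_discrete (f := fun p : ℤ × (Fin n → ℤ) =>
      μ (dyadicCube p) / volume (dyadicCube p))).comp hΦ
  have hγle : ∀ y, γ y ≤ ENNReal.ofReal (2 ^ n * t) := fun y =>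
    ENNReal.div_le_of_le_mul (hmax_le _ (hΦmax y))
  have hγtop : ∀ y, γ y ≠ ∞ := fun y => ((hγle y).trans_lt ENNReal.ofReal_lt_top).ne
  -- Equality of the averages over the tiles, as pushforwards to the countable index set. The corner
  -- map factors through `Φ`, so it inherits this.
  have hmap : μ.map Φ = (volume.withDensity γ).map Φ := by
    refine Measure.ext_of_singleton fun p => ?_
    rw [Measure.map_apply hΦ (measurableSet_singleton p),
      Measure.map_apply hΦ (measurableSet_singleton p)]
    by_cases hp : p ∈ maximalCubes P
    · rw [hfib p hp, withDensity_apply _ (measurableSet_dyadicCube p)]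
      have : ∫⁻ y in dyadicCube p, γ y = ∫⁻ _y in dyadicCube p,
          μ (dyadicCube p) / volume (dyadicCube p) := by
        refine setLIntegral_congr_fun (measurableSet_dyadicCube p) fun y hy => ?_
        have : Φ y = p := by
          rw [← hfib p hp] at hy
          exact hy
        simp only [hγ, this]
      rw [this, setLIntegral_const,
        ENNReal.div_mul_cancel (volume_dyadicCube_ne_zero p) (volume_dyadicCube_ne_top p)]
    · rw [hfib' p hp, measure_empty, measure_empty]
  have hofReal : (fun y => ENNReal.ofReal (γ y).toReal) = γ :=
    funext fun y => ENNReal.ofReal_toReal (hγtop y)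
  have hcorner : Measurable (dyadicCorner (n := n)) := Measurable.of_discrete
  set I : Set (ℤ × (Fin n → ℤ)) := {p | p ∈ maximalCubes P ∧ Sel p}
  set rad : ℤ × (Fin n → ℤ) → ℝ := fun p => 2 * (n * (2 : ℝ) ^ (-p.1)) with hrad
  have hradpos : ∀ p, 0 < rad p := fun p => by positivity
  set Ex : Set (E n) := ⋃ p ∈ I, Metric.closedBall (dyadicCorner p) (rad p)
  have hExm : MeasurableSet Ex := MeasurableSet.biUnion (Set.to_countable _)
    fun p _ => Metric.isClosed_closedBall.measurableSet
  have hExvol := volume_biUnion_closedBall_le μ (t := ENNReal.ofReal t) (I := I)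
    (pairwiseDisjoint_maximalCubes.subset fun p hp => hp.1) fun p hp => hp.2.2.le
  refine ⟨fun y => dyadicCorner (Φ y), fun y => rad (Φ y), fun y => (γ y).toReal, Ex,
    hcorner.comp hΦ, hγm.ennreal_toReal, fun y => ENNReal.toReal_nonneg,
    fun y => ENNReal.toReal_le_of_le_ofReal (by positivity) (hγle y), ?_,
    fun y => hradpos _, fun y => ?_, hExm, hExvol, fun y => ?_⟩
  · rw [hofReal]
    have h1 := congrArg (Measure.map dyadicCorner) hmap
    rwa [Measure.map_map hcorner hΦ, Measure.map_map hcorner hΦ] at h1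
  · rw [norm_sub_rev, hrad]
    have := norm_sub_dyadicCorner_le (hΦmem y)
    linarith
  · by_cases hsel : Sel (Φ y)
    · left
      exact Set.subset_biUnion_of_mem (u := fun p => Metric.closedBall (dyadicCorner p) (rad p))
        (show Φ y ∈ I from ⟨hΦmax y, hsel⟩)
    · right
      have hyN : (Φ y).1 = N := (hΦmax y).1.resolve_left hsel
      simpa only [hrad, hyN] using hN

/-- The weak type `(1, 1)` estimate for finite measures when `α = 0`, by the
Calderón-Zygmund decomposition. -/
lemma IsTruncatedKernel.weakType_of_isL2Form (hn : 0 < n) (hk : IsTruncatedKernel 0 θ C k)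
    (hθ : 0 < θ) (hC : 0 < C) {B : ℝ≥0} (hB : IsL2Form k B) (μ : Measure (E n))
    [IsFiniteMeasure μ] (z : E n) {ρ : ℝ} {t : ℝ} (ht : 0 < t) :
    ENNReal.ofReal t * volume (Metric.closedBall z ρ ∩ {x | t < |potential k μ x|}) ≤
      (ENNReal.ofReal ((2 * n) ^ n) * volume (Metric.ball (0 : E n) 1) +
        4 * (ENNReal.ofReal C * annuliConst (n - 0) θ * volume (Metric.ball (0 : E n) 1)) +
        ENNReal.ofReal (8 * B ^ 2 * 2 ^ n)) * μ Set.univ := by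
  have hn0 : (0 : ℝ) < n := by exact_mod_cast hn
  generalize hK₀ : ENNReal.ofReal C * annuliConst (n - 0) θ * volume (Metric.ball (0 : E n) 1) = K₀
  obtain ⟨r, s, hr, hvan⟩ := hk.vanish
  obtain ⟨r, s, hr, hvan⟩ := hk.vanish
  -- Radii below r/2 ensure that, for x within `rad y` of `c y`, both `c y` and `y` are within r of
  -- x, where the kernel vanishes.
  obtain ⟨c, rad, g, Ex, hcm, hgm, hg0, hgle, hmap, hradpos, hdist, hExm, hExvol, hEx⟩ :=
    exists_calderonZygmund_decomposition hn μ ht (show 0 < r / 2 by positivity)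
  set μg := volume.withDensity fun y => ENNReal.ofReal (g y) with hμg
  have hμguniv : μg Set.univ = μ Set.univ := by
    have h1 := congrArg (fun m => m Set.univ) hmap
    simp only [Measure.map_apply hcm MeasurableSet.univ, Set.preimage_univ] at h1
    exact h1.symm
  have hμgfin : IsFiniteMeasure μg := ⟨by rw [hμguniv]; exact measure_lt_top _ _⟩
  have hlint : ∫⁻ y, ENNReal.ofReal (g y) = μ Set.univ := by
    rw [← hμguniv, hμg, withDensity_apply _ MeasurableSet.univ, Measure.restrict_univ]
  have hgint : Integrable g := by
    refine ⟨hgm.aestronglyMeasurable, ?_⟩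
    rw [hasFiniteIntegral_iff_ofReal (Eventually.of_forall hg0), hlint]
    exact measure_lt_top _ _
  have hgI : ∫ y, g y = μ.real Set.univ := by
    rw [integral_eq_lintegral_of_nonneg_ae (Eventually.of_forall hg0) hgm.aestronglyMeasurable,
      hlint]
    rfl
  have hpotg : ∀ x, potential k μg x = ∫ y, k x y * g y := by
    intro x
    rw [potential, hμg, integral_withDensity_eq_integral_toReal_smul hgm.ennreal_ofReal
      (Eventually.of_forall fun y => ENNReal.ofReal_lt_top)]
    simp only [smul_eq_mul, mul_comm, ENNReal.toReal_ofReal (hg0 _)]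
  -- Both measures have the same image under `c`, so ∫ k(x, c y) agrees for them. The bad part Tμ -
  -- Tμ_g is thus controlled by the displacement errors `h` of the two measures.
  set h : E n → ℝ≥0∞ := fun x => ∫⁻ y, ‖k x (c y) - k x y‖ₑ ∂(μ + μg) with hh
  have hjoint : Measurable fun p : E n × E n => ‖k p.1 (c p.2) - k p.1 p.2‖ₑ := by
    have h1 : Measurable fun p : E n × E n => k p.1 (c p.2) :=
      (hk.continuous hθ).measurable.comp (measurable_fst.prodMk (hcm.comp measurable_snd))
    exact (h1.sub (hk.continuous hθ).measurable).enorm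
  obtain ⟨M, hM0, hM⟩ := hk.exists_bound hC hn0
  have hcompare : ∀ x, ‖potential k μ x - potential k μg x‖ₑ ≤ h x := by
    intro x
    have hkc : ∀ ν : Measure (E n), IsFiniteMeasure ν → Integrable (fun y => k x (c y)) ν :=
      fun ν _ => Integrable.of_bound
        ((hk.continuous_right hθ x).measurable.comp hcm).aestronglyMeasurable M
        (Eventually.of_forall fun y => hM x _)
    have heq : ∫ y, k x (c y) ∂μ = ∫ y, k x (c y) ∂μg := by
      have hm := hk.continuous_right hθ x
      have e1 := integral_map (μ := μ) hcm.aemeasurable hm.aestronglyMeasurable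
      have e2 := integral_map (μ := μg) hcm.aemeasurable hm.aestronglyMeasurable
      rw [hmap] at e1
      exact e1.symm.trans e2
    have hki := fun (ν : Measure (E n)) [IsFiniteMeasure ν] => hk.integrable hθ hC hn0 ν x
    have hdiff : potential k μ x - potential k μg x =
        -(∫ y, (k x (c y) - k x y) ∂μ) + ∫ y, (k x (c y) - k x y) ∂μg := by
      rw [integral_sub (hkc μ inferInstance) (hki μ), integral_sub (hkc μg inferInstance) (hki μg),
        heq]
      simp only [potential]
      ring
    rw [hdiff, hh]
    simp only
    rw [lintegral_add_measure]
    refine (enorm_add_le _ _).trans ?_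
    rw [enorm_neg]
    exact add_le_add (enorm_integral_le_lintegral_enorm _) (enorm_integral_le_lintegral_enorm _)
  -- Only the region outside the ball about `c y` matters: for a heavy cube the ball lies in `Ex`,
  -- for a small one the integrand vanishes on it. Integration is in the first variable, hence the
  -- adjoint kernel.
  have hosc : ∀ y, ∫⁻ x in Exᶜ, ‖k x (c y) - k x y‖ₑ ≤ K₀ := by
    intro y
    have htail := hk.swap.lintegral_enorm_sub_le hθ hC hn0 (ν := volume) (hradpos y)
      (fun τ hτ => volume_closedBall_le (c y) hτ) (hdist y)
    rw [hK₀] at htail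
    refine le_trans ?_ htail
    rcases hEx y with hy | hy
    · exact lintegral_mono_set (Set.compl_subset_compl.2 hy)
    · refine (setLIntegral_le_lintegral _ _).trans ?_
      rw [← lintegral_add_compl _
        (Metric.isClosed_closedBall.measurableSet : MeasurableSet
          (Metric.closedBall (c y) (rad y)))]
      have hzero : ∫⁻ x in Metric.closedBall (c y) (rad y), ‖k x (c y) - k x y‖ₑ = 0 := by
        rw [setLIntegral_congr_fun (g := fun _ => 0) Metric.isClosed_closedBall.measurableSet]
        · simp
        intro x hx
        rw [Metric.mem_closedBall, dist_eq_norm] at hx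
        have hpos := hradpos y
        have hxy : ‖x - y‖ ≤ ‖x - c y‖ + ‖c y - y‖ := norm_sub_le_norm_sub_add_norm_sub _ _ _
        have := hdist y
        simp only
        rw [hvan x (c y) (Or.inl (by linarith)), hvan x y (Or.inl (by linarith))]
        simp
      rw [hzero, zero_add]
  have hhint : ∫⁻ x in Exᶜ, h x ≤ 2 * K₀ * μ Set.univ := by
    calc ∫⁻ x in Exᶜ, h x = ∫⁻ y, (∫⁻ x in Exᶜ, ‖k x (c y) - k x y‖ₑ) ∂(μ + μg) :=
          lintegral_lintegral_swap hjoint.aemeasurable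
      _ ≤ ∫⁻ _y, K₀ ∂(μ + μg) := lintegral_mono hosc
      _ = _ := by
          rw [lintegral_const, Measure.add_apply, hμguniv]
          ring
  have hhm : Measurable h := hjoint.lintegral_prod_right'
  have hosc_set : ENNReal.ofReal t * volume (Exᶜ ∩ {x | ENNReal.ofReal (t / 2) ≤ h x}) ≤
      4 * K₀ * μ Set.univ := by
    have h1 := mul_meas_ge_le_lintegral (μ := volume.restrict Exᶜ) hhm (ENNReal.ofReal (t / 2))
    rw [Measure.restrict_apply' hExm.compl, Set.inter_comm] at h1
    have h2 : ENNReal.ofReal t = 2 * ENNReal.ofReal (t / 2) := by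
      rw [← ENNReal.ofReal_ofNat 2, ← ENNReal.ofReal_mul zero_le_two]
      congr 1
      ring
    rw [h2, mul_assoc]
    calc _ ≤ 2 * (2 * K₀ * μ Set.univ) := mul_le_mul_right (h1.trans hhint) 2
      _ = _ := by ring
  -- the averaged part
  have hcont : Continuous (potential k μg) := hk.continuous_potential hθ hC hn0 μg
  have hgsq : ∫ y, g y ^ 2 ≤ 2 ^ n * t * μ.real Set.univ := by
    rw [← hgI, ← integral_const_mul]
    refine integral_mono_of_nonneg (Eventually.of_forall fun y => sq_nonneg _)
      (hgint.const_mul _) (Eventually.of_forall fun y => ?_)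
    simp only
    rw [sq]
    exact mul_le_mul_of_nonneg_right (hgle y) (hg0 y)
  -- Since 0 ≤ g ≤ 2^n t, the squared L² norm of `g` is at most 2^n t μ(ℝⁿ), so the L² bound at
  -- height t/2 gives order 1/t. The L² test treats one sign of the potential at a time.
  have hgood : ∀ σ : ℝ, σ ^ 2 = 1 → ENNReal.ofReal t *
      volume (Metric.closedBall z ρ ∩ {x | t / 2 < σ * potential k μg x}) ≤
      ENNReal.ofReal (4 * B ^ 2 * 2 ^ n) * μ Set.univ := by
    intro σ hσ
    set S := Metric.closedBall z ρ ∩ {x | t / 2 < σ * potential k μg x}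
    have hSm : MeasurableSet S := Metric.isClosed_closedBall.measurableSet.inter
      (measurableSet_lt measurable_const (hcont.measurable.const_mul σ))
    have hSfin : volume S ≠ ∞ :=
      ((measure_mono Set.inter_subset_left).trans_lt measure_closedBall_lt_top).ne
    have hint : IntegrableOn (fun x => ∫ y, k x y * g y) S := by
      simp only [← hpotg]
      exact (hcont.continuousOn.integrableOn_compact (isCompact_closedBall z ρ)).mono_set
        Set.inter_subset_left
    have h1 := hB.sq_mul_volume_le hgint ⟨2 ^ n * t, fun x => by
      rw [abs_of_nonneg (hg0 x)]
      exact hgle x⟩ hSm hSfin (half_pos ht) hσ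
      (fun x hx => by
        rw [← hpotg]
        exact le_of_lt hx.2) hint
    have h2 : t * volume.real S ≤ 4 * B ^ 2 * 2 ^ n * μ.real Set.univ := by
      have h3 : (t / 2) ^ 2 * volume.real S ≤ B ^ 2 * (2 ^ n * t * μ.real Set.univ) :=
        h1.trans (by gcongr)
      have h4 : t * (t * volume.real S) ≤ t * (4 * B ^ 2 * 2 ^ n * μ.real Set.univ) := by
        linarith
      exact le_of_mul_le_mul_left h4 ht
    rw [← ENNReal.ofReal_toReal hSfin, ← ENNReal.ofReal_mul ht.le,
      ← ENNReal.ofReal_toReal (measure_ne_top μ Set.univ), ← ENNReal.ofReal_mul (by positivity)]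
    exact ENNReal.ofReal_le_ofReal h2
  have hsub : Metric.closedBall z ρ ∩ {x | t < |potential k μ x|} ⊆
      Ex ∪ (Exᶜ ∩ {x | ENNReal.ofReal (t / 2) ≤ h x}) ∪
        ((Metric.closedBall z ρ ∩ {x | t / 2 < 1 * potential k μg x}) ∪
          (Metric.closedBall z ρ ∩ {x | t / 2 < (-1) * potential k μg x})) := by
    rintro x ⟨hxB, hx⟩
    by_cases hxE : x ∈ Ex
    · exact Or.inl (Or.inl hxE)
    by_cases hxh : ENNReal.ofReal (t / 2) ≤ h x
    · exact Or.inl (Or.inr ⟨hxE, hxh⟩)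
    right
    have h1 := (hcompare x).trans_lt (not_le.1 hxh)
    rw [Real.enorm_eq_ofReal_abs, ENNReal.ofReal_lt_ofReal_iff (half_pos ht)] at h1
    have h2 : t < |potential k μ x| := hx
    have h3 : t / 2 < |potential k μg x| := by
      have := abs_sub_abs_le_abs_sub (potential k μ x) (potential k μg x)
      linarith
    rcases lt_abs.1 h3 with h4 | h4
    · exact Or.inl ⟨hxB, by simpa using h4⟩
    · exact Or.inr ⟨hxB, by simpa using h4⟩
  calc ENNReal.ofReal t * volume (Metric.closedBall z ρ ∩ {x | t < |potential k μ x|})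
      ≤ ENNReal.ofReal t * (volume Ex + volume (Exᶜ ∩ {x | ENNReal.ofReal (t / 2) ≤ h x}) +
          (volume (Metric.closedBall z ρ ∩ {x | t / 2 < 1 * potential k μg x}) +
            volume (Metric.closedBall z ρ ∩ {x | t / 2 < (-1) * potential k μg x}))) := by
        gcongr
        exact (measure_mono hsub).trans ((measure_union_le _ _).trans
          (add_le_add (measure_union_le _ _) (measure_union_le _ _)))
    _ = ENNReal.ofReal t * volume Ex +
          ENNReal.ofReal t * volume (Exᶜ ∩ {x | ENNReal.ofReal (t / 2) ≤ h x}) +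
          (ENNReal.ofReal t *
              volume (Metric.closedBall z ρ ∩ {x | t / 2 < 1 * potential k μg x}) +
            ENNReal.ofReal t *
              volume (Metric.closedBall z ρ ∩ {x | t / 2 < (-1) * potential k μg x})) := by
        ring
    _ ≤ ENNReal.ofReal ((2 * n) ^ n) * volume (Metric.ball (0 : E n) 1) * μ Set.univ +
          4 * K₀ * μ Set.univ +
          (ENNReal.ofReal (4 * B ^ 2 * 2 ^ n) * μ Set.univ +
            ENNReal.ofReal (4 * B ^ 2 * 2 ^ n) * μ Set.univ) :=
        add_le_add (add_le_add hExvol hosc_set)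
          (add_le_add (hgood 1 (by norm_num)) (hgood (-1) (by norm_num)))
    _ = _ := by
        rw [show (8 : ℝ) * B ^ 2 * 2 ^ n = 4 * B ^ 2 * 2 ^ n + 4 * B ^ 2 * 2 ^ n by ring,
          ENNReal.ofReal_add (by positivity) (by positivity)]
        ring

/-- The local weak type estimate for potentials of finite measures. -/
lemma exists_weakType (hn : 0 < n) (hα : 0 ≤ α) (hαn : α < n) (hθ : 0 < θ) (hC : 0 < C)
    (B : ℝ≥0) : ∃ W : ℝ≥0, ∀ k : E n → E n → ℝ, IsTruncatedKernel α θ C k →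
      (α = 0 → IsL2Form k B) → ∀ (μ : Measure (E n)) [IsFiniteMeasure μ] (z : E n) (ρ t : ℝ),
      0 < ρ → 0 < t →
      ENNReal.ofReal t * volume (Metric.closedBall z ρ ∩ {x | t < |potential k μ x|}) ≤
        W * ENNReal.ofReal (ρ ^ α) * μ Set.univ := by
  have hb : volume (Metric.ball (0 : E n) 1) ≠ ∞ := measure_ball_lt_top.ne
  rcases hα.eq_or_lt with rfl | hpos
  · have hW : ENNReal.ofReal ((2 * n) ^ n) * volume (Metric.ball (0 : E n) 1) +
        4 * (ENNReal.ofReal C * annuliConst (n - 0) θ * volume (Metric.ball (0 : E n) 1)) +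
        ENNReal.ofReal (8 * B ^ 2 * 2 ^ n) ≠ ∞ := by
      have := annuliConst_ne_top (n - 0) hθ
      finiteness
    refine ⟨(ENNReal.ofReal ((2 * n) ^ n) * volume (Metric.ball (0 : E n) 1) +
        4 * (ENNReal.ofReal C * annuliConst (n - 0) θ * volume (Metric.ball (0 : E n) 1)) +
        ENNReal.ofReal (8 * B ^ 2 * 2 ^ n)).toNNReal,
      fun k hk hB μ _ z ρ t hρ ht => ?_⟩
    rw [ENNReal.coe_toNNReal hW, Real.rpow_zero, ENNReal.ofReal_one, mul_one]
    exact hk.weakType_of_isL2Form hn hθ hC (hB rfl) μ z ht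
  · have hW : ENNReal.ofReal C *
        ((annuliConst (n - α) α + 1) * volume (Metric.ball (0 : E n) 1)) ≠ ∞ := by
      have := annuliConst_ne_top (n - α) hpos
      finiteness
    refine ⟨(ENNReal.ofReal C *
      ((annuliConst (n - α) α + 1) * volume (Metric.ball (0 : E n) 1))).toNNReal,
      fun k hk _ μ _ z ρ t hρ ht => ?_⟩
    rw [ENNReal.coe_toNNReal hW]
    exact hk.weakType_of_pos hpos hαn hθ μ z hρ

end RestrictedWeak

/-! ### Fractional maximal function, good-λ inequality, weak type (2,2) -/

namespace RestrictedWeak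

variable {n : ℕ} {α θ C : ℝ} {k : E n → E n → ℝ}

/-- The set where the centred fractional maximal function of `ν` exceeds `t`. -/
def maximalLevelSet (α : ℝ) (ν : Measure (E n)) (t : ℝ) : Set (E n) :=
  {z | ∃ ρ, 0 < ρ ∧ ENNReal.ofReal t * ENNReal.ofReal (ρ ^ (n - α)) < ν (Metric.closedBall z ρ)}

/-- The two weight weak type inequality for the fractional maximal function. -/
lemma measure_maximalLevelSet_le (hn : 0 < n) (hαn : α < n) (σ ω : Measure (E n)) {A : Set (E n)}
    (hA : σ A ≠ ∞) {t : ℝ} (ht : 0 < t) :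
    ENNReal.ofReal t ^ 2 * ω (maximalLevelSet α (σ.restrict A) t) ≤
      ENNReal.ofReal (10 ^ (n - α)) ^ 2 * muckenhoupt α σ ω * σ A := by
  set ν := σ.restrict A with hν
  have hνuniv : ν Set.univ = σ A := by rw [hν, Measure.restrict_apply_univ]
  have hs : 0 < (n : ℝ) - α := by linarith
  -- All balls witnessing the level set. Their radii are bounded because σ(A) is finite, as Vitali's
  -- lemma requires.
  set T : Set (E n × ℝ) := {p | 0 < p.2 ∧
    ENNReal.ofReal t * ENNReal.ofReal (p.2 ^ (n - α)) < ν (Metric.closedBall p.1 p.2)}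
  have hrad : ∀ p ∈ T, p.2 ≤ ((σ A).toReal / t) ^ (n - α)⁻¹ := by
    rintro p ⟨hp0, hp⟩
    have h1 := hp.trans_le (measure_mono (Set.subset_univ _))
    rw [hνuniv, ← ENNReal.ofReal_mul ht.le] at h1
    have h2 := (ENNReal.ofReal_lt_iff_lt_toReal (by positivity) hA).1 h1
    rw [Real.le_rpow_inv_iff_of_pos hp0.le (by positivity) hs, le_div_iff₀ ht]
    linarith
  obtain ⟨u, huT, hdisj, hcov⟩ := Vitali.exists_disjoint_subfamily_covering_enlargement_closedBall
    T Prod.fst Prod.snd _ hrad 5 (by norm_num)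
  have hucount : u.Countable := by
    refine hdisj.countable_of_nonempty_interior fun p hp => ?_
    refine Set.Nonempty.mono Metric.ball_subset_interior_closedBall ?_
    exact ⟨p.1, Metric.mem_ball_self (huT hp).1⟩
  have hsub : maximalLevelSet α ν t ⊆ ⋃ p ∈ u, Metric.closedBall p.1 (5 * p.2) := by
    rintro z ⟨ρ, hρ, hz⟩
    obtain ⟨b, hb, hzb⟩ := hcov (z, ρ) ⟨hρ, hz⟩
    exact Set.mem_iUnion₂.2 ⟨b, hb, hzb (Metric.mem_closedBall_self hρ.le)⟩
  have hball : ∀ p ∈ u, ENNReal.ofReal t ^ 2 * ω (Metric.closedBall p.1 (5 * p.2)) ≤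
      ENNReal.ofReal (10 ^ (n - α)) ^ 2 * muckenhoupt α σ ω * ν (Metric.closedBall p.1 p.2) := by
    intro p hp
    obtain ⟨hp0, hp1⟩ := huT hp
    set r := ENNReal.ofReal (p.2 ^ (n - α)) with hr
    have hr0 : r ^ 2 ≠ 0 := by
      refine pow_ne_zero _ ?_
      simp only [hr, ne_eq, ENNReal.ofReal_eq_zero, not_le]
      positivity
    have hrt : r ^ 2 ≠ ∞ := ENNReal.pow_ne_top ENNReal.ofReal_ne_top
    set Q := cube (WithLp.toLp 2 fun i => p.1 i - 5 * p.2) (2 * (5 * p.2)) with hQ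
    have hBQ : Metric.closedBall p.1 (5 * p.2) ⊆ Q := closedBall_subset_cube p.1 (5 * p.2)
    have hνQ : ν (Metric.closedBall p.1 p.2) ≤ σ Q :=
      (Measure.restrict_apply_le _ _).trans (measure_mono
        ((Metric.closedBall_subset_closedBall (by linarith)).trans hBQ))
    have hA2 := le_muckenhoupt hn α σ ω (WithLp.toLp 2 fun i => p.1 i - 5 * p.2)
      (show 0 < 2 * (5 * p.2) by positivity)
    rw [← hQ, show 2 * (5 * p.2) = 10 * p.2 by ring, Real.mul_rpow (by norm_num) hp0.le,
      ENNReal.ofReal_mul (by positivity), ← hr] at hA2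
    refine (ENNReal.mul_le_mul_iff_right hr0 hrt).1 ?_
    -- The inequality t r < ν(ball) is used twice: one copy stays on the disjoint balls for
    -- summation, the other is enlarged to σ(Q) and paired with ω(Q). The cube around the fivefold
    -- ball has side 10 times the radius.
    calc r ^ 2 * (ENNReal.ofReal t ^ 2 * ω (Metric.closedBall p.1 (5 * p.2)))
        = (ENNReal.ofReal t * r) * (ENNReal.ofReal t * r) *
            ω (Metric.closedBall p.1 (5 * p.2)) := by ring
      _ ≤ ν (Metric.closedBall p.1 p.2) * σ Q * ω Q := by
          gcongr
          exact hp1.le.trans hνQ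
      _ = ν (Metric.closedBall p.1 p.2) * (σ Q * ω Q) := by ring
      _ ≤ ν (Metric.closedBall p.1 p.2) *
            ((ENNReal.ofReal (10 ^ (n - α)) * r) ^ 2 * muckenhoupt α σ ω) := by gcongr
      _ = _ := by ring
  calc ENNReal.ofReal t ^ 2 * ω (maximalLevelSet α ν t)
      ≤ ENNReal.ofReal t ^ 2 * ∑' p : u, ω (Metric.closedBall (p : E n × ℝ).1
          (5 * (p : E n × ℝ).2)) := by
        gcongr
        exact (measure_mono hsub).trans (measure_biUnion_le ω hucount
          fun p : E n × ℝ => Metric.closedBall p.1 (5 * p.2))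
    _ ≤ ∑' p : u, ENNReal.ofReal (10 ^ (n - α)) ^ 2 * muckenhoupt α σ ω *
          ν (Metric.closedBall (p : E n × ℝ).1 (p : E n × ℝ).2) := by
        rw [← ENNReal.tsum_mul_left]
        exact ENNReal.tsum_le_tsum fun p => hball p p.2
    _ = ENNReal.ofReal (10 ^ (n - α)) ^ 2 * muckenhoupt α σ ω *
          ν (⋃ p ∈ u, Metric.closedBall p.1 p.2) := by
        rw [ENNReal.tsum_mul_left, measure_biUnion hucount hdisj
          fun p _ => Metric.isClosed_closedBall.measurableSet]
    _ ≤ _ := by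
        rw [← hνuniv]
        gcongr
        exact Set.subset_univ _

/-- The weak type inequality of exponent two implies the restricted weak type inequality. -/
lemma setLIntegral_enorm_le_of_weakType {X : Type*} [MeasurableSpace X] {μ : Measure X}
    {f : X → ℝ} (hf : Measurable f) {V : ℝ≥0∞} (hV : V ≠ ∞)
    (h : ∀ t : ℝ, 0 < t → ENNReal.ofReal t ^ 2 * μ {x | t < |f x|} ≤ V) {F : Set X}
    (hF : μ F ≠ ∞) : ∫⁻ x in F, ‖f x‖ₑ ∂μ ≤ 2 * (V * μ F) ^ (1 / 2 : ℝ) := by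
  -- Layer cake cut at height T: below it level sets are bounded by μ(F), above it by V t⁻².
  have hsplit : ∀ T : ℝ, 0 < T → ∫⁻ x in F, ‖f x‖ₑ ∂μ ≤
      ENNReal.ofReal T * μ F + V * ENNReal.ofReal T⁻¹ := by
    intro T hT
    have h1 : ∫⁻ x in F, ‖f x‖ₑ ∂μ =
        ∫⁻ t in Set.Ioi 0, (μ.restrict F) {x | t < |f x|} := by
      rw [← lintegral_eq_lintegral_meas_lt _ (Eventually.of_forall fun x => abs_nonneg _)
        hf.abs.aemeasurable]
      simp only [Real.enorm_eq_ofReal_abs]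
    have h2 : ∫⁻ t in Set.Ioc 0 T, (μ.restrict F) {x | t < |f x|} ≤
        ENNReal.ofReal T * μ F := by
      calc ∫⁻ t in Set.Ioc 0 T, (μ.restrict F) {x | t < |f x|}
          ≤ ∫⁻ _t in Set.Ioc 0 T, μ F := lintegral_mono fun t => by
            rw [← Measure.restrict_apply_univ (μ := μ) F]
            exact measure_mono (Set.subset_univ _)
        _ = _ := by rw [setLIntegral_const, Real.volume_Ioc, sub_zero, mul_comm]
    have h3 : ∫⁻ t in Set.Ioi T, (μ.restrict F) {x | t < |f x|} ≤ V * ENNReal.ofReal T⁻¹ := by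
      have h4 : ∫⁻ t in Set.Ioi T, ENNReal.ofReal (t ^ (-2 : ℝ)) = ENNReal.ofReal T⁻¹ := by
        rw [← ofReal_integral_eq_lintegral_ofReal
          (integrableOn_Ioi_rpow_of_lt (by norm_num) hT)
          ((ae_restrict_mem measurableSet_Ioi).mono fun t ht =>
            Real.rpow_nonneg (hT.trans ht).le _),
          integral_Ioi_rpow_of_lt (by norm_num) hT]
        congr 1
        rw [show (-2 : ℝ) + 1 = -1 by norm_num, Real.rpow_neg_one]
        ring
      rw [← h4, ← lintegral_const_mul' _ _ hV]
      refine setLIntegral_mono' measurableSet_Ioi fun t ht => ?_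
      have ht0 : 0 < t := hT.trans ht
      have h5 := (mul_le_mul_right (Measure.restrict_apply_le F {x | t < |f x|} (μ := μ))
        (ENNReal.ofReal t ^ 2)).trans (h t ht0)
      rw [Real.rpow_neg ht0.le, ENNReal.ofReal_inv_of_pos (by positivity), ← div_eq_mul_inv,
        ENNReal.le_div_iff_mul_le (Or.inl (by simp; positivity)) (Or.inl ENNReal.ofReal_ne_top),
        mul_comm]
      simpa [ENNReal.ofReal_pow ht0.le] using h5
    rw [h1, ← Set.Ioc_union_Ioi_eq_Ioi hT.le]
    exact (lintegral_union_le _ _ _).trans (add_le_add h2 h3)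
  have hXfin : ∫⁻ x in F, ‖f x‖ₑ ∂μ ≠ ∞ := by
    refine ((hsplit 1 one_pos).trans_lt ?_).ne
    finiteness
  generalize ∫⁻ x in F, ‖f x‖ₑ ∂μ = X at hsplit hXfin
  generalize μ F = w at hsplit hF
  lift X to ℝ≥0 using hXfin
  lift w to ℝ≥0 using hF
  lift V to ℝ≥0 using hV
  -- The optimisation in T is a discriminant inequality, which covers w = 0 and V = 0 without
  -- separate cases.
  have hquad : ∀ T : ℝ, 0 ≤ (w : ℝ) * (T * T) + (-X) * T + V := by
    intro T
    rcases le_or_gt T 0 with hT | hT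
    · have : 0 ≤ (-X : ℝ) * T := mul_nonneg_of_nonpos_of_nonpos (by simp) hT
      have : 0 ≤ (w : ℝ) * (T * T) := mul_nonneg w.2 (mul_self_nonneg T)
      have := V.2
      positivity
    · have h1 := ENNReal.toReal_mono (by finiteness) (hsplit T hT)
      rw [ENNReal.toReal_add (by finiteness) (by finiteness), ENNReal.toReal_mul,
        ENNReal.toReal_mul, ENNReal.toReal_ofReal hT.le,
        ENNReal.toReal_ofReal (by positivity)] at h1
      simp only [ENNReal.coe_toReal] at h1
      have h2 := mul_le_mul_of_nonneg_right h1 hT.le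
      rw [add_mul, mul_assoc (V : ℝ), inv_mul_cancel₀ hT.ne'] at h2
      linarith
  have hdisc := discrim_le_zero hquad
  rw [discrim] at hdisc
  have hX2 : X ^ 2 ≤ 4 * (V * w) := by
    rw [← NNReal.coe_le_coe]
    push_cast
    linarith
  have h3 : X ≤ 2 * (V * w) ^ (1 / 2 : ℝ) := by
    have h4 : X = (X ^ 2) ^ (1 / 2 : ℝ) := by
      rw [← NNReal.rpow_natCast, ← NNReal.rpow_mul]
      norm_num
    have h5 : (4 : ℝ≥0) ^ (1 / 2 : ℝ) = 2 := by
      rw [show (4 : ℝ≥0) = 2 ^ 2 by norm_num, ← NNReal.rpow_natCast, ← NNReal.rpow_mul]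
      norm_num
    rw [h4, ← h5, ← NNReal.mul_rpow]
    exact NNReal.rpow_le_rpow hX2 (by norm_num)
  rw [← ENNReal.coe_mul, ← ENNReal.coe_rpow_of_nonneg _ (by norm_num)]
  exact_mod_cast h3

/-- The level sets of the potential of a boundedly supported measure are bounded. -/
lemma IsTruncatedKernel.exists_levelSet_subset (hk : IsTruncatedKernel α θ C k) (σ : Measure (E n))
    {A : Set (E n)} (hA : IsCompact A) :
    ∃ R : ℝ, ∀ t : ℝ, 0 < t →
      {x | t < |potential k (σ.restrict A) x|} ⊆ Metric.closedBall 0 R := by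
  obtain ⟨r, s, hr, hvan⟩ := hk.vanish
  obtain ⟨R₀, hR₀⟩ := hA.isBounded.subset_closedBall 0
  refine ⟨R₀ + s, fun t ht x hx => ?_⟩
  by_contra hcon
  rw [Metric.mem_closedBall, dist_zero_right, not_le] at hcon
  have hzero : potential k (σ.restrict A) x = 0 := by
    refine integral_eq_zero_of_ae ?_
    filter_upwards [ae_restrict_mem hA.measurableSet] with y hy
    have h1 := hR₀ hy
    rw [Metric.mem_closedBall, dist_zero_right] at h1
    refine hvan x y (Or.inr ?_)
    have := norm_sub_norm_le x y
    linarith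
  have hx' : t < |potential k (σ.restrict A) x| := hx
  rw [hzero, abs_zero] at hx'
  exact absurd hx' (not_lt.2 ht.le)

/-- The good-`λ` inequality for Lebesgue measure on one of the maximal cubes on which the potential
is larger than `t` except for a small proportion. -/
lemma volume_dyadicCube_inter_lt (hn : 0 < n) (hαn : α < n) (hθ : 0 < θ) (hC : 0 < C)
    (hk : IsTruncatedKernel α θ C k) {W : ℝ≥0}
    (hW : ∀ (μ : Measure (E n)) [IsFiniteMeasure μ] (z : E n) (ρ t : ℝ), 0 < ρ → 0 < t →
      ENNReal.ofReal t * volume (Metric.closedBall z ρ ∩ {x | t < |potential k μ x|}) ≤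
        W * ENNReal.ofReal (ρ ^ α) * μ Set.univ)
    {δ γ t : ℝ} (hδ : 0 < δ) (hγ : 0 < γ) (ht : 0 < t)
    (hγ1 : 4 * W * (2 * n) ^ n * γ < δ / 2 ^ n)
    (hγ2 : 8 * (C * (annuliConst (n - α) θ).toReal) * γ ≤ 1)
    (hα : 0 ≤ α) (ν : Measure (E n)) [IsFiniteMeasure ν] {p : ℤ × (Fin n → ℤ)}
    (hp : p ∈ maximalCubes fun q => volume (dyadicCube q \ {x | t < |potential k ν x|}) <
      ENNReal.ofReal δ * volume (dyadicCube q)) {z : E n} (hz : z ∈ dyadicCube p)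
    (hzν : z ∉ maximalLevelSet α ν (γ * t)) :
    volume (dyadicCube p ∩ {x | 2 * t < |potential k ν x|}) <
      ENNReal.ofReal δ * volume (dyadicCube p) := by
  have hn0 : (0 : ℝ) < n := by exact_mod_cast hn
  have hgrow : ∀ ρ, 0 < ρ → ν (Metric.closedBall z ρ) ≤
      ENNReal.ofReal (γ * t) * ENNReal.ofReal (ρ ^ (n - α)) := by
    intro ρ hρ
    by_contra hcon
    exact hzν ⟨ρ, hρ, not_le.1 hcon⟩
  set l : ℝ := (2 : ℝ) ^ (-(p.1 - 1)) with hl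
  have hlpos : 0 < l := by positivity
  set par : ℤ × (Fin n → ℤ) := (p.1 - 1, dyadicIndex (p.1 - 1) z)
  have hparball : ∀ x ∈ dyadicCube par, ‖z - x‖ ≤ n * l := fun x hx =>
    norm_sub_le_of_mem_dyadicCube (mem_dyadicCube_self _ z) hx
  have hvolp : volume (dyadicCube p) = ENNReal.ofReal (l ^ n / 2 ^ n) := by
    rw [volume_dyadicCube, ← ENNReal.ofReal_pow (by positivity), ← div_pow, hl,
      show -(p.1 - 1) = -p.1 + 1 by ring, zpow_add_one₀ two_ne_zero]
    congr 2
    ring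
  -- With `l` the side of the parent, the parent lies within half the radius of `B`, so the far part
  -- of the potential is nearly constant on the parent.
  set B := Metric.closedBall z (2 * (n * l)) with hB
  have hBm : MeasurableSet B := Metric.isClosed_closedBall.measurableSet
  set ν₁ := ν.restrict B with hν₁
  set ν₂ := ν.restrict Bᶜ with hν₂
  have hsum : ∀ x, potential k ν x = potential k ν₁ x + potential k ν₂ x :=
    hk.potential_add hθ hC hαn ν hBm
  set D := Metric.closedBall z (n * l) ∩ {x | t / 4 < |potential k ν₁ x|} with hD
  have hDvol : volume D < ENNReal.ofReal δ * volume (dyadicCube p) := by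
    have h1 := hW ν₁ z (n * l) (t / 4) (by positivity) (by positivity)
    rw [hν₁, Measure.restrict_apply_univ] at h1
    have h2 := h1.trans (mul_le_mul_right (hgrow (2 * (n * l)) (by positivity)) _)
    rw [← hν₁, ← hD] at h2
    rw [hvolp, ← ENNReal.ofReal_mul hδ.le]
    have h3 : (W : ℝ≥0∞) * ENNReal.ofReal ((n * l) ^ α) *
        (ENNReal.ofReal (γ * t) * ENNReal.ofReal ((2 * (n * l)) ^ (n - α))) ≤
        ENNReal.ofReal (t / 4) * ENNReal.ofReal (4 * W * (2 * n) ^ n * γ * l ^ n) := by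
      rw [← ENNReal.ofReal_coe_nnreal, ← ENNReal.ofReal_mul (by positivity),
        ← ENNReal.ofReal_mul (by positivity), ← ENNReal.ofReal_mul (by positivity),
        ← ENNReal.ofReal_mul (by positivity)]
      refine ENNReal.ofReal_le_ofReal ?_
      have h4 : (n * l) ^ α * (2 * (n * l)) ^ (n - α) ≤ (2 * n) ^ n * l ^ n := by
        calc (n * l) ^ α * (2 * (n * l)) ^ (n - α)
            ≤ (2 * (n * l)) ^ α * (2 * (n * l)) ^ (n - α) := by
              have h0 : 0 < n * l := by positivity
              exact mul_le_mul_of_nonneg_right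
                (Real.rpow_le_rpow h0.le (by linarith) hα) (by positivity)
          _ = (2 * n) ^ n * l ^ n := by
              rw [← Real.rpow_add (by positivity), add_sub_cancel, Real.rpow_natCast, ← mul_pow,
                mul_assoc]
      calc (W : ℝ) * (n * l) ^ α * (γ * t * (2 * (n * l)) ^ (n - α))
          = W * γ * t * ((n * l) ^ α * (2 * (n * l)) ^ (n - α)) := by ring
        _ ≤ W * γ * t * ((2 * n) ^ n * l ^ n) := by gcongr
        _ = _ := by ring
    have h5 := (ENNReal.mul_le_mul_iff_right
      (by simpa using ht) ENNReal.ofReal_ne_top).1 (h2.trans h3)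
    refine h5.trans_lt ((ENNReal.ofReal_lt_ofReal_iff (by positivity)).2 ?_)
    calc 4 * W * (2 * n) ^ n * γ * l ^ n < δ / 2 ^ n * l ^ n := by gcongr
      _ = _ := by ring
  have hvar : ∀ x ∈ dyadicCube par, |potential k ν₂ z - potential k ν₂ x| ≤ t / 8 := by
    intro x hx
    have h1 := hk.enorm_potential_sub_le hθ hC hαn (ν := ν) (x := x) (z := z)
      (ρ := 2 * (n * l)) (by positivity) hgrow
      (by linarith [hparball x hx])
    rw [← hB, ← hν₂, Real.enorm_eq_ofReal_abs,
      ← ENNReal.ofReal_toReal (annuliConst_ne_top (n - α) hθ), ← ENNReal.ofReal_mul hC.le,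
      ← ENNReal.ofReal_mul (by positivity)] at h1
    have h2 := (ENNReal.ofReal_le_ofReal_iff (by positivity)).1 h1
    refine h2.trans ?_
    have := mul_le_mul_of_nonneg_right hγ2 ht.le
    linarith
  -- a point of the parent where both the potential and its local part are small
  obtain ⟨x', hx'par, hx'Ω, hx'D⟩ : ∃ x', x' ∈ dyadicCube par ∧ |potential k ν x'| ≤ t ∧
      |potential k ν₁ x'| ≤ t / 4 := by
    by_contra! hcon
    -- The parent is not selected, so at least the fraction δ of it lies outside the level set. The
    -- exceptional set `D` of the local part is too small to cover that.
    have hsub : dyadicCube par \ {x | t < |potential k ν x|} ⊆ D := by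
      rintro x ⟨hx1, hx2⟩
      refine ⟨?_, hcon x hx1 (not_lt.1 hx2)⟩
      rw [Metric.mem_closedBall, dist_comm, dist_eq_norm]
      exact hparball x hx1
    refine not_parent_of_mem_maximalCubes hp hz ?_
    refine (measure_mono hsub).trans_lt (hDvol.trans_le ?_)
    gcongr
    exact dyadicCube_subset_parent hz
  refine (measure_mono ?_).trans_lt hDvol
  rintro x ⟨hxp, hx⟩
  have hxpar : x ∈ dyadicCube par := dyadicCube_subset_parent hz hxp
  refine ⟨?_, ?_⟩
  · rw [Metric.mem_closedBall, dist_comm, dist_eq_norm]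
    exact hparball x hxpar
  · have hx2 : 2 * t < |potential k ν x| := hx
    have h1 := hvar x hxpar
    have h2 := hvar x' hx'par
    have h3 := hsum x
    have h4 := hsum x'
    show t / 4 < |potential k ν₁ x|
    by_contra! hcon
    -- Local part at x, two variations of the far part, potential and local part at x': t/4 + t/8 +
    -- t/8 + t + t/4 = 7t/4.
    have hxle : |potential k ν x| ≤ 2 * t := by
      have e : potential k ν x = potential k ν₁ x +
          (-(potential k ν₂ z - potential k ν₂ x) + (potential k ν₂ z - potential k ν₂ x') +
            (potential k ν x' - potential k ν₁ x')) := by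
        rw [h3, h4]
        ring
      rw [abs_le] at *
      constructor <;> linarith [h1.1, h1.2, h2.1, h2.2, hcon.1, hcon.2, hx'Ω.1, hx'Ω.2,
        hx'D.1, hx'D.2]
    linarith

/-- The good-`λ` inequality. -/
lemma measure_levelSet_le (hn : 0 < n) (hα : 0 ≤ α) (hαn : α < n) (hθ : 0 < θ) (hC : 0 < C)
    (hk : IsTruncatedKernel α θ C k) {W : ℝ≥0}
    (hW : ∀ (μ : Measure (E n)) [IsFiniteMeasure μ] (z : E n) (ρ t : ℝ), 0 < ρ → 0 < t →
      ENNReal.ofReal t * volume (Metric.closedBall z ρ ∩ {x | t < |potential k μ x|}) ≤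
        W * ENNReal.ofReal (ρ ^ α) * μ Set.univ)
    {ω : Measure (E n)} [IsLocallyFiniteMeasure ω] {δ γ t : ℝ} (hδ : 0 < δ) (hδ1 : δ < 1)
    (hω : ∀ (p : ℤ × (Fin n → ℤ)) (A : Set (E n)), A ⊆ dyadicCube p →
        volume A < ENNReal.ofReal δ * volume (dyadicCube p) →
        ω A ≤ ENNReal.ofReal (1 / 16) * ω (dyadicCube p))
    (hγ : 0 < γ) (ht : 0 < t)
    (hγ1 : 4 * W * (2 * n) ^ n * γ < δ / 2 ^ n)
    (hγ2 : 8 * (C * (annuliConst (n - α) θ).toReal) * γ ≤ 1)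
    (ν : Measure (E n)) [IsFiniteMeasure ν]
    (hfin : volume {x | t < |potential k ν x|} ≠ ∞) :
    ω {x | 2 * t < |potential k ν x|} ≤ ω (maximalLevelSet α ν (γ * t)) +
      ENNReal.ofReal (1 / 8) * ω {x | t < |potential k ν x|} := by
  set Ω := {x | t < |potential k ν x|}
  have hΩo : IsOpen Ω :=
    isOpen_lt continuous_const (hk.continuous_potential hθ hC hαn ν).abs
  -- Cubes almost contained in Ω replace a Whitney decomposition. A nearby point outside Ω would not
  -- do, since the local part could be large there; a positive proportion of such points in the
  -- parent leaves a choice.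
  set P : ℤ × (Fin n → ℤ) → Prop := fun q => volume (dyadicCube q \ Ω) <
    ENNReal.ofReal δ * volume (dyadicCube q)
  have hδ' : ENNReal.ofReal δ ≠ 0 := by simpa using hδ
  have h1δ : ENNReal.ofReal (1 - δ) ≠ 0 := by simpa using hδ1
  have hbdd : ∃ k₀ : ℤ, ∀ k < k₀, ∀ z, ¬ P (k, z) := by
    obtain ⟨k₀, hk₀⟩ := exists_forall_lt_volume_dyadicCube hn (ENNReal.div_ne_top hfin h1δ)
    refine ⟨k₀, fun j hj w hw => ?_⟩
    have h1 := hk₀ j hj w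
    rw [ENNReal.div_lt_iff (Or.inl h1δ) (Or.inl ENNReal.ofReal_ne_top)] at h1
    have hvt := volume_dyadicCube_ne_top (j, w)
    generalize hv : volume (dyadicCube (j, w)) = v at h1 hw hvt
    have h2 : v < v := by
      calc v ≤ volume Ω + volume (dyadicCube (j, w) \ Ω) := by
            rw [← hv]
            exact (measure_mono (by rw [Set.union_sdiff_self]; exact Set.subset_union_right)).trans
              (measure_union_le _ _)
        _ < v * ENNReal.ofReal (1 - δ) + ENNReal.ofReal δ * v := ENNReal.add_lt_add h1 (by
            have : volume (dyadicCube (j, w) \ Ω) < ENNReal.ofReal δ *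
              volume (dyadicCube (j, w)) := hw
            rwa [hv] at this)
        _ = v * (ENNReal.ofReal (1 - δ) + ENNReal.ofReal δ) := by ring
        _ = v := by
            rw [← ENNReal.ofReal_add (by linarith) hδ.le]
            simp
    exact lt_irrefl _ h2
  have hcov : Ω ⊆ ⋃ p ∈ maximalCubes P, dyadicCube p := by
    intro x hx
    obtain ⟨j, -, hj⟩ := exists_dyadicCube_subset hΩo hx 0
    obtain ⟨p, hp, hxp⟩ := exists_mem_maximalCubes (P := P) hbdd (x := x) (k := j) (by
      show volume (dyadicCube _ \ Ω) < _
      rw [Set.sdiff_eq_empty.2 hj, measure_empty]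
      exact ENNReal.mul_pos hδ' (volume_dyadicCube_ne_zero _))
    exact Set.mem_iUnion₂.2 ⟨p, hp, hxp⟩
  set Bad := maximalLevelSet α ν (γ * t)
  set G := {x | 2 * t < |potential k ν x|} \ Bad with hG
  have hGΩ : G ⊆ Ω := fun x hx => by
    have : 2 * t < |potential k ν x| := hx.1
    show t < |potential k ν x|
    linarith
  have hcube : ∀ p ∈ maximalCubes P, ω (dyadicCube p ∩ G) ≤
      ENNReal.ofReal (1 / 8) * ω (dyadicCube p ∩ Ω) := by
    intro p hp
    rcases Set.eq_empty_or_nonempty (dyadicCube p ∩ G) with hempty | ⟨z, hzp, hzG⟩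
    · rw [hempty, measure_empty]
      exact zero_le
    have h1 := volume_dyadicCube_inter_lt hn hαn hθ hC hk hW hδ hγ ht hγ1 hγ2 hα ν hp hzp hzG.2
    have h2 : ω (dyadicCube p ∩ G) ≤ ENNReal.ofReal (1 / 16) * ω (dyadicCube p) :=
      hω p _ Set.inter_subset_left ((measure_mono
        (Set.inter_subset_inter_right _ Set.sdiff_subset)).trans_lt h1)
    have h3 : ω (dyadicCube p \ Ω) ≤ ENNReal.ofReal (1 / 16) * ω (dyadicCube p) :=
      hω p _ Set.sdiff_subset hp.1
    have h4 : ω (dyadicCube p) ≤ ω (dyadicCube p ∩ Ω) + ω (dyadicCube p \ Ω) :=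
      measure_le_inter_add_sdiff _ _ _
    have hωt : ω (dyadicCube p) ≠ ∞ := ((measure_mono (dyadicCube_subset_cube p)).trans_lt
      (isCompact_cube _ (by positivity)).measure_lt_top).ne
    have hωt' : ω (dyadicCube p ∩ Ω) ≠ ∞ :=
      ((measure_mono Set.inter_subset_left).trans_lt hωt.lt_top).ne
    have h5 := h4.trans (add_le_add_right h3 _)
    -- From ω(p) ≤ ω(p ∩ Ω) + ω(p)/16 one gets ω(p)/16 ≤ ω(p ∩ Ω)/15, which is better than the 1/8
    -- needed.
    refine h2.trans ?_
    generalize ω (dyadicCube p) = x at h5 hωt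
    generalize ω (dyadicCube p ∩ Ω) = y at h5 hωt'
    lift x to ℝ≥0 using hωt
    lift y to ℝ≥0 using hωt'
    have h6 := ENNReal.toReal_mono (by finiteness) h5
    rw [ENNReal.toReal_add (by finiteness) (by finiteness), ENNReal.toReal_mul,
      ENNReal.toReal_ofReal (by norm_num), ENNReal.coe_toReal, ENNReal.coe_toReal] at h6
    rw [← ENNReal.toReal_le_toReal (by finiteness) (by finiteness), ENNReal.toReal_mul,
      ENNReal.toReal_mul, ENNReal.toReal_ofReal (by norm_num),
      ENNReal.toReal_ofReal (by norm_num), ENNReal.coe_toReal, ENNReal.coe_toReal]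
    have := y.2
    linarith
  have hGle : ω G ≤ ENNReal.ofReal (1 / 8) * ω Ω := by
    calc ω G ≤ ω (⋃ p ∈ maximalCubes P, dyadicCube p ∩ G) := by
          rw [← Set.iUnion₂_inter, Set.inter_eq_self_of_subset_right (hGΩ.trans hcov)]
      _ ≤ ∑' p : maximalCubes P, ω (dyadicCube (p : ℤ × (Fin n → ℤ)) ∩ G) :=
          measure_biUnion_le ω (Set.to_countable _) fun p => dyadicCube p ∩ G
      _ ≤ ∑' p : maximalCubes P,
            ENNReal.ofReal (1 / 8) * ω (dyadicCube (p : ℤ × (Fin n → ℤ)) ∩ Ω) :=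
          ENNReal.tsum_le_tsum fun p => hcube p p.2
      _ = _ := by
          rw [ENNReal.tsum_mul_left, tsum_measure_maximalCubes_inter ω hΩo.measurableSet,
            Set.inter_eq_self_of_subset_right hcov]
  calc ω {x | 2 * t < |potential k ν x|} ≤ ω (Bad ∪ G) := measure_mono (by
        rw [hG, Set.union_sdiff_self]
        exact Set.subset_union_right)
    _ ≤ ω Bad + ω G := measure_union_le _ _
    _ ≤ _ := by gcongr

/-- The weak type `(2, 2)` inequality on characteristic functions for an `A_∞` weight `ω`. -/
lemma exists_weakType_two (hn : 0 < n) (hα : 0 ≤ α) (hαn : α < n) (hθ : 0 < θ) (hC : 0 < C)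
    {ε η : ℝ} (hε : 0 < ε) (hε1 : ε < 1) (hη : η < 1) (B : ℝ≥0) :
    ∃ V : ℝ≥0, ∀ k : E n → E n → ℝ, IsTruncatedKernel α θ C k → (α = 0 → IsL2Form k B) →
      ∀ (σ ω : Measure (E n)) [IsLocallyFiniteMeasure σ] [IsLocallyFiniteMeasure ω],
      IsAInftyWith ε η ω → ∀ A : Set (E n), IsCompact A → ∀ t : ℝ, 0 < t →
      ENNReal.ofReal t ^ 2 * ω {x | t < |potential k (σ.restrict A) x|} ≤
        V * (muckenhoupt α σ ω * σ A) := by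
  obtain ⟨W, hW⟩ := exists_weakType hn hα hαn hθ hC B
  obtain ⟨δ, hδ, hδ1, hω⟩ := exists_forall_measure_le (n := n) hε hε1 hη
    (show (0 : ℝ) < 1 / 16 by norm_num)
  obtain ⟨γ, hγ, hγ1, hγ2⟩ : ∃ γ : ℝ, 0 < γ ∧ 4 * W * (2 * n) ^ n * γ < δ / 2 ^ n ∧
      8 * (C * (annuliConst (n - α) θ).toReal) * γ ≤ 1 := by
    have ha : 0 ≤ 4 * (W : ℝ) * (2 * n) ^ n := by positivity
    have hc : 0 ≤ 8 * (C * (annuliConst (n - α) θ).toReal) := by positivity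
    generalize 4 * (W : ℝ) * (2 * n) ^ n = a at ha
    generalize 8 * (C * (annuliConst (n - α) θ).toReal) = c at hc
    have hb : 0 < δ / 2 ^ n := by positivity
    generalize δ / 2 ^ n = b at hb
    -- One denominator serves both smallness conditions; the 1 in it gives strictness and excludes
    -- zero.
    refine ⟨min b 1 / (a + c + 1), by positivity, ?_, ?_⟩
    · rw [← mul_div_assoc, div_lt_iff₀ (by positivity)]
      have : min b 1 ≤ b := min_le_left _ _
      nlinarith
    · rw [← mul_div_assoc, div_le_iff₀ (by positivity)]
      have : min b 1 ≤ 1 := min_le_right _ _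
      nlinarith
  refine ⟨8 * Real.toNNReal γ⁻¹ ^ 2 * Real.toNNReal (10 ^ (n - α)) ^ 2,
    fun k hk hB σ ω _ _ h A hA t ht => ?_⟩
  have hσA : σ A ≠ ∞ := hA.measure_lt_top.ne
  set ν := σ.restrict A with hν
  have hνfin : IsFiniteMeasure ν := isFiniteMeasure_restrict.2 hσA
  obtain ⟨R, hR⟩ := hk.exists_levelSet_subset σ hA
  set a := ENNReal.ofReal (10 ^ (n - α)) ^ 2 * muckenhoupt α σ ω * σ A with ha
  have hγe : ENNReal.ofReal γ⁻¹ * ENNReal.ofReal γ = 1 := by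
    rw [← ENNReal.ofReal_mul (by positivity), inv_mul_cancel₀ hγ.ne', ENNReal.ofReal_one]
  set Ψ := ⨆ (t : ℝ) (_ : 0 < t), ENNReal.ofReal t ^ 2 * ω {x | t < |potential k ν x|}
  -- Needed to absorb half of `Ψ`. For a fixed truncation the potential is bounded and its level
  -- sets lie in one ball, so the supremum is finite, with no uniform control.
  have hΨfin : Ψ ≠ ∞ := by
    obtain ⟨M, hM0, hM⟩ := hk.exists_bound hC hαn
    have hbound : ∀ x, |potential k ν x| ≤ M * ν.real Set.univ := fun x =>
      norm_integral_le_of_norm_le_const (μ := ν) (f := k x) (C := M)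
        (Eventually.of_forall fun y => hM x y)
    have hball : ω (Metric.closedBall 0 R) ≠ ∞ := (isCompact_closedBall _ _).measure_lt_top.ne
    refine ne_top_of_le_ne_top (b := ENNReal.ofReal (M * ν.real Set.univ) ^ 2 *
      ω (Metric.closedBall 0 R)) (by finiteness) (iSup₂_le fun t ht => ?_)
    rcases le_or_gt t (M * ν.real Set.univ) with hle | hgt
    · gcongr
      exact hR t ht
    · have : {x | t < |potential k ν x|} = ∅ := by
        ext x
        simp only [Set.mem_ofPred_eq, Set.mem_empty_iff_false, iff_false, not_lt]
        exact (hbound x).trans hgt.le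
      rw [this, measure_empty, mul_zero]
      exact zero_le
  have hle : ∀ t : ℝ, 0 < t → ENNReal.ofReal t ^ 2 * ω {x | t < |potential k ν x|} ≤ Ψ :=
    fun t ht => le_iSup₂_of_le t ht le_rfl
  -- The good-λ inequality is applied at height t/2; halving the height costs a factor 4, and 4 ·
  -- 1/8 = 1/2.
  have hstep : Ψ ≤ 4 * ENNReal.ofReal γ⁻¹ ^ 2 * a + ENNReal.ofReal (1 / 2) * Ψ := by
    refine iSup₂_le fun t ht => ?_
    have ht2 : 0 < t / 2 := by positivity
    have h1 := measure_levelSet_le hn hα hαn hθ hC hk (hW k hk hB) hδ hδ1 (hω ω h) hγ ht2 hγ1 hγ2 ν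
      (((measure_mono (hR _ ht2)).trans_lt measure_closedBall_lt_top).ne)
    rw [mul_div_cancel₀ t two_ne_zero] at h1
    have h2 := measure_maximalLevelSet_le hn hαn σ ω hσA (show 0 < γ * (t / 2) by positivity)
    rw [← ha, ← hν] at h2
    have h3 := hle (t / 2) ht2
    have e1 : ENNReal.ofReal t = 2 * ENNReal.ofReal (t / 2) := by
      rw [← ENNReal.ofReal_ofNat 2, ← ENNReal.ofReal_mul zero_le_two]
      congr 1
      ring
    have e2 : ENNReal.ofReal t ^ 2 =
        4 * ENNReal.ofReal γ⁻¹ ^ 2 * ENNReal.ofReal (γ * (t / 2)) ^ 2 := by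
      rw [e1, ENNReal.ofReal_mul hγ.le]
      calc (2 * ENNReal.ofReal (t / 2)) ^ 2
          = 4 * (ENNReal.ofReal γ⁻¹ * ENNReal.ofReal γ) ^ 2 * ENNReal.ofReal (t / 2) ^ 2 := by
            rw [hγe]
            ring
        _ = _ := by ring
    have e3 : (4 : ℝ≥0∞) * ENNReal.ofReal (1 / 8) = ENNReal.ofReal (1 / 2) := by
      rw [← ENNReal.ofReal_ofNat 4, ← ENNReal.ofReal_mul (by norm_num)]
      norm_num
    calc ENNReal.ofReal t ^ 2 * ω {x | t < |potential k ν x|}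
        ≤ ENNReal.ofReal t ^ 2 * (ω (maximalLevelSet α ν (γ * (t / 2))) +
            ENNReal.ofReal (1 / 8) * ω {x | t / 2 < |potential k ν x|}) := by gcongr
      _ = 4 * ENNReal.ofReal γ⁻¹ ^ 2 * (ENNReal.ofReal (γ * (t / 2)) ^ 2 *
            ω (maximalLevelSet α ν (γ * (t / 2)))) + 4 * ENNReal.ofReal (1 / 8) *
            (ENNReal.ofReal (t / 2) ^ 2 * ω {x | t / 2 < |potential k ν x|}) := by
          rw [mul_add]
          congr 1
          · rw [e2]
            ring
          · rw [e1]
            ring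
      _ ≤ _ := by
          rw [e3]
          gcongr
  refine (hle t ht).trans ?_
  have hfinal : Ψ ≤ 2 * (4 * ENNReal.ofReal γ⁻¹ ^ 2 * a) := by
    generalize 4 * ENNReal.ofReal γ⁻¹ ^ 2 * a = b at hstep
    rcases eq_or_ne b ∞ with hb | hb
    · rw [hb]
      simp
    lift b to ℝ≥0 using hb
    clear_value Ψ
    lift Ψ to ℝ≥0 using hΨfin
    have h6 := ENNReal.toReal_mono (by finiteness) hstep
    rw [ENNReal.toReal_add (by finiteness) (by finiteness), ENNReal.toReal_mul,
      ENNReal.toReal_ofReal (by norm_num), ENNReal.coe_toReal, ENNReal.coe_toReal] at h6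
    rw [← ENNReal.toReal_le_toReal (by finiteness) (by finiteness), ENNReal.toReal_mul,
      ENNReal.coe_toReal, ENNReal.coe_toReal, ENNReal.toReal_ofNat]
    linarith
  refine hfinal.trans (le_of_eq ?_)
  simp only [ha, ENNReal.ofReal]
  push_cast
  ring

/-- The restricted weak type inequality for scalar truncated kernels. -/
lemma exists_restrictedWeakType (hn : 0 < n) (hα : 0 ≤ α) (hαn : α < n) (hθ : 0 < θ) (hC : 0 < C)
    {ε η : ℝ} (hε : 0 < ε) (hε1 : ε < 1) (hη : η < 1) (B : ℝ≥0) :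
    ∃ V : ℝ≥0, ∀ k : E n → E n → ℝ, IsTruncatedKernel α θ C k → (α = 0 → IsL2Form k B) →
      ∀ (σ ω : Measure (E n)) [IsLocallyFiniteMeasure σ] [IsLocallyFiniteMeasure ω],
      IsAInftyWith ε η ω → muckenhoupt α σ ω ≠ ∞ → ∀ A F : Set (E n), IsCompact A → IsCompact F →
      ‖∫ x in F, ∫ y in A, k x y ∂σ ∂ω‖ₑ ≤
        V * muckenhoupt α σ ω ^ (1 / 2 : ℝ) * (σ A * ω F) ^ (1 / 2 : ℝ) := by
  obtain ⟨V, hV⟩ := exists_weakType_two hn hα hαn hθ hC hε hε1 hη B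
  refine ⟨2 * V ^ (1 / 2 : ℝ), fun k hk hB σ ω _ _ h hA2 A F hA hF => ?_⟩
  have hσA : σ A ≠ ∞ := hA.measure_lt_top.ne
  have hνfin : IsFiniteMeasure (σ.restrict A) := isFiniteMeasure_restrict.2 hσA
  have hmeas := (hk.continuous_potential hθ hC hαn (σ.restrict A)).measurable
  refine (enorm_integral_le_lintegral_enorm _).trans
    ((setLIntegral_enorm_le_of_weakType hmeas (by finiteness) (hV k hk hB σ ω h A hA)
      hF.measure_lt_top.ne).trans (le_of_eq ?_))
  have h12 : (0 : ℝ) ≤ 1 / 2 := by norm_num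
  rw [ENNReal.coe_mul, ENNReal.coe_rpow_of_nonneg _ h12]
  simp only [ENNReal.mul_rpow_of_nonneg _ _ h12]
  push_cast
  ring

end RestrictedWeak

/-! ### Duality and reduction of vector operators to scalar kernels -/

namespace RestrictedWeak

variable {n m : ℕ} {α θ C : ℝ}

section Bilinear

variable {k : E n → E n → ℝ}

/-- The `L²` bound of a bilinear form passes to the adjoint kernel. -/
lemma IsL2Form.swap {B : ℝ≥0} (h : IsL2Form k B) (hk : IsTruncatedKernel α θ C k) (hθ : 0 < θ)
    (hC : 0 < C) (hαn : α < n) : IsL2Form (fun x y => k y x) B := by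
  intro f g hf hg hfM hgM
  obtain ⟨M, -, hM⟩ := hk.exists_bound hC hαn
  have hint : Integrable (Function.uncurry fun x y => k y x * (g x * f y))
      ((volume : Measure (E n)).prod volume) := by
    refine (hg.mul_prod hf).bdd_mul (c := M) ?_ (Eventually.of_forall fun p => hM p.2 p.1)
    exact ((hk.continuous hθ).comp continuous_swap).aestronglyMeasurable
  have h1 : ∫ x, g x * ∫ y, k y x * f y = ∫ x, f x * ∫ y, k x y * g y := by
    calc ∫ x, g x * ∫ y, k y x * f y = ∫ x, ∫ y, k y x * (g x * f y) := by
          congr 1 with x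
          rw [← integral_const_mul]
          congr 1 with y
          ring
      _ = ∫ y, ∫ x, k y x * (g x * f y) := integral_integral_swap hint
      _ = _ := by
          congr 1 with y
          rw [← integral_const_mul]
          congr 1 with x
          ring
  rw [h1]
  refine (h g f hg hf hgM hfM).trans (le_of_eq ?_)
  ring

lemma memLp_two_of_integrable_of_bounded {f : E n → ℝ} (hf : Integrable f)
    (hfM : ∃ M, ∀ x, |f x| ≤ M) : MemLp f 2 := by
  obtain ⟨M, hM⟩ := hfM
  rw [memLp_two_iff_integrable_sq hf.aestronglyMeasurable]
  simp only [sq]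
  exact hf.bdd_mul hf.aestronglyMeasurable (Eventually.of_forall hM)

lemma eLpNorm_two_eq {f : E n → ℝ} (hf : MemLp f 2) :
    eLpNorm f 2 = ENNReal.ofReal √(∫ x, f x ^ 2) := by
  rw [hf.eLpNorm_eq_integral_rpow_norm (by norm_num) (by norm_num), Real.sqrt_eq_rpow]
  simp

/-- Fubini's theorem for truncated kernels. -/
lemma IsTruncatedKernel.integral_swap (hk : IsTruncatedKernel α θ C k) (hθ : 0 < θ) (hC : 0 < C)
    (hαn : α < n) (σ ω : Measure (E n)) [IsLocallyFiniteMeasure σ] [IsLocallyFiniteMeasure ω]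
    {A F : Set (E n)} (hA : IsCompact A) (hF : IsCompact F) :
    ∫ x in F, ∫ y in A, k x y ∂σ ∂ω = ∫ y in A, ∫ x in F, k x y ∂ω ∂σ := by
  obtain ⟨M, -, hM⟩ := hk.exists_bound hC hαn
  have h1 : IsFiniteMeasure (σ.restrict A) := isFiniteMeasure_restrict.2 hA.measure_lt_top.ne
  have h2 : IsFiniteMeasure (ω.restrict F) := isFiniteMeasure_restrict.2 hF.measure_lt_top.ne
  exact integral_integral_swap (Integrable.of_bound (hk.continuous hθ).aestronglyMeasurable M
    (Eventually.of_forall fun p => hM p.1 p.2))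

end Bilinear

lemma enorm_euclideanSpace_le_sum (v : E m) : ‖v‖ₑ ≤ ∑ j, ‖v j‖ₑ := by
  have hv : v = ∑ j, EuclideanSpace.single j (v j) := by
    ext i
    simp
  have h1 : ‖v‖ ≤ ∑ j, ‖v j‖ := by
    calc ‖v‖ = ‖∑ j, EuclideanSpace.single j (v j)‖ := by rw [← hv]
      _ ≤ ∑ j, ‖EuclideanSpace.single j (v j)‖ := norm_sum_le _ _
      _ = _ := by simp
  calc ‖v‖ₑ = ENNReal.ofReal ‖v‖ := (ofReal_norm v).symm
    _ ≤ ENNReal.ofReal (∑ j, ‖v j‖) := ENNReal.ofReal_le_ofReal h1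
    _ = _ := by
        rw [ENNReal.ofReal_sum_of_nonneg fun j _ => norm_nonneg _]
        simp only [ofReal_norm]

namespace SingularIntegral

/-- The components of the truncated kernel. -/
noncomputable def truncKernel (T : SingularIntegral n m α θ C) (δ R : ℝ) (j : Fin m)
    (x y : E n) : ℝ :=
  T.cutoff δ R ‖x - y‖ * T.kernel x y j

variable (T : SingularIntegral n m α θ C) {δ R : ℝ}

lemma isTruncatedKernel (hδ : 0 < δ) (hδR : δ < R) (j : Fin m) :
    IsTruncatedKernel α θ C (T.truncKernel δ R j) := by
  obtain ⟨r, s, hr, h⟩ := T.cutoff_support δ R hδ hδR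
  exact ⟨T.truncated_standard δ R hδ hδR j, r, s, hr, fun x y hxy => by
    rw [truncKernel, h _ hxy, zero_mul]⟩

lemma trunc_apply {μ : Measure (E n)} {f : E n → ℝ} (hδ : 0 < δ) (hδR : δ < R) (hθ : 0 < θ)
    (hC : 0 < C) (hαn : α < n) (hf : Integrable f μ) (x : E n) (j : Fin m) :
    T.trunc δ R μ f x j = ∫ y, T.truncKernel δ R j x y * f y ∂μ := by
  rw [trunc, eval_integral_piLp]
  · congr 1 with y
    simp only [PiLp.smul_apply, smul_eq_mul, truncKernel]
    ring
  · intro i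
    obtain ⟨M, -, hM⟩ := (T.isTruncatedKernel hδ hδR i).exists_bound hC hαn
    have := hf.bdd_mul (c := M)
      ((T.isTruncatedKernel hδ hδR i).continuous_right hθ x).aestronglyMeasurable
      (Eventually.of_forall fun y => hM x y)
    refine this.congr (Eventually.of_forall fun y => ?_)
    simp only [PiLp.smul_apply, smul_eq_mul, truncKernel]
    ring

lemma trunc_indicator_apply {σ : Measure (E n)} [IsLocallyFiniteMeasure σ] {A : Set (E n)}
    (hA : IsCompact A) (hδ : 0 < δ) (hδR : δ < R) (hθ : 0 < θ) (hC : 0 < C) (hαn : α < n)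
    (x : E n) (j : Fin m) :
    T.trunc δ R σ (A.indicator 1) x j = ∫ y in A, T.truncKernel δ R j x y ∂σ := by
  have hint : Integrable (A.indicator (1 : E n → ℝ)) σ :=
    (integrable_indicator_iff hA.measurableSet).2 (integrableOn_const hA.measure_lt_top.ne)
  rw [T.trunc_apply hδ hδR hθ hC hαn hint, ← integral_indicator hA.measurableSet]
  congr 1 with y
  by_cases hy : y ∈ A <;> simp [hy]

lemma setIntegral_trunc_apply {σ ω : Measure (E n)} [IsLocallyFiniteMeasure σ]
    [IsLocallyFiniteMeasure ω] {A F : Set (E n)} (hA : IsCompact A) (hF : IsCompact F)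
    (hδ : 0 < δ) (hδR : δ < R) (hθ : 0 < θ) (hC : 0 < C) (hαn : α < n) (j : Fin m) :
    (∫ x in F, T.trunc δ R σ (A.indicator 1) x ∂ω) j =
      ∫ x in F, ∫ y in A, T.truncKernel δ R j x y ∂σ ∂ω := by
  rw [eval_integral_piLp]
  · simp only [T.trunc_indicator_apply hA hδ hδR hθ hC hαn]
  · intro i
    simp only [T.trunc_indicator_apply hA hδ hδR hθ hC hαn]
    have : IsFiniteMeasure (σ.restrict A) := isFiniteMeasure_restrict.2 hA.measure_lt_top.ne
    exact (((T.isTruncatedKernel hδ hδR i).continuous_potential hθ hC hαn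
      (σ.restrict A)).continuousOn).integrableOn_compact hF

/-- A component is pointwise dominated by the vector, so it inherits the norm bound; Cauchy–Schwarz
gives the form bound. -/
lemma isL2Form {B : ℝ≥0} (h : T.IsL2BoundedBy B) (hδ : 0 < δ) (hδR : δ < R) (hθ : 0 < θ)
    (hC : 0 < C) (hαn : α < n) (j : Fin m) : IsL2Form (T.truncKernel δ R j) B := by
  intro f g hf hg hfM hgM
  have hk := T.isTruncatedKernel hδ hδR j
  obtain ⟨M, -, hM⟩ := hk.exists_bound hC hαn
  have hf2 := memLp_two_of_integrable_of_bounded hf hfM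
  have hg2 := memLp_two_of_integrable_of_bounded hg hgM
  set u : E n → ℝ := fun x => ∫ y, T.truncKernel δ R j x y * f y with hu
  have huc : Continuous u := by
    refine continuous_of_dominated (bound := fun y => M * |f y|) (fun x => ?_) (fun x => ?_) ?_ ?_
    · exact (hk.continuous_right hθ x).aestronglyMeasurable.mul hf.aestronglyMeasurable
    · refine Eventually.of_forall fun y => ?_
      rw [norm_mul]
      exact mul_le_mul_of_nonneg_right (hM x y) (norm_nonneg _)
    · exact hf.abs.const_mul M
    · exact Eventually.of_forall fun y => (hk.continuous_left hθ y).mul continuous_const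
  have hule : eLpNorm u 2 volume ≤ B * eLpNorm f 2 volume := by
    refine (eLpNorm_mono (g := T.trunc δ R volume f) fun x => ?_).trans (h δ R hδ hδR f hf2)
    rw [hu]
    simp only
    rw [← T.trunc_apply hδ hδR hθ hC hαn hf x j]
    exact PiLp.norm_apply_le _ _
  have hmul := eLpNorm_smul_le_mul_eLpNorm (p := 2) (q := 2) (r := 1) (μ := volume)
    huc.aestronglyMeasurable hg.aestronglyMeasurable
  have h1 : ‖∫ x, g x * u x‖ₑ ≤ eLpNorm (g • u) 1 volume := by
    rw [eLpNorm_one_eq_lintegral_enorm]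
    exact enorm_integral_le_lintegral_enorm _
  have h2 := h1.trans (hmul.trans (mul_le_mul_right hule _))
  rw [eLpNorm_two_eq hf2, eLpNorm_two_eq hg2, Real.enorm_eq_ofReal_abs,
    ← ENNReal.ofReal_coe_nnreal, ← ENNReal.ofReal_mul (NNReal.coe_nonneg B),
    ← ENNReal.ofReal_mul (by positivity)]
    at h2
  refine ((ENNReal.ofReal_le_ofReal_iff (by positivity)).1 h2).trans (le_of_eq ?_)
  ring

end SingularIntegral

/-- Sufficiency of the Muckenhoupt condition. -/
lemma exists_restrictedWeakNorm_le (m : ℕ) (hn : 0 < n) (hα : 0 ≤ α) (hαn : α < n) (hθ : 0 < θ)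
    (hC : 0 < C) {ε η : ℝ} (hε : 0 < ε) (hε1 : ε < 1) (hη : η < 1) (B : ℝ≥0) :
    ∃ C₁ : ℝ≥0, 0 < C₁ ∧ ∀ (σ ω : Measure (E n)) [IsLocallyFiniteMeasure σ]
      [IsLocallyFiniteMeasure ω], IsAInftyWith ε η σ ∨ IsAInftyWith ε η ω →
      ∀ T : SingularIntegral n m α θ C, (α = 0 → T.IsL2BoundedBy B) →
        T.restrictedWeakNorm σ ω ≤ C₁ * muckenhoupt α σ ω ^ (1 / 2 : ℝ) := by
  obtain ⟨V, hV⟩ := exists_restrictedWeakType hn hα hαn hθ hC hε hε1 hη B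
  -- The triangle inequality over components gives `m * V`; adding 1 keeps the constant positive,
  -- also when m = 0, so that the right side is infinite when the Muckenhoupt constant is.
  refine ⟨m * V + 1, by positivity, fun σ ω _ _ hA T hB => ?_⟩
  rcases eq_or_ne (muckenhoupt α σ ω) ∞ with htop | hfin
  · rw [htop, ENNReal.top_rpow_of_pos (by norm_num), ENNReal.mul_top (by simp)]
    exact le_top
  refine iSup_le fun δ => iSup_le fun R => iSup_le fun hδ => iSup_le fun hδR =>
    iSup_le fun a => iSup_le fun l => iSup_le fun hl => iSup_le fun A => iSup_le fun F =>
    iSup_le fun hAc => iSup_le fun hFc => iSup_le fun _ => iSup_le fun _ => ?_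
  refine ENNReal.div_le_of_le_mul ?_
  have hcomp : ∀ j, ‖(∫ x in F, T.trunc δ R σ (A.indicator 1) x ∂ω) j‖ₑ ≤
      V * muckenhoupt α σ ω ^ (1 / 2 : ℝ) * (σ A * ω F) ^ (1 / 2 : ℝ) := by
    intro j
    have hk := T.isTruncatedKernel hδ hδR j
    have hform : α = 0 → IsL2Form (T.truncKernel δ R j) B := fun h0 =>
      T.isL2Form (hB h0) hδ hδR hθ hC hαn j
    rw [T.setIntegral_trunc_apply hAc hFc hδ hδR hθ hC hαn j]
    rcases hA with hσ | hω
    · rw [hk.integral_swap hθ hC hαn σ ω hAc hFc, muckenhoupt_swap, mul_comm (σ A)]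
      exact hV _ hk.swap (fun h0 => (hform h0).swap hk hθ hC hαn) ω σ hσ
        (by rwa [muckenhoupt_swap]) F A hFc hAc
    · exact hV _ hk hform σ ω hω hfin A F hAc hFc
  calc ‖∫ x in F, T.trunc δ R σ (A.indicator 1) x ∂ω‖ₑ
      ≤ ∑ j, ‖(∫ x in F, T.trunc δ R σ (A.indicator 1) x ∂ω) j‖ₑ := enorm_euclideanSpace_le_sum _
    _ ≤ ∑ _j : Fin m, V * muckenhoupt α σ ω ^ (1 / 2 : ℝ) * (σ A * ω F) ^ (1 / 2 : ℝ) :=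
        Finset.sum_le_sum fun j _ => hcomp j
    _ = m * V * muckenhoupt α σ ω ^ (1 / 2 : ℝ) * (σ A * ω F) ^ (1 / 2 : ℝ) := by
        simp
        ring
    _ ≤ _ := by
        gcongr
        push_cast
        exact le_self_add

/-! ### Necessity for elliptic operators -/

section Necessity

/-- Testing an elliptic operator on two well separated cubes. -/
lemma SingularIntegral.le_restrictedWeakNorm (T : SingularIntegral n m α θ C) (hαn : α < n)
    (hθ : 0 < θ) (hC : 0 < C) {c : ℝ} (hc : 0 < c) (hT : T.IsEllipticWith c) {M : ℝ}
    (hM0 : 0 < M) (hM : 4 * n ≤ M)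
    (hM' : (2 * n / M) ^ θ * (C + C * (1 / 2) ^ (α - n)) ≤ c / 4) (σ ω : Measure (E n))
    [IsLocallyFiniteMeasure σ] [IsLocallyFiniteMeasure ω] {a b v : E n} {l : ℝ} (hl : 0 < l)
    (hv : ‖v‖ = 1) (hb : b = a + (M * l) • v) :
    ENNReal.ofReal (c / 4 * (M * l) ^ (α - n)) * (σ (cube b l) * ω (cube a l)) ^ (1 / 2 : ℝ) ≤
      T.restrictedWeakNorm σ ω := by
  obtain ⟨j, hj⟩ := hT v hv
  set t := M * l with ht
  have ht0 : 0 < t := by positivity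
  have hn0 : (0 : ℝ) ≤ n := Nat.cast_nonneg n
  have hab : ‖a - b‖ = t := by
    rw [hb, sub_add_cancel_left, norm_neg, norm_smul, hv, mul_one, Real.norm_of_nonneg ht0.le]
  -- The cutoff need only be large at the single distance `t` between the corners. The truncated
  -- kernel is itself standard, so its smoothness spreads the lower bound over the two cubes.
  obtain ⟨δ, R, hδ, hδR, hcut⟩ : ∃ δ R, 0 < δ ∧ δ < R ∧ 1 / 2 < T.cutoff δ R t := by
    have h1 := (T.cutoff_tendsto t ht0).eventually_const_lt (show (1 / 2 : ℝ) < 1 by norm_num)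
    have h2 : ∀ᶠ p : ℝ × ℝ in 𝓝[>] 0 ×ˢ atTop, (0 < p.1 ∧ p.1 < 1) ∧ 1 < p.2 :=
      by
      have h3 : ∀ᶠ u : ℝ in 𝓝[>] 0, 0 < u ∧ u < 1 := Ioo_mem_nhdsGT one_pos
      exact h3.prod_mk (eventually_gt_atTop 1)
    obtain ⟨p, hp1, ⟨hp2, hp3⟩, hp4⟩ := (h1.and h2).exists
    exact ⟨p.1, p.2, hp2, hp3.trans hp4, hp1⟩
  have hk := T.isTruncatedKernel hδ hδR j
  set k := T.truncKernel δ R j with hkdef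
  set τ := t ^ (α - n) with hτ
  have hτ0 : 0 < τ := by positivity
  have hkab : c / 2 * τ ≤ |k a b| := by
    have h1 := hj a t ht0
    rw [← hb] at h1
    rw [hkdef, truncKernel, abs_mul, hab]
    have h2 : 1 / 2 ≤ |T.cutoff δ R t| := hcut.le.trans (le_abs_self _)
    calc c / 2 * τ = 1 / 2 * (c * τ) := by ring
      _ ≤ |T.cutoff δ R t| * |T.kernel a b j| := by gcongr
  have hnM : n * l ≤ t / 4 := by
    rw [ht]
    nlinarith
  have hclose : ∀ x ∈ cube a l, ∀ y ∈ cube b l, |k a b - k x y| ≤ c / 4 * τ := by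
    intro x hx y hy
    have hxa : ‖a - x‖ ≤ n * l := by
      rw [norm_sub_rev]
      exact norm_sub_le_of_mem_cube hl.le hx
    have hyb : ‖b - y‖ ≤ n * l := by
      rw [norm_sub_rev]
      exact norm_sub_le_of_mem_cube hl.le hy
    have hbx : t / 2 ≤ ‖b - x‖ := by
      have h1 : ‖a - b‖ ≤ ‖a - x‖ + ‖x - b‖ := norm_sub_le_norm_sub_add_norm_sub _ _ _
      rw [hab, norm_sub_rev x b] at h1
      linarith
    have hbx0 : 0 < ‖b - x‖ := by linarith
    have hratio1 : ‖a - x‖ / t ≤ 2 * n / M := by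
      rw [div_le_div_iff₀ ht0 hM0, ht]
      have : 0 ≤ n * l * M := by positivity
      nlinarith
    have hratio2 : ‖b - y‖ / ‖b - x‖ ≤ 2 * n / M := by
      rw [div_le_div_iff₀ hbx0 hM0]
      calc ‖b - y‖ * M ≤ n * l * M := by gcongr
        _ = 2 * n * (t / 2) := by rw [ht]; ring
        _ ≤ 2 * n * ‖b - x‖ := by gcongr
    have hle : 2 * n / M ≤ 1 / 2 := by
      rw [div_le_iff₀ hM0]
      linarith
    have e1 := hk.standard.1.2 a x b (by
      rintro rfl
      rw [sub_self, norm_zero] at hab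
      linarith) (by rw [hab]; exact hratio1.trans hle)
    have e2 := hk.standard.2.2 b y x (sub_ne_zero.1 (norm_pos_iff.1 hbx0)) (hratio2.trans hle)
    simp only at e2
    have f1 : |k a b - k x b| ≤ C * (2 * n / M) ^ θ * τ := by
      rw [hab] at e1
      refine e1.trans ?_
      gcongr
    have f2 : |k x b - k x y| ≤ C * (2 * n / M) ^ θ * ((1 / 2) ^ (α - n) * τ) := by
      refine e2.trans ?_
      have h3 : ‖b - x‖ ^ (α - n) ≤ (1 / 2) ^ (α - n) * τ := by
        rw [hτ, ← Real.mul_rpow (by norm_num) ht0.le]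
        exact Real.rpow_le_rpow_of_nonpos (by positivity) (by linarith) (by linarith)
      gcongr
    calc |k a b - k x y| ≤ |k a b - k x b| + |k x b - k x y| := abs_sub_le _ _ _
      _ ≤ C * (2 * n / M) ^ θ * τ + C * (2 * n / M) ^ θ * ((1 / 2) ^ (α - n) * τ) :=
          add_le_add f1 f2
      _ = (2 * n / M) ^ θ * (C + C * (1 / 2) ^ (α - n)) * τ := by ring
      _ ≤ c / 4 * τ := by gcongr
  -- the kernel has a constant sign on the product of the cubes
  obtain ⟨s, hs, hsk⟩ : ∃ s : ℝ, |s| = 1 ∧ ∀ x ∈ cube a l, ∀ y ∈ cube b l,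
      c / 4 * τ ≤ s * k x y := by
    rcases le_total 0 (k a b) with h0 | h0
    · refine ⟨1, by simp, fun x hx y hy => ?_⟩
      rw [abs_of_nonneg h0] at hkab
      have := (abs_le.1 (hclose x hx y hy)).2
      linarith
    · refine ⟨-1, by simp, fun x hx y hy => ?_⟩
      rw [abs_of_nonpos h0] at hkab
      have := (abs_le.1 (hclose x hx y hy)).1
      linarith
  have hAc := isCompact_cube b hl.le
  have hFc := isCompact_cube a hl.le
  have hσfin : IsFiniteMeasure (σ.restrict (cube b l)) :=
    isFiniteMeasure_restrict.2 hAc.measure_lt_top.ne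
  set I := ∫ x in cube a l, T.trunc δ R σ ((cube b l).indicator 1) x ∂ω with hI
  have hIj : c / 4 * τ * (σ.real (cube b l) * ω.real (cube a l)) ≤ |I j| := by
    rw [hI, T.setIntegral_trunc_apply hAc hFc hδ hδR hθ hC hαn j, ← hkdef]
    have hinner : ∀ x ∈ cube a l,
        c / 4 * τ * σ.real (cube b l) ≤ s * ∫ y in cube b l, k x y ∂σ := by
      intro x hx
      rw [← integral_const_mul]
      have := setIntegral_mono_on (μ := σ) (f := fun _ => c / 4 * τ)
        (integrableOn_const hAc.measure_lt_top.ne)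
        ((hk.integrable hθ hC hαn (σ.restrict (cube b l)) x).const_mul s)
        (measurableSet_cube b l) (hsk x hx)
      simpa [mul_comm] using this
    have houter : c / 4 * τ * σ.real (cube b l) * ω.real (cube a l) ≤
        s * ∫ x in cube a l, ∫ y in cube b l, k x y ∂σ ∂ω := by
      rw [← integral_const_mul]
      have := setIntegral_mono_on (μ := ω) (f := fun _ => c / 4 * τ * σ.real (cube b l))
        (integrableOn_const hFc.measure_lt_top.ne)
        (((hk.continuous_potential hθ hC hαn
          (σ.restrict (cube b l))).continuousOn.integrableOn_compact
          hFc).const_mul s)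
        (measurableSet_cube a l) hinner
      simpa [mul_comm, potential] using this
    calc c / 4 * τ * (σ.real (cube b l) * ω.real (cube a l))
        ≤ s * ∫ x in cube a l, ∫ y in cube b l, k x y ∂σ ∂ω := by
          rw [← mul_assoc]
          exact houter
      _ ≤ |s * ∫ x in cube a l, ∫ y in cube b l, k x y ∂σ ∂ω| := le_abs_self _
      _ = _ := by rw [abs_mul, hs, one_mul]
  have hIe : ENNReal.ofReal (c / 4 * τ) * (σ (cube b l) * ω (cube a l)) ≤ ‖I‖ₑ := by
    rw [← ofReal_measureReal hAc.measure_lt_top.ne, ← ofReal_measureReal hFc.measure_lt_top.ne,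
      ← ENNReal.ofReal_mul measureReal_nonneg, ← ENNReal.ofReal_mul (by positivity), ← ofReal_norm]
    exact ENNReal.ofReal_le_ofReal (hIj.trans (PiLp.norm_apply_le I j))
  have hsup : ‖I‖ₑ / (σ (cube b l) * ω (cube a l)) ^ (1 / 2 : ℝ) ≤ T.restrictedWeakNorm σ ω := by
    have hsub1 : cube b l ⊆ cube (WithLp.toLp 2 fun i => a i - t) (2 * t + l) := fun x hx i => by
      have h1 := hx i
      have h2 := (abs_apply_le_norm (a - b) i).trans hab.le
      rw [PiLp.sub_apply, abs_le] at h2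
      simp only
      constructor <;> linarith
    have hsub2 : cube a l ⊆ cube (WithLp.toLp 2 fun i => a i - t) (2 * t + l) := fun x hx i => by
      have h1 := hx i
      simp only
      constructor <;> linarith
    exact le_iSup_of_le δ <| le_iSup_of_le R <| le_iSup_of_le hδ <| le_iSup_of_le hδR <|
      le_iSup_of_le (WithLp.toLp 2 fun i => a i - t) <| le_iSup_of_le (2 * t + l) <|
      le_iSup_of_le (by positivity) <| le_iSup_of_le (cube b l) <| le_iSup_of_le (cube a l) <|
      le_iSup_of_le hAc <| le_iSup_of_le hFc <| le_iSup_of_le hsub1 <| le_iSup_of_le hsub2 le_rfl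
  refine le_trans ?_ hsup
  have hXt : σ (cube b l) * ω (cube a l) ≠ ∞ :=
    ENNReal.mul_ne_top hAc.measure_lt_top.ne hFc.measure_lt_top.ne
  generalize σ (cube b l) * ω (cube a l) = X at hIe hXt
  rcases eq_or_ne X 0 with h0 | h0
  · rw [h0, ENNReal.zero_rpow_of_pos (by norm_num), mul_zero]
    exact zero_le
  have hX0 : X ^ (1 / 2 : ℝ) ≠ 0 := by simp [h0]
  have hX1 : X ^ (1 / 2 : ℝ) ≠ ∞ := by finiteness
  rw [ENNReal.le_div_iff_mul_le (Or.inl hX0) (Or.inl hX1), mul_assoc,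
    ← ENNReal.rpow_add _ _ h0 hXt]
  norm_num
  exact hIe

/-- Necessity of the Muckenhoupt condition for elliptic operators. -/
lemma exists_muckenhoupt_le (m : ℕ) (hn : 0 < n) (hαn : α < n) (hθ : 0 < θ) (hC : 0 < C)
    {ε η : ℝ} (hε : 0 < ε) (hη : η < 1) {c : ℝ} (hc : 0 < c) :
    ∃ C₂ : ℝ≥0, 0 < C₂ ∧ ∀ (σ ω : Measure (E n)) [IsLocallyFiniteMeasure σ]
      [IsLocallyFiniteMeasure ω], IsAInftyWith ε η σ ∨ IsAInftyWith ε η ω →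
      ∀ T : SingularIntegral n m α θ C, T.IsEllipticWith c →
        muckenhoupt α σ ω ^ (1 / 2 : ℝ) ≤ C₂ * T.restrictedWeakNorm σ ω := by
  have hn0 : (0 : ℝ) < n := by exact_mod_cast hn
  obtain ⟨M, hM0, hM, hM'⟩ : ∃ M : ℝ, 0 < M ∧ 4 * n ≤ M ∧
      (2 * n / M) ^ θ * (C + C * (1 / 2) ^ (α - n)) ≤ c / 4 := by
    have hD : 0 < C + C * (1 / 2 : ℝ) ^ (α - n) := by positivity
    generalize C + C * (1 / 2 : ℝ) ^ (α - n) = D at hD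
    set τ := c / 4 / D with hτ
    have hτ0 : 0 < τ := by positivity
    -- The first entry keeps the cubes well separated; the second makes the variation of the kernel
    -- at most half of its lower bound c/2 at the corners.
    refine ⟨max (4 * (n : ℝ)) (2 * n / τ ^ θ⁻¹), by positivity, le_max_left _ _, ?_⟩
    rw [← le_div_iff₀ hD, ← hτ]
    have h1 : 2 * n / max (4 * (n : ℝ)) (2 * n / τ ^ θ⁻¹) ≤ τ ^ θ⁻¹ := by
      rw [div_le_comm₀ (by positivity) (by positivity)]
      exact le_max_right _ _
    calc (2 * n / max (4 * (n : ℝ)) (2 * n / τ ^ θ⁻¹)) ^ θ ≤ (τ ^ θ⁻¹) ^ θ := by gcongr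
      _ = τ := Real.rpow_inv_rpow hτ0.le hθ.ne'
  obtain ⟨D, hD, hdoubling⟩ := exists_forall_measure_cube_le (n := n) hε hη M
  set q : ℝ≥0 := Real.toNNReal (c / 4 * M ^ (α - n))⁻¹ with hq
  have hq0 : 0 < q := by
    rw [hq, Real.toNNReal_pos]
    positivity
  refine ⟨D ^ (1 / 2 : ℝ) * q, by positivity, fun σ ω _ _ hA T hT => ?_⟩
  set N := T.restrictedWeakNorm σ ω
  set e : E n := EuclideanSpace.single ⟨0, hn⟩ 1 with he
  have hen : ‖e‖ = 1 := by simp [he]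
  have hterm : ∀ (a : E n) (l : ℝ), 0 < l →
      σ (cube a l) / volume (cube a l) ^ (1 - α / n) *
        (ω (cube a l) / volume (cube a l) ^ (1 - α / n)) ≤ D * (q * N) ^ 2 := by
    intro a l hl
    set a' := a + (M * l) • e with ha'
    have hcoord : ∀ i, |a' i - a i| ≤ M * l := by
      intro i
      rw [ha', PiLp.add_apply, add_sub_cancel_left, PiLp.smul_apply, smul_eq_mul, abs_mul,
        abs_of_pos (by positivity : 0 < M * l)]
      have := (abs_apply_le_norm e i).trans hen.le
      have : 0 < M * l := by positivity
      nlinarith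
    have haa' : a = a' + (M * l) • (-e) := by
      rw [ha', smul_neg, add_neg_cancel_right]
    -- Only the cube of the A_∞ weight is displaced, and doubling brings it back. When that weight
    -- is `ω` the base cube is the one at `a'`, so the direction is reversed.
    obtain ⟨X, hX1, hX2⟩ : ∃ X : ℝ≥0∞, σ (cube a l) * ω (cube a l) ≤ D * X ∧
        ENNReal.ofReal (c / 4 * (M * l) ^ (α - n)) * X ^ (1 / 2 : ℝ) ≤ N := by
      rcases hA with hσ | hω
      · refine ⟨σ (cube a' l) * ω (cube a l), ?_,
          T.le_restrictedWeakNorm hαn hθ hC hc hT hM0 hM hM' σ ω hl hen ha'⟩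
        rw [← mul_assoc]
        gcongr
        exact hdoubling σ hσ a' a l hl fun i => by rw [abs_sub_comm]; exact hcoord i
      · refine ⟨σ (cube a l) * ω (cube a' l), ?_,
          T.le_restrictedWeakNorm hαn hθ hC hc hT hM0 hM hM' σ ω hl (by rwa [norm_neg]) haa'⟩
        rw [mul_left_comm]
        gcongr
        exact hdoubling ω hω a' a l hl fun i => by rw [abs_sub_comm]; exact hcoord i
    have hX3 : ENNReal.ofReal (l ^ (α - n)) * X ^ (1 / 2 : ℝ) ≤ q * N := by
      have h1 : ENNReal.ofReal (l ^ (α - n)) =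
          q * ENNReal.ofReal (c / 4 * (M * l) ^ (α - n)) := by
        have h2 : (q : ℝ≥0∞) = ENNReal.ofReal (c / 4 * M ^ (α - n))⁻¹ := rfl
        rw [h2, ← ENNReal.ofReal_mul (by positivity), Real.mul_rpow hM0.le hl.le, ← mul_assoc,
          ← mul_assoc, mul_assoc _ (c / 4), inv_mul_cancel₀ (by positivity), one_mul]
      rw [h1, mul_assoc]
      gcongr
    have hX4 : (X ^ (1 / 2 : ℝ)) ^ 2 = X := by
      rw [← ENNReal.rpow_natCast, ← ENNReal.rpow_mul]
      norm_num
    rw [volume_cube_rpow hn a hl, div_eq_mul_inv, div_eq_mul_inv,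
      ← ENNReal.ofReal_inv_of_pos (by positivity), ← Real.rpow_neg hl.le, neg_sub]
    calc σ (cube a l) * ENNReal.ofReal (l ^ (α - n)) * (ω (cube a l) * ENNReal.ofReal (l ^ (α - n)))
        = σ (cube a l) * ω (cube a l) * ENNReal.ofReal (l ^ (α - n)) ^ 2 := by ring
      _ ≤ D * X * ENNReal.ofReal (l ^ (α - n)) ^ 2 := by gcongr
      _ = D * (ENNReal.ofReal (l ^ (α - n)) * X ^ (1 / 2 : ℝ)) ^ 2 := by
          rw [mul_pow, hX4]
          ring
      _ ≤ _ := by gcongr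
  have hmuck : muckenhoupt α σ ω ≤ D * (q * N) ^ 2 :=
    iSup_le fun a => iSup_le fun l => iSup_le fun hl => hterm a l hl
  have h12 : (0 : ℝ) ≤ 1 / 2 := by norm_num
  calc muckenhoupt α σ ω ^ (1 / 2 : ℝ) ≤ (D * (q * N) ^ 2) ^ (1 / 2 : ℝ) :=
        ENNReal.rpow_le_rpow hmuck h12
    _ = D ^ (1 / 2 : ℝ) * (q * N) := by
        rw [ENNReal.mul_rpow_of_nonneg _ _ h12, ← ENNReal.rpow_natCast, ← ENNReal.rpow_mul]
        norm_num
    _ = _ := by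
        rw [ENNReal.coe_mul, ENNReal.coe_rpow_of_nonneg _ h12, mul_assoc]

end Necessity

end RestrictedWeak

/-! ### The equivalence and the two quantitative bounds -/

theorem theorem1 (n m : ℕ) (α : ℝ) (hα : 0 ≤ α) (hαn : α < n)
    (θ C : ℝ) (hθ : 0 < θ) (hC : 0 < C) :
    -- the restricted weak type inequality holds if, and for elliptic `T` only if,
    -- the Muckenhoupt constant is finite
    (∀ (σ ω : Measure (RestrictedWeak.E n)) [IsLocallyFiniteMeasure σ]
        [IsLocallyFiniteMeasure ω],
      RestrictedWeak.IsAInfty σ ∨ RestrictedWeak.IsAInfty ω →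
      ∀ T : RestrictedWeak.SingularIntegral n m α θ C,
        (α = 0 → ∃ B : ℝ≥0, T.IsL2BoundedBy B) →
        (RestrictedWeak.muckenhoupt α σ ω < ∞ → T.restrictedWeakNorm σ ω < ∞) ∧
        (T.IsElliptic →
          T.restrictedWeakNorm σ ω < ∞ → RestrictedWeak.muckenhoupt α σ ω < ∞)) ∧
    -- for elliptic `T` the norm is comparable to the square root of the Muckenhoupt constant
    (∀ ε η : ℝ, 0 < ε → ε < 1 → 0 < η → η < 1 →
      (∀ B : ℝ≥0, ∃ C₁ : ℝ≥0, 0 < C₁ ∧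
        ∀ (σ ω : Measure (RestrictedWeak.E n)) [IsLocallyFiniteMeasure σ]
          [IsLocallyFiniteMeasure ω],
        RestrictedWeak.IsAInftyWith ε η σ ∨ RestrictedWeak.IsAInftyWith ε η ω →
        ∀ T : RestrictedWeak.SingularIntegral n m α θ C,
          (α = 0 → T.IsL2BoundedBy B) → T.IsElliptic →
          T.restrictedWeakNorm σ ω ≤
            C₁ * RestrictedWeak.muckenhoupt α σ ω ^ (1 / 2 : ℝ)) ∧
      (∀ c : ℝ, 0 < c → ∃ C₂ : ℝ≥0, 0 < C₂ ∧
        ∀ (σ ω : Measure (RestrictedWeak.E n)) [IsLocallyFiniteMeasure σ]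
          [IsLocallyFiniteMeasure ω],
        RestrictedWeak.IsAInftyWith ε η σ ∨ RestrictedWeak.IsAInftyWith ε η ω →
        ∀ T : RestrictedWeak.SingularIntegral n m α θ C,
          (α = 0 → ∃ B : ℝ≥0, T.IsL2BoundedBy B) → T.IsEllipticWith c →
          RestrictedWeak.muckenhoupt α σ ω ^ (1 / 2 : ℝ) ≤
            C₂ * T.restrictedWeakNorm σ ω)) := by
  have hn : 0 < n := by
    rcases Nat.eq_zero_or_pos n with h | h
    · simp [h] at hαn
      linarith
    · exact h
  refine ⟨fun σ ω _ _ hA T hB => ⟨fun hfin => ?_, fun ⟨c, hc, hT⟩ hfin => ?_⟩,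
    fun ε η hε hε1 hη hη1 => ⟨fun B => ?_, fun c hc => ?_⟩⟩
  · obtain ⟨ε, η, hε, hε1, hη, hη1, hA'⟩ : ∃ ε η : ℝ, 0 < ε ∧ ε < 1 ∧ 0 < η ∧ η < 1 ∧
        (RestrictedWeak.IsAInftyWith ε η σ ∨ RestrictedWeak.IsAInftyWith ε η ω) := by
      rcases hA with ⟨ε, η, h1, h2, h3, h4, h⟩ | ⟨ε, η, h1, h2, h3, h4, h⟩
      · exact ⟨ε, η, h1, h2, h3, h4, Or.inl h⟩
      · exact ⟨ε, η, h1, h2, h3, h4, Or.inr h⟩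
    obtain ⟨B, hB'⟩ : ∃ B : ℝ≥0, α = 0 → T.IsL2BoundedBy B := by
      by_cases h0 : α = 0
      · obtain ⟨B, h⟩ := hB h0
        exact ⟨B, fun _ => h⟩
      -- For α > 0 no L² bound is required, and any value of `B` will do.
      · exact ⟨0, fun h => absurd h h0⟩
    obtain ⟨C₁, -, h⟩ := RestrictedWeak.exists_restrictedWeakNorm_le m hn hα hαn hθ hC hε hε1 hη1 B
    refine (h σ ω hA' T hB').trans_lt ?_
    exact ENNReal.mul_lt_top ENNReal.coe_lt_top
      (ENNReal.rpow_lt_top_of_nonneg (by norm_num) hfin.ne)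
  · obtain ⟨ε, η, hε, hη1, hA'⟩ : ∃ ε η : ℝ, 0 < ε ∧ η < 1 ∧
        (RestrictedWeak.IsAInftyWith ε η σ ∨ RestrictedWeak.IsAInftyWith ε η ω) := by
      rcases hA with ⟨ε, η, h1, -, -, h4, h⟩ | ⟨ε, η, h1, -, -, h4, h⟩
      · exact ⟨ε, η, h1, h4, Or.inl h⟩
      · exact ⟨ε, η, h1, h4, Or.inr h⟩
    obtain ⟨C₂, -, h⟩ := RestrictedWeak.exists_muckenhoupt_le m hn hαn hθ hC hε hη1 hc
    have h1 := (h σ ω hA' T hT).trans_lt (ENNReal.mul_lt_top ENNReal.coe_lt_top hfin)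
    exact (ENNReal.rpow_lt_top_iff_of_pos (by norm_num)).1 h1
  · obtain ⟨C₁, hC₁, h⟩ :=
      RestrictedWeak.exists_restrictedWeakNorm_le m hn hα hαn hθ hC hε hε1 hη1 B
    exact ⟨C₁, hC₁, fun σ ω _ _ hA T hB _ => h σ ω hA T hB⟩
  · obtain ⟨C₂, hC₂, h⟩ := RestrictedWeak.exists_muckenhoupt_le m hn hαn hθ hC hε hη1 hc
    exact ⟨C₂, hC₂, fun σ ω _ _ hA T _ hT => h σ ω hA T hT⟩
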